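/- Let $S$ be an oriented smooth surface (Hausdorff and second countable, possibly with boundary or corners; for instance any oriented surface of finite type, such as a closed surface or the plane). For a subset $K\subset S$ let $\mathrm{Diff}(S,K)$ be the group of orientation-preserving $C^\infty$-diffeomorphisms $f$ of $S$ with $f(K)=K$, endowed with the (compact-open) $C^\infty$ topology, let $\mathrm{Diff}_0(S,K)$ be the connected component of the identity in $\mathrm{Diff}(S,K)$, and let $$\mathcal{M}^\infty(S,K)=\mathrm{Diff}(S,K)/\mathrm{Diff}_0(S,K).$$ Let $0<\lambda<1/2$ and let $C_\lambda\subset[0,1]$ be the central Cantor set with parameter $\lambda$: $C_\lambda=\bigcap_{n\ge 0}\bigcup\mathcal{I}_n$, where $\mathcal{I}_0=\{[0,1]\}$ and $\mathcal{I}_{n+1}$ is obtained from $\mathcal{I}_n$ by removing from each interval $J\in\mathcal{I}_n$ the central open interval of length $(1-2\lambda)|J|$. Let $e:[0,1]\to S$ be a smooth embedding, and write again $C_\lambda$ for the subset $e(C_\lambda)$ of $S$. As $C_\lambda$ is totally disconnected, $\mathcal{M}^\infty(S,C_\lambda)$ acts on $C_\lambda$: the class of $f$ sends $p$ to $f(p)$.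 **Theorem.** Let $\Gamma$ be a finitely generated subgroup of $\mathcal{M}^\infty(S,C_\lambda)$. Then at least one of the following holds: 1. $\Gamma$ contains a free subgroup on two generators. 2. $\Gamma$ has a finite orbit on $C_\lambda$, i.e. there exists $p\in C_\lambda$ such that the set $\Gamma(p)=\{g(p)\mid g\in\Gamma\}$ is finite. -/

import Mathlib

open scoped Manifold ContDiff Topology

universe v w

noncomputable section

/-! ### The group of smooth diffeomorphisms of a manifold and its `C^∞` topology -/

section DiffeoGroup

variable {E : Type} [NormedAddCommGroup E] [NormedSpace ℝ E] {H : Type v} [TopologicalSpace H]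
  {I : ModelWithCorners ℝ E H} {M : Type w} [TopologicalSpace M] [ChartedSpace H M]

/-- Smooth self-diffeomorphisms form a group under composition, `(f * g) x = f (g x)`. -/
instance diffeoGroup : Group (M ≃ₘ⟮I, I⟯ M) where
  mul f g := g.trans f
  one := Diffeomorph.refl I M ∞
  inv f := f.symm
  mul_assoc _ _ _ := rfl
  one_mul _ := rfl
  mul_one _ := rfl
  inv_mul_cancel f := Diffeomorph.self_trans_symm f

theorem diffeo_mul_apply (f g : M ≃ₘ⟮I, I⟯ M) (x : M) : (f * g) x = f (g x) := rfl

theorem diffeo_one_apply (x : M) : (1 : M ≃ₘ⟮I, I⟯ M) x = x := rfl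

theorem diffeo_apply_inv (f : M ≃ₘ⟮I, I⟯ M) (x : M) : f (f⁻¹ x) = x := f.apply_symm_apply x

theorem diffeo_inv_apply (f : M ≃ₘ⟮I, I⟯ M) (x : M) : f⁻¹ (f x) = x := f.symm_apply_apply x

/-- The underlying continuous map of a diffeomorphism. -/
def diffeoToC (f : M ≃ₘ⟮I, I⟯ M) : C(M, M) := ⟨f, f.continuous⟩

/-- The tangent map of a diffeomorphism, as a diffeomorphism of the tangent bundle. -/
def tangentDiffeo [IsManifold I ∞ M] (f : M ≃ₘ⟮I, I⟯ M) :
    TangentBundle I M ≃ₘ⟮I.tangent, I.tangent⟯ TangentBundle I M where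
  toFun := tangentMap I I f
  invFun := tangentMap I I f.symm
  left_inv p := by
    have h := tangentMap_comp (I := I) (I' := I) (I'' := I)
      (f.symm.mdifferentiable (by simp)) (f.mdifferentiable (by simp))
    have h2 : (f.symm ∘ f : M → M) = id := funext f.symm_apply_apply
    rw [h2, tangentMap_id] at h
    exact (congrFun h p).symm
  right_inv p := by
    have h := tangentMap_comp (I := I) (I' := I) (I'' := I)
      (f.mdifferentiable (by simp)) (f.symm.mdifferentiable (by simp))
    have h2 : (f ∘ f.symm : M → M) = id := funext f.apply_symm_apply
    rw [h2, tangentMap_id] at h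
    exact (congrFun h p).symm
  contMDiff_toFun := f.contMDiff.contMDiff_tangentMap (by simp)
  contMDiff_invFun := f.symm.contMDiff.contMDiff_tangentMap (by simp)

theorem tangentDiffeo_mul [IsManifold I ∞ M] (f g : M ≃ₘ⟮I, I⟯ M) :
    tangentDiffeo (f * g) = tangentDiffeo f * tangentDiffeo g := by
  apply Diffeomorph.ext
  intro p
  exact congrFun (tangentMap_comp (I := I) (I' := I) (I'' := I)
    (f.mdifferentiable (by simp)) (g.mdifferentiable (by simp))) p

end DiffeoGroup

/-- The compact-open `C^k` topology on the group of diffeomorphisms of `M`: the topology of uniform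
convergence on compact sets of the `k`-th iterated tangent map `T^k f : T^k M → T^k M` (in charts:
of all partial derivatives of order at most `k`). -/
@[reducible] def ckTopology : (k : ℕ) → {E : Type} → [NormedAddCommGroup E] → [NormedSpace ℝ E] →
    {H : Type v} → [TopologicalSpace H] → (I : ModelWithCorners ℝ E H) →
    (M : Type w) → [TopologicalSpace M] → [ChartedSpace H M] → [IsManifold I ∞ M] →
    TopologicalSpace (M ≃ₘ⟮I, I⟯ M)
  | 0, _, _, _, _, _, _, _, _, _, _ => TopologicalSpace.induced diffeoToC inferInstance
  | k + 1, _, _, _, _, _, I, M, _, _, _ =>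
      TopologicalSpace.induced tangentDiffeo (ckTopology k I.tangent (TangentBundle I M))

theorem ckTopology_continuous_mul_left (k : ℕ) : ∀ {E : Type} [NormedAddCommGroup E]
    [NormedSpace ℝ E] {H : Type v} [TopologicalSpace H] (I : ModelWithCorners ℝ E H)
    (M : Type w) [TopologicalSpace M] [ChartedSpace H M] [IsManifold I ∞ M]
    (f : M ≃ₘ⟮I, I⟯ M), @Continuous _ _ (ckTopology k I M) (ckTopology k I M) (fun g => f * g) := by
  induction k with
  | zero =>
    intro E _ _ H _ I M _ _ _ f
    let : TopologicalSpace (M ≃ₘ⟮I, I⟯ M) := ckTopology 0 I M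
    have h : Continuous (diffeoToC : (M ≃ₘ⟮I, I⟯ M) → C(M, M)) := continuous_induced_dom
    exact continuous_induced_rng.2 ((ContinuousMap.continuous_postcomp (diffeoToC f)).comp h)
  | succ k ih =>
    intro E _ _ H _ I M _ _ _ f
    refine continuous_induced_rng.2 ?_
    have h := ih I.tangent (TangentBundle I M) (tangentDiffeo f)
    have h2 : (tangentDiffeo ∘ fun g : M ≃ₘ⟮I, I⟯ M => f * g)
        = (fun g => tangentDiffeo f * g) ∘ tangentDiffeo :=
      funext fun g => tangentDiffeo_mul f g
    rw [h2]
    exact @Continuous.comp _ _ _ (ckTopology (k + 1) I M)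
      (ckTopology k I.tangent (TangentBundle I M)) (ckTopology k I.tangent (TangentBundle I M))
      _ _ h continuous_induced_dom

theorem ckTopology_continuous_mul_right (k : ℕ) : ∀ {E : Type} [NormedAddCommGroup E]
    [NormedSpace ℝ E] {H : Type v} [TopologicalSpace H] (I : ModelWithCorners ℝ E H)
    (M : Type w) [TopologicalSpace M] [ChartedSpace H M] [IsManifold I ∞ M]
    (f : M ≃ₘ⟮I, I⟯ M), @Continuous _ _ (ckTopology k I M) (ckTopology k I M) (fun g => g * f) := by
  induction k with
  | zero =>
    intro E _ _ H _ I M _ _ _ f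
    let : TopologicalSpace (M ≃ₘ⟮I, I⟯ M) := ckTopology 0 I M
    have h : Continuous (diffeoToC : (M ≃ₘ⟮I, I⟯ M) → C(M, M)) := continuous_induced_dom
    exact continuous_induced_rng.2 ((ContinuousMap.continuous_precomp (diffeoToC f)).comp h)
  | succ k ih =>
    intro E _ _ H _ I M _ _ _ f
    refine continuous_induced_rng.2 ?_
    have h := ih I.tangent (TangentBundle I M) (tangentDiffeo f)
    have h2 : (tangentDiffeo ∘ fun g : M ≃ₘ⟮I, I⟯ M => g * f)
        = (fun g => g * tangentDiffeo f) ∘ tangentDiffeo :=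
      funext fun g => tangentDiffeo_mul g f
    rw [h2]
    exact @Continuous.comp _ _ _ (ckTopology (k + 1) I M)
      (ckTopology k I.tangent (TangentBundle I M)) (ckTopology k I.tangent (TangentBundle I M))
      _ _ h continuous_induced_dom

section SmoothTopology

variable {E : Type} [NormedAddCommGroup E] [NormedSpace ℝ E] {H : Type v} [TopologicalSpace H]
  {I : ModelWithCorners ℝ E H} {M : Type w} [TopologicalSpace M] [ChartedSpace H M]
  [IsManifold I ∞ M]

/-- The (compact-open) `C^∞` topology on the group of diffeomorphisms: the coarsest topology finer
than all the `C^k` topologies. -/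
instance smoothTopology : TopologicalSpace (M ≃ₘ⟮I, I⟯ M) := ⨅ k : ℕ, ckTopology k I M

theorem smoothTopology_continuous_mul_left (f : M ≃ₘ⟮I, I⟯ M) :
    Continuous (fun g : M ≃ₘ⟮I, I⟯ M => f * g) :=
  continuous_iInf_rng.2 fun k => continuous_iInf_dom (ckTopology_continuous_mul_left k I M f)

theorem smoothTopology_continuous_mul_right (f : M ≃ₘ⟮I, I⟯ M) :
    Continuous (fun g : M ≃ₘ⟮I, I⟯ M => g * f) :=
  continuous_iInf_rng.2 fun k => continuous_iInf_dom (ckTopology_continuous_mul_right k I M f)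

theorem smoothTopology_continuous_eval (x : M) : Continuous (fun g : M ≃ₘ⟮I, I⟯ M => g x) :=
  continuous_iInf_dom (i := 0)
    (@Continuous.comp _ _ _ (ckTopology 0 I M) _ _ _ _
      (ContinuousEvalConst.continuous_eval_const (F := C(M, M)) x) continuous_induced_dom)

end SmoothTopology

/-! ### Oriented surfaces -/

section Surface

variable {H : Type v} [TopologicalSpace H] (I : ModelWithCorners ℝ (EuclideanSpace ℝ (Fin 2)) H)
  (S : Type w) [TopologicalSpace S] [ChartedSpace H S] [IsManifold I ∞ S]

/-- An orientation of a smooth surface: an orientation of each tangent plane, which is locally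
constant in the local trivializations of the tangent bundle given by the charts. -/
structure SurfaceOrientation where
  /-- The orientation of the tangent plane at a point. -/
  orient : ∀ x : S, Orientation ℝ (TangentSpace I x) (Fin 2)
  locallyConstant : ∀ x₀ : S, IsLocallyConstant
    fun x : (trivializationAt (EuclideanSpace ℝ (Fin 2)) (TangentSpace I : S → Type) x₀).baseSet =>
      Orientation.map (Fin 2)
        ((trivializationAt (EuclideanSpace ℝ (Fin 2))
          (TangentSpace I : S → Type) x₀).continuousLinearEquivAt ℝ x x.2).toLinearEquiv
        (orient x)

variable {I S}

/-- The differential of a diffeomorphism at a point, as a linear isomorphism. -/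
def diffeoDeriv (f : S ≃ₘ⟮I, I⟯ S) (x : S) : TangentSpace I x ≃ₗ[ℝ] TangentSpace I (f x) :=
  (f.mfderivToContinuousLinearEquiv (by simp) x).toLinearEquiv

/-- A diffeomorphism is orientation-preserving if its differential at each point carries the
orientation at that point to the orientation at the image point. -/
def PreservesOrientation (o : SurfaceOrientation I S) (f : S ≃ₘ⟮I, I⟯ S) : Prop :=
  ∀ x : S, Orientation.map (Fin 2) (diffeoDeriv f x) (o.orient x) = o.orient (f x)

theorem orientation_map_map {V₁ V₂ V₃ : Type} [AddCommGroup V₁] [Module ℝ V₁] [AddCommGroup V₂]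
    [Module ℝ V₂] [AddCommGroup V₃] [Module ℝ V₃] (a : V₁ ≃ₗ[ℝ] V₂) (b : V₂ ≃ₗ[ℝ] V₃)
    (o : Orientation ℝ V₁ (Fin 2)) :
    Orientation.map (Fin 2) b (Orientation.map (Fin 2) a o)
      = Orientation.map (Fin 2) (a.trans b) o := by
  induction o using Module.Ray.ind with
  | h v hv => rfl

set_option linter.unusedSectionVars false in
theorem diffeoDeriv_one (x : S) :
    diffeoDeriv (1 : S ≃ₘ⟮I, I⟯ S) x = LinearEquiv.refl ℝ (TangentSpace I x) := by
  ext v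
  exact congrArg (fun L : TangentSpace I x →L[ℝ] TangentSpace I x => L v) (mfderiv_id (I := I))

set_option linter.unusedSectionVars false in
theorem diffeoDeriv_mul (f g : S ≃ₘ⟮I, I⟯ S) (x : S) :
    diffeoDeriv (f * g) x = (diffeoDeriv g x).trans (diffeoDeriv f (g x)) := by
  ext v
  exact congrArg (fun L : TangentSpace I x →L[ℝ] TangentSpace I (f (g x)) => L v)
    (mfderiv_comp (I' := I) x (f.mdifferentiable (by simp) (g x)) (g.mdifferentiable (by simp) x))

theorem PreservesOrientation.one (o : SurfaceOrientation I S) : PreservesOrientation o 1 := by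
  intro x
  rw [diffeoDeriv_one]
  exact congrArg (fun F => F (o.orient x)) (Orientation.map_refl (Fin 2))

theorem PreservesOrientation.mul {o : SurfaceOrientation I S} {f g : S ≃ₘ⟮I, I⟯ S}
    (hf : PreservesOrientation o f) (hg : PreservesOrientation o g) :
    PreservesOrientation o (f * g) := by
  intro x
  rw [diffeoDeriv_mul]
  refine (orientation_map_map (diffeoDeriv g x) (diffeoDeriv f (g x)) (o.orient x)).symm.trans ?_
  rw [hg x, hf (g x)]
  rfl

theorem PreservesOrientation.inv {o : SurfaceOrientation I S} {f : S ≃ₘ⟮I, I⟯ S}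
    (hf : PreservesOrientation o f) : PreservesOrientation o f⁻¹ := by
  intro x
  obtain ⟨y, rfl⟩ : ∃ y, f y = x := ⟨f⁻¹ x, diffeo_apply_inv f x⟩
  have h1 := diffeoDeriv_mul f⁻¹ f y
  have h2 : PreservesOrientation o (f⁻¹ * f) := by
    rw [inv_mul_cancel]; exact PreservesOrientation.one o
  have h3 := h2 y
  rw [h1] at h3
  rw [← hf y]
  exact (orientation_map_map (diffeoDeriv f y) (diffeoDeriv f⁻¹ (f y)) (o.orient y)).trans h3

/-! ### The smooth mapping class group of a surface relative to a subset -/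

/-- `Diff(S, K)`: the group of orientation-preserving smooth diffeomorphisms `f` of the oriented
surface `S` with `f(K) = K`. -/
def relDiffeo (o : SurfaceOrientation I S) (K : Set S) : Subgroup (S ≃ₘ⟮I, I⟯ S) where
  carrier := {f | PreservesOrientation o f ∧ f '' K = K}
  one_mem' := ⟨PreservesOrientation.one o, by
    change (fun x : S => x) '' K = K
    simp⟩
  mul_mem' := by
    rintro f g ⟨hf, hfK⟩ ⟨hg, hgK⟩
    refine ⟨hf.mul hg, ?_⟩
    change (fun x : S => f (g x)) '' K = K
    rw [← Set.image_image, hgK, hfK]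
  inv_mem' := by
    rintro f ⟨hf, hfK⟩
    refine ⟨hf.inv, ?_⟩
    conv_lhs => rw [← hfK]
    rw [Set.image_image]
    simp only [diffeo_inv_apply, Set.image_id']

theorem relDiffeo_continuous_mul_left {o : SurfaceOrientation I S} {K : Set S}
    (f : relDiffeo o K) : Continuous (fun g : relDiffeo o K => f * g) :=
  Continuous.subtype_mk ((smoothTopology_continuous_mul_left f.1).comp continuous_subtype_val) _

theorem relDiffeo_continuous_mul_right {o : SurfaceOrientation I S} {K : Set S}
    (f : relDiffeo o K) : Continuous (fun g : relDiffeo o K => g * f) :=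
  Continuous.subtype_mk ((smoothTopology_continuous_mul_right f.1).comp continuous_subtype_val) _

/-- `Diff₀(S, K)`: the connected component of the identity in `Diff(S, K)` (with the `C^∞`
topology). -/
def relDiffeoZero (o : SurfaceOrientation I S) (K : Set S) : Subgroup (relDiffeo o K) where
  carrier := connectedComponent (1 : relDiffeo o K)
  one_mem' := mem_connectedComponent
  mul_mem' := by
    intro f g hf hg
    have h := (relDiffeo_continuous_mul_right g).image_connectedComponent_subset 1
    rw [one_mul, ← connectedComponent_eq hg] at h
    exact h ⟨f, hf, rfl⟩
  inv_mem' := by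
    intro f hf
    have h := (relDiffeo_continuous_mul_left f⁻¹).image_connectedComponent_subset f
    rw [inv_mul_cancel, ← connectedComponent_eq hf] at h
    exact h ⟨1, mem_connectedComponent, mul_one _⟩

instance relDiffeoZero_normal (o : SurfaceOrientation I S) (K : Set S) :
    (relDiffeoZero o K).Normal where
  conj_mem f hf g := by
    have hc : Continuous (fun h : relDiffeo o K => g * h * g⁻¹) :=
      (relDiffeo_continuous_mul_right g⁻¹).comp (relDiffeo_continuous_mul_left g)
    have h := hc.image_connectedComponent_subset 1
    rw [mul_one, mul_inv_cancel] at h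
    exact h ⟨f, hf, rfl⟩

/-- The smooth mapping class group `𝓜^∞(S, K) = Diff(S, K) / Diff₀(S, K)`. -/
abbrev SmoothMCG (o : SurfaceOrientation I S) (K : Set S) : Type w :=
  relDiffeo o K ⧸ relDiffeoZero o K

/-- If `K` is totally disconnected, two diffeomorphisms in the same mapping class coincide on `K`,
so that the mapping class group acts on `K`. -/
theorem apply_eq_of_mk_eq {o : SurfaceOrientation I S} {K : Set S} (hK : IsTotallyDisconnected K)
    {f g : relDiffeo o K} (h : (f : SmoothMCG o K) = g) {p : S} (hp : p ∈ K) :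
    f.1 p = g.1 p := by
  have h0 : f⁻¹ * g ∈ connectedComponent (1 : relDiffeo o K) := QuotientGroup.eq.1 h
  have hc : Continuous (fun k : relDiffeo o K => k.1 p) :=
    (smoothTopology_continuous_eval p).comp continuous_subtype_val
  have hpre : IsPreconnected ((fun k : relDiffeo o K => k.1 p) '' connectedComponent 1) :=
    isPreconnected_connectedComponent.image _ hc.continuousOn
  have hsub : ((fun k : relDiffeo o K => k.1 p) '' connectedComponent 1) ⊆ K := by
    rintro _ ⟨k, -, rfl⟩
    have hk := k.2.2
    exact hk.subset ⟨p, hp, rfl⟩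
  have h1 := hK _ hsub hpre ⟨_, h0, rfl⟩ ⟨1, mem_connectedComponent, rfl⟩
  have h2 : f.1 ((f⁻¹ * g : relDiffeo o K).1 p) = f.1 p := congrArg f.1 h1
  rw [← h2]
  exact diffeo_apply_inv f.1 (g.1 p)

/-- The orbit `Γ(p) = {g(p) | g ∈ Γ}` of a point `p` under a group `Γ` of mapping classes relative
to `K`, where a class acts through its representatives. For `p ∈ K` and `K` totally disconnected,
the choice of the representative is irrelevant (`apply_eq_of_mk_eq`). -/
def mcgOrbit {o : SurfaceOrientation I S} {K : Set S} (Γ : Subgroup (SmoothMCG o K)) (p : S) :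
    Set S :=
  {q | ∃ f : relDiffeo o K, (f : SmoothMCG o K) ∈ Γ ∧ f.1 p = q}

variable (I)

/-- `e` restricts to a smooth embedding of the segment `[0, 1]` in the surface: it is smooth and
injective on `[0, 1]`, with a derivative that vanishes nowhere on `[0, 1]` (as `[0, 1]` is compact
and surfaces are Hausdorff, it is then a homeomorphism onto its image). -/
structure IsEmbeddedSegment (e : ℝ → S) : Prop where
  contMDiffOn : ContMDiffOn 𝓘(ℝ, ℝ) I ∞ e (Set.Icc 0 1)
  injOn : Set.InjOn e (Set.Icc 0 1)
  deriv_ne_zero : ∀ t ∈ Set.Icc (0 : ℝ) 1, mfderivWithin 𝓘(ℝ, ℝ) I e (Set.Icc 0 1) t ≠ 0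

end Surface

/-! ### The central Cantor set with parameter `l` -/

/-- The end points `(a, b)` of the `2 ^ n` intervals `[a, b]` of step `n` of the construction of the
central Cantor set: each interval `[a, b]` of a step is replaced in the next one by the two
intervals that remain when the central open interval of length `(1 - 2 l) (b - a)` is removed. -/
def cantorIntervals (l : ℝ) : ℕ → Set (ℝ × ℝ)
  | 0 => {(0, 1)}
  | n + 1 =>
      (fun J : ℝ × ℝ => (J.1, J.1 + l * (J.2 - J.1))) '' cantorIntervals l n ∪
      (fun J : ℝ × ℝ => (J.2 - l * (J.2 - J.1), J.2)) '' cantorIntervals l n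

/-- The central Cantor set `C_l ⊆ [0, 1]`, the intersection over `n` of the unions of the intervals
of step `n`. -/
def centralCantorSet (l : ℝ) : Set ℝ :=
  ⋂ n : ℕ, ⋃ J ∈ cantorIntervals l n, Set.Icc J.1 J.2

end

set_option linter.unusedSectionVars false

/-! The gaps of the Cantor set have lengths `(1 - 2 * l) * l ^ n`. A diffeomorphism preserving the
set carries small gaps to gaps and multiplies their lengths by nearly its derivative along the
segment. Since two powers of `l` within a factor less than 2 of each other are equal, all gaps near
a given point are multiplied by the same power of `l`. As `2 * l < 1`, the Cantor set has length
zero, so gaps determine distances. Hence the map is, near each point, an exact similarity that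
carries the intervals of the construction ("cylinders") to cylinders: `strictDiff_of_contMDiff` and
`StrictDiff.exists_localSimilar`. The surface plays no further role, and what remains is a statement
on finitely generated groups of local similarities, `ActsByLocalSimilarities.free_or_finite_orbit`.

The exponent of the ratio of `g` at `x` is an integer cocycle (`exists_cocycle`), thought of as a
height. There are finitely many cylinders of a given step, so the pigeonhole principle applied to
well-chosen times along an orbit produces returns to one cylinder that are isometric or contracting.
For the powers of one element this gives the trichotomy `ActsByLocalSimilarities.trichotomy`: each
point is locally periodic, or in the basin of an attracting cycle, or on a repelling cycle. For
words in finitely many generators it gives `ActsByLocalSimilarities.exists_contraction`: an infinite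
orbit forces a contracting element.

If all orbits are infinite, restrict to a minimal closed invariant set `X`, which is perfect. A
contracting element `φ` is not locally periodic on `X`; it has a finite set `A` of attractors, a
finite set `R` of repellers and a clopen set `F` of locally periodic points, and its suitable powers
push everything off `F` and away from `R` towards `A`. By minimality, finitely many translates of a
neighborhood of an attracting point cover `X`; multiplying conjugates whose sets `F` avoid these
translates one after the other removes `F` altogether (`Trichotomy.exists_pushing_empty`). Neumann's
lemma (`exists_forall_smul_notMem`) moves finite sets off each other, so two conjugates of the
resulting dynamics play ping-pong (`exists_free_of_trichotomy`). -/

namespace CantorTits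

open Filter Set MulAction Pointwise

/-! ### Attracting-repelling dynamics and ping-pong on compact minimal spaces -/

section PingPong

variable {G : Type*} {X : Type*} [Group G] [MulAction G X]

/-- If all orbits of a group action are infinite, any finite set can be moved off any other finite
set (a form of B. H. Neumann's lemma). -/
theorem exists_forall_smul_notMem (hinf : ∀ x : X, (orbit G x).Infinite) {P Q : Set X}
    (hP : P.Finite) (hQ : Q.Finite) : ∃ k : G, ∀ q ∈ Q, k • q ∉ P := by
  classical
  by_contra! hcon
  let s : Finset (X × X) := (hQ.toFinset ×ˢ hP.toFinset).filter fun z => ∃ g : G, g • z.1 = z.2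
  let g : X × X → G := fun z => if h : ∃ g : G, g • z.1 = z.2 then h.choose else 1
  -- Every `k` carries some `q ∈ Q` into `P`, hence lies in one of finitely many cosets of
  -- stabilizers of points of `Q`. By Neumann's covering lemma one of these stabilizers has finite
  -- index, that is, a finite orbit.
  have hcov : ⋃ z ∈ s, g z • ((stabilizer G z.1 : Subgroup G) : Set G) = univ := by
    refine eq_univ_of_forall fun k => ?_
    obtain ⟨q, hq, hkq⟩ := hcon k
    have hz : ∃ g : G, g • (q, k • q).1 = (q, k • q).2 := ⟨k, rfl⟩
    refine mem_iUnion₂.2 ⟨(q, k • q), ?_, ?_⟩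
    · simp only [s, Finset.mem_filter, Finset.mem_product, Finite.mem_toFinset]
      exact ⟨⟨hq, hkq⟩, hz⟩
    · have h1 : g (q, k • q) • q = k • q := by
        simp only [g, dif_pos hz]
        exact hz.choose_spec
      rw [mem_smul_set_iff_inv_smul_mem]
      simp only [SetLike.mem_coe, mem_stabilizer_iff, smul_eq_mul, mul_smul]
      rw [inv_smul_eq_iff, h1]
  obtain ⟨z, -, hz⟩ := Subgroup.exists_finiteIndex_of_leftCoset_cover hcov
  refine hz.index_ne_zero ?_
  rw [index_stabilizer]
  exact (hinf z.1).ncard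

theorem pow_smul_eq_self {g : G} {x : X} (h : g • x = x) (n : ℕ) : g ^ n • x = x := by
  induction n with
  | zero => simp
  | succ n ih => rw [pow_succ, mul_smul, h, ih]

variable [TopologicalSpace X]

/-- The powers of `T` converge to `α`, uniformly on `W`. -/
def ConvergesOn (T : G) (W : Set X) (α : X) : Prop :=
  ∀ U ∈ 𝓝 α, ∀ᶠ n : ℕ in atTop, ∀ x ∈ W, T ^ n • x ∈ U

/-- `α` is an attracting fixed point of `T`. -/
def Attracts (T : G) (α : X) : Prop := ∃ W ∈ 𝓝 α, ConvergesOn T W α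

/-- Some power of `g` is the identity near `x`. -/
def LocallyPeriodic (g : G) (x : X) : Prop := ∃ k : ℕ, 0 < k ∧ ∀ᶠ y in 𝓝 x, g ^ k • y = y

/-- The forward orbit of `x` converges to an attracting periodic orbit of `g`. -/
def InBasin (g : G) (x : X) : Prop :=
  ∃ k : ℕ, 0 < k ∧ ∃ α, Attracts (g ^ k) α ∧ Tendsto (fun n : ℕ => (g ^ k) ^ n • x) atTop (𝓝 α)

/-- `x` is an attracting periodic point of `g`. -/
def PeriodicAttractor (g : G) (x : X) : Prop := ∃ k : ℕ, 0 < k ∧ Attracts (g ^ k) x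

/-- Each point is locally periodic, or attracted by an attracting periodic orbit, or a repelling
periodic point. -/
def Trichotomy (X : Type*) [TopologicalSpace X] [MulAction G X] (g : G) : Prop :=
  ∀ x : X, LocallyPeriodic g x ∨ InBasin g x ∨ PeriodicAttractor g⁻¹ x

theorem ConvergesOn.pow {T : G} {W : Set X} {α : X} (h : ConvergesOn T W α) {k : ℕ} (hk : 0 < k) :
    ConvergesOn (T ^ k) W α := by
  intro U hU
  have ht : Tendsto (fun n : ℕ => k * n) atTop atTop := tendsto_id.const_mul_atTop' hk
  filter_upwards [ht.eventually (h U hU)] with n hn x hx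
  rw [← pow_mul]
  exact hn x hx

theorem Attracts.pow {T : G} {α : X} (h : Attracts T α) {k : ℕ} (hk : 0 < k) :
    Attracts (T ^ k) α := by
  obtain ⟨W, hW, hc⟩ := h
  exact ⟨W, hW, hc.pow hk⟩

theorem ConvergesOn.tendsto {T : G} {W : Set X} {α x : X} (h : ConvergesOn T W α) (hx : x ∈ W) :
    Tendsto (fun n : ℕ => T ^ n • x) atTop (𝓝 α) := fun U hU => (h U hU).mono fun _ hn => hn x hx

variable [T2Space X]

theorem eq_of_tendsto_of_periodic {T : G} {α y : X}
    (h : Tendsto (fun n : ℕ => T ^ n • y) atTop (𝓝 α)) {j : ℕ} (hj : 0 < j) (hy : T ^ j • y = y) :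
    y = α := by
  have ht : Tendsto (fun n : ℕ => j * n) atTop atTop := tendsto_id.const_mul_atTop' hj
  have h1 := h.comp ht
  have h2 : ((fun n : ℕ => T ^ n • y) ∘ fun n => j * n) = fun _ => y := by
    funext n
    simp only [Function.comp, pow_mul]
    induction n with
    | zero => simp
    | succ n ih => rw [pow_succ, mul_smul, hy, ih]
  rw [h2] at h1
  exact tendsto_nhds_unique tendsto_const_nhds h1

variable [ContinuousConstSMul G X]

theorem Attracts.smul_eq {T : G} {α : X} (h : Attracts T α) : T • α = α := by
  obtain ⟨W, hW, hc⟩ := h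
  have h1 := hc.tendsto (mem_of_mem_nhds hW)
  have h2 : Tendsto (fun n : ℕ => T • T ^ n • α) atTop (𝓝 (T • α)) := h1.const_smul T
  have h3 := h1.comp (tendsto_add_atTop_nat 1)
  refine tendsto_nhds_unique h2 (h3.congr fun n => ?_)
  simp only [Function.comp, pow_succ', mul_smul]

theorem PeriodicAttractor.periodic {g : G} {α : X} (h : PeriodicAttractor g α) :
    ∃ k : ℕ, 0 < k ∧ g ^ k • α = α := by
  obtain ⟨k, hk, h⟩ := h
  exact ⟨k, hk, h.smul_eq⟩

theorem LocallyPeriodic.inv {g : G} {x : X} (h : LocallyPeriodic g x) :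
    LocallyPeriodic g⁻¹ x := by
  obtain ⟨k, hk, h⟩ := h
  refine ⟨k, hk, h.mono fun y hy => ?_⟩
  rw [inv_pow, inv_smul_eq_iff, hy]

theorem locallyPeriodic_inv_iff {g : G} {x : X} : LocallyPeriodic g⁻¹ x ↔ LocallyPeriodic g x :=
  ⟨fun h => inv_inv g ▸ h.inv, fun h => h.inv⟩

/-- This is where perfectness enters: another point near `x` would be both periodic and attracted to
`x`. -/
theorem not_attracts_of_locallyPeriodic (hperf : ∀ x : X, (𝓝[≠] x).NeBot) {T : G} {x : X}
    (h : LocallyPeriodic T x) : ¬ Attracts T x := by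
  rintro ⟨W, hW, hc⟩
  obtain ⟨j, hj, h⟩ := h
  have := hperf x
  have h1 : ∀ᶠ y in 𝓝[≠] x, T ^ j • y = y ∧ y ∈ W :=
    eventually_nhdsWithin_of_eventually_nhds (h.and hW)
  obtain ⟨y, ⟨hy1, hy2⟩, hyx⟩ := (h1.and eventually_mem_nhdsWithin).exists
  exact hyx (eq_of_tendsto_of_periodic (hc.tendsto hy2) hj hy1)

theorem LocallyPeriodic.pow {g : G} {x : X} (h : LocallyPeriodic g x) (k : ℕ) :
    LocallyPeriodic (g ^ k) x := by
  obtain ⟨j, hj, h⟩ := h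
  refine ⟨j, hj, h.mono fun y hy => ?_⟩
  rw [← pow_mul, mul_comm, pow_mul]
  clear h
  induction k with
  | zero => simp
  | succ n ih => rw [pow_succ, mul_smul, hy, ih]

theorem PeriodicAttractor.not_locallyPeriodic (hperf : ∀ x : X, (𝓝[≠] x).NeBot) {g : G} {x : X}
    (h : PeriodicAttractor g x) : ¬ LocallyPeriodic g x := by
  obtain ⟨k, -, h⟩ := h
  exact fun hl => not_attracts_of_locallyPeriodic hperf (hl.pow k) h

/-- Uniformity of the convergence is essential: for large `n`, `T ^ n` sends `y` into `W₂`, and `T⁻¹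
^ n` sends all of `W₂` off `y`, although it brings `T ^ n • y` back to `y`. -/
theorem PeriodicAttractor.not_inv (hperf : ∀ x : X, (𝓝[≠] x).NeBot) {g : G} {x : X}
    (h : PeriodicAttractor g x) : ¬ PeriodicAttractor g⁻¹ x := by
  rintro ⟨j, hj, hj'⟩
  obtain ⟨k, hk, hk'⟩ := h
  have h1 := hk'.pow hj
  have h2 := hj'.pow hk
  rw [← pow_mul] at h1 h2
  rw [mul_comm, inv_pow] at h2
  set T := g ^ (k * j)
  obtain ⟨W₁, hW₁, hc₁⟩ := h1
  obtain ⟨W₂, hW₂, hc₂⟩ := h2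
  have := hperf x
  obtain ⟨y, hy, hyx⟩ := ((eventually_nhdsWithin_of_eventually_nhds
    (s := {x}ᶜ) hW₁).and eventually_mem_nhdsWithin).exists
  have hU : {y}ᶜ ∈ 𝓝 x := isOpen_compl_singleton.mem_nhds fun h => hyx h.symm
  obtain ⟨n, hn₁, hn₂⟩ := ((hc₁ W₂ hW₂).and (hc₂ _ hU)).exists
  refine hn₂ _ (hn₁ y hy) ?_
  rw [inv_pow, inv_smul_smul]
  rfl

/-- Near each point, the only attracting or repelling periodic point is a given one. -/
theorem Trichotomy.exists_nhds (hperf : ∀ x : X, (𝓝[≠] x).NeBot) {g : G} (hg : Trichotomy X g)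
    (x : X) : ∃ O ∈ 𝓝 x, (∀ y ∈ O, LocallyPeriodic g y) ∨
      (¬ LocallyPeriodic g x ∧ ∃ p, ∀ y ∈ O, (∃ k : ℕ, 0 < k ∧ g ^ k • y = y) →
        y = p ∧ ¬ LocallyPeriodic g y) := by
  rcases hg x with h | ⟨k, hk, α, hα, hx⟩ | hx
  · obtain ⟨k, hk, h⟩ := h
    exact ⟨_, eventually_eventually_nhds.2 h, Or.inl fun y hy => ⟨k, hk, hy⟩⟩
  · have hα' : ¬ LocallyPeriodic g α :=
      PeriodicAttractor.not_locallyPeriodic hperf ⟨k, hk, hα⟩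
    obtain ⟨W, hW, hc⟩ := hα
    obtain ⟨n, hn⟩ := (hx.eventually (eventually_mem_nhds_iff.2 hW)).exists
    have hO : {y | (g ^ k) ^ n • y ∈ W} ∈ 𝓝 x :=
      (continuous_const_smul ((g ^ k) ^ n)).continuousAt.preimage_mem_nhds hn
    have key : ∀ y, (g ^ k) ^ n • y ∈ W → (∃ j : ℕ, 0 < j ∧ g ^ j • y = y) → y = α := by
      rintro y hy ⟨j, hj, hjy⟩
      have h1 := hc.tendsto hy
      have h2 : Tendsto (fun m : ℕ => (g ^ k) ^ m • y) atTop (𝓝 α) := by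
        rw [← tendsto_add_atTop_iff_nat n]
        refine h1.congr fun m => ?_
        rw [pow_add, mul_smul]
      refine eq_of_tendsto_of_periodic h2 hj ?_
      rw [← pow_mul, mul_comm, pow_mul]
      clear h1 h2 hn hO
      generalize k = k
      induction k with
      | zero => simp
      | succ n ih => rw [pow_succ, mul_smul, hjy, ih]
    refine ⟨_, hO, Or.inr ⟨?_, α, ?_⟩⟩
    · intro h
      obtain ⟨j, hj, hj'⟩ := h
      have := key x (mem_of_mem_nhds hn) ⟨j, hj, hj'.self_of_nhds⟩
      exact hα' (this ▸ ⟨j, hj, hj'⟩)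
    · intro y hy hy'
      have := key y hy hy'
      exact ⟨this, this ▸ hα'⟩
  · have hx' : ¬ LocallyPeriodic g x := fun h => hx.not_locallyPeriodic hperf h.inv
    obtain ⟨k, hk, W, hW, hc⟩ := hx
    refine ⟨W, hW, Or.inr ⟨hx', x, ?_⟩⟩
    rintro y hy ⟨j, hj, hjy⟩
    have : y = x := by
      refine eq_of_tendsto_of_periodic (hc.tendsto hy) hj ?_
      rw [← pow_mul, mul_comm, pow_mul, inv_pow]
      have h1 : (g ^ j)⁻¹ • y = y := by rw [inv_smul_eq_iff, hjy]
      clear hc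
      generalize k = k
      induction k with
      | zero => simp
      | succ n ih => rw [pow_succ, mul_smul, h1, ih]
    exact ⟨this, this ▸ hx'⟩

variable [CompactSpace X]

theorem Trichotomy.finite_attractors (hperf : ∀ x : X, (𝓝[≠] x).NeBot) {g : G}
    (hg : Trichotomy X g) : {x : X | PeriodicAttractor g x}.Finite := by
  have h : (univ ∩ {x : X | PeriodicAttractor g x}).Finite := by
    refine isCompact_univ.induction_on (p := fun s => (s ∩ {x | PeriodicAttractor g x}).Finite)
      (by simp) (fun s t hst ht => ht.subset (inter_subset_inter_left _ hst))
      (fun s t hs ht => by rw [union_inter_distrib_right]; exact hs.union ht) fun x _ => ?_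
    obtain ⟨O, hO, h⟩ := hg.exists_nhds hperf x
    refine ⟨O, mem_nhdsWithin_of_mem_nhds hO, ?_⟩
    rcases h with h | ⟨-, p, h⟩
    · convert Set.finite_empty (α := X)
      refine eq_empty_of_forall_notMem fun y hy => ?_
      exact PeriodicAttractor.not_locallyPeriodic hperf hy.2 (h y hy.1)
    · exact (Set.finite_singleton p).subset fun y hy => (h y hy.1 hy.2.periodic).1
  simpa using h

/-- Near a point that is not locally periodic, no periodic point is locally periodic. Being also
open, this set is clopen, so both it and its complement are compact; uniform exponents follow on
each. -/
theorem Trichotomy.isClosed_locallyPeriodic (hperf : ∀ x : X, (𝓝[≠] x).NeBot) {g : G}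
    (hg : Trichotomy X g) : IsClosed {x : X | LocallyPeriodic g x} := by
  rw [← isOpen_compl_iff, isOpen_iff_mem_nhds]
  intro x hx
  obtain ⟨O, hO, h⟩ := hg.exists_nhds hperf x
  rcases h with h | ⟨-, p, h⟩
  · exact absurd (h x (mem_of_mem_nhds hO)) hx
  · refine mem_of_superset hO fun y hy hy' => ?_
    obtain ⟨k, hk, hk'⟩ := id hy'
    exact (h y hy ⟨k, hk, hk'.self_of_nhds⟩).2 hy'

theorem isOpen_locallyPeriodic (g : G) : IsOpen {x : X | LocallyPeriodic g x} := by
  rw [isOpen_iff_mem_nhds]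
  rintro x ⟨k, hk, h⟩
  exact (eventually_eventually_nhds.2 h).mono fun y hy => ⟨k, hk, hy⟩

theorem Trichotomy.exists_uniform_period (hperf : ∀ x : X, (𝓝[≠] x).NeBot) {g : G}
    (hg : Trichotomy X g) : ∃ k : ℕ, 0 < k ∧ ∀ x : X, LocallyPeriodic g x → g ^ k • x = x := by
  refine (hg.isClosed_locallyPeriodic hperf).isCompact.induction_on
    (p := fun s => ∃ k : ℕ, 0 < k ∧ ∀ x ∈ s, g ^ k • x = x) ⟨1, one_pos, by simp⟩
    (fun s t hst ⟨k, hk, h⟩ => ⟨k, hk, fun x hx => h x (hst hx)⟩) ?_ ?_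
  · rintro s t ⟨k, hk, h⟩ ⟨j, hj, h'⟩
    have aux : ∀ (a b : ℕ) (x : X), g ^ a • x = x → g ^ (a * b) • x = x := by
      intro a b x hx
      rw [pow_mul]
      induction b with
      | zero => simp
      | succ n ih => rw [pow_succ, mul_smul, hx, ih]
    refine ⟨k * j, mul_pos hk hj, ?_⟩
    rintro x (hx | hx)
    · exact aux _ _ x (h x hx)
    · rw [mul_comm]
      exact aux _ _ x (h' x hx)
  · rintro x ⟨k, hk, h⟩
    exact ⟨_, mem_nhdsWithin_of_mem_nhds h, k, hk, fun y hy => hy⟩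

/-- Outside `V` and the locally periodic set only basin points remain, and they form a compact set.
Entering `U` is locally uniform in the exponent, and exponents of two pieces are merged by taking
their product. -/
theorem Trichotomy.exists_uniform_basin {g : G}
    (hg : Trichotomy X g) {U V : Set X} (hU : IsOpen U) (hV : IsOpen V)
    (hAU : ∀ x, PeriodicAttractor g x → x ∈ U) (hRV : ∀ x, PeriodicAttractor g⁻¹ x → x ∈ V) :
    ∃ k : ℕ, 0 < k ∧ ∀ᶠ n : ℕ in atTop, ∀ x : X, x ∉ V → ¬ LocallyPeriodic g x →
      (g ^ k) ^ n • x ∈ U := by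
  have hK : IsCompact (Vᶜ ∩ {x : X | LocallyPeriodic g x}ᶜ) :=
    (hV.isClosed_compl.inter (isOpen_locallyPeriodic g).isClosed_compl).isCompact
  have h := hK.induction_on
    (p := fun s => ∃ k : ℕ, 0 < k ∧ ∀ᶠ n : ℕ in atTop, ∀ x ∈ s, (g ^ k) ^ n • x ∈ U)
    ⟨1, one_pos, by simp⟩
    (fun s t hst ⟨k, hk, h⟩ => ⟨k, hk, h.mono fun n hn x hx => hn x (hst hx)⟩) ?_ ?_
  · obtain ⟨k, hk, h⟩ := h
    exact ⟨k, hk, h.mono fun n hn x hx hx' => hn x ⟨hx, hx'⟩⟩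
  · rintro s t ⟨k, hk, h⟩ ⟨j, hj, h'⟩
    refine ⟨k * j, mul_pos hk hj, ?_⟩
    have h1 := (tendsto_id.const_mul_atTop' hj : Tendsto (fun n : ℕ => j * n) atTop atTop).eventually h
    have h2 := (tendsto_id.const_mul_atTop' hk : Tendsto (fun n : ℕ => k * n) atTop atTop).eventually h'
    filter_upwards [h1, h2] with n hn hn'
    rintro x (hx | hx)
    · have := hn x hx
      rw [← pow_mul] at this ⊢
      rwa [mul_assoc]
    · have := hn' x hx
      rw [← pow_mul] at this ⊢
      rwa [mul_comm k j, mul_assoc]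
  · rintro x ⟨hxV, hxF⟩
    rcases hg x with h | ⟨k, hk, α, hα, hx⟩ | hx
    · exact absurd h hxF
    · have hαU := hAU α ⟨k, hk, hα⟩
      obtain ⟨W, hW, hc⟩ := hα
      obtain ⟨n, hn⟩ := (hx.eventually (eventually_mem_nhds_iff.2 hW)).exists
      have hO : {y | (g ^ k) ^ n • y ∈ W} ∈ 𝓝 x :=
        (continuous_const_smul ((g ^ k) ^ n)).continuousAt.preimage_mem_nhds hn
      refine ⟨_, mem_nhdsWithin_of_mem_nhds hO, k, hk, ?_⟩
      have h1 := hc U (hU.mem_nhds hαU)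
      have h2 := (tendsto_sub_atTop_nat n).eventually h1
      filter_upwards [h2, eventually_ge_atTop n] with m hm hnm y hy
      have := hm _ hy
      rwa [← mul_smul, ← pow_add, Nat.sub_add_cancel hnm] at this
    · exact absurd (hRV x hx) hxV

/-- `G` contains elements that push the complement of arbitrarily small neighborhoods of `R ∪ F`
into arbitrarily small neighborhoods of `A`, whose inverses do the same with `A` and `R` exchanged,
and that fix `F`. -/
def Pushing (G : Type*) {X : Type*} [Group G] [MulAction G X] [TopologicalSpace X]
    (A R F : Set X) : Prop :=
  ∀ U V : Set X, IsOpen U → IsOpen V → A ⊆ U → R ⊆ V → ∃ a : G,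
    (∀ x, x ∉ V → x ∉ F → a • x ∈ U) ∧ (∀ x, x ∉ U → x ∉ F → a⁻¹ • x ∈ V) ∧ ∀ x ∈ F, a • x = x

theorem Trichotomy.pushing (hperf : ∀ x : X, (𝓝[≠] x).NeBot) {g : G}
    (hg : Trichotomy X g) (hg' : Trichotomy X g⁻¹) :
    Pushing G {x : X | PeriodicAttractor g x} {x | PeriodicAttractor g⁻¹ x}
      {x | LocallyPeriodic g x} := by
  intro U V hU hV hAU hRV
  obtain ⟨k₁, hk₁, h₁⟩ := hg.exists_uniform_basin hU hV hAU hRV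
  obtain ⟨k₂, hk₂, h₂⟩ := hg'.exists_uniform_basin hV hU hRV
    (by rw [inv_inv]; exact hAU)
  obtain ⟨k₃, hk₃, h₃⟩ := hg.exists_uniform_period hperf
  have t₁ : Tendsto (fun n : ℕ => (k₂ * k₃) * n) atTop atTop :=
    tendsto_id.const_mul_atTop' (mul_pos hk₂ hk₃)
  have t₂ : Tendsto (fun n : ℕ => (k₁ * k₃) * n) atTop atTop :=
    tendsto_id.const_mul_atTop' (mul_pos hk₁ hk₃)
  obtain ⟨n, hn₁, hn₂⟩ := ((t₁.eventually h₁).and (t₂.eventually h₂)).exists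
  -- One exponent, a common multiple of the three periods, serves the forward push, the backward
  -- push and the pointwise fixing at once.
  refine ⟨g ^ (k₁ * k₂ * k₃ * n), fun x hx hxF => ?_, fun x hx hxF => ?_, fun x hx => ?_⟩
  · have := hn₁ x hx hxF
    rw [← pow_mul] at this
    convert this using 3
    ring
  · have := hn₂ x hx (fun h => hxF (locallyPeriodic_inv_iff.1 h))
    rw [← pow_mul, inv_pow] at this
    convert this using 4
    ring
  · have h4 := h₃ x hx
    rw [show k₁ * k₂ * k₃ * n = k₃ * (k₁ * k₂ * n) by ring, pow_mul]
    generalize k₁ * k₂ * n = m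
    induction m with
    | zero => simp
    | succ n ih => rw [pow_succ, mul_smul, h4, ih]

theorem Pushing.smul {A R F : Set X} (h : Pushing G A R F) (g : G) :
    Pushing G (g • A) (g • R) (g • F) := by
  intro U V hU hV hAU hRV
  obtain ⟨a, h1, h2, h3⟩ := h (g⁻¹ • U) (g⁻¹ • V) (hU.smul _) (hV.smul _)
    (smul_set_subset_iff_subset_inv_smul_set.1 hAU) (smul_set_subset_iff_subset_inv_smul_set.1 hRV)
  refine ⟨g * a * g⁻¹, fun x hx hxF => ?_, fun x hx hxF => ?_, fun x hx => ?_⟩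
  · have := h1 (g⁻¹ • x) (by rwa [smul_mem_smul_set_iff])
      (by rwa [← mem_smul_set_iff_inv_smul_mem])
    rwa [mem_inv_smul_set_iff, ← mul_smul, ← mul_smul] at this
  · have := h2 (g⁻¹ • x) (by rwa [smul_mem_smul_set_iff])
      (by rwa [← mem_smul_set_iff_inv_smul_mem])
    rw [mem_inv_smul_set_iff, ← mul_smul, ← mul_smul] at this
    simpa [mul_assoc] using this
  · rw [mem_smul_set_iff_inv_smul_mem] at hx
    rw [mul_smul, mul_smul, h3 _ hx, smul_inv_smul]

/-- The product `a * b` works: each point is moved by at least one of the two factors unless it lies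
in both fixed sets. Shrinking to disjoint `U₀` and `V₀` guarantees that a point already pushed by
`b` towards the attractors is not in the repelling zone of `a`; this is why all attractors must be
disjoint from all repellers. -/
theorem Pushing.inter {A₁ R₁ F₁ A₂ R₂ F₂ : Set X} (h₁ : Pushing G A₁ R₁ F₁)
    (h₂ : Pushing G A₂ R₂ F₂) (hA₁ : A₁.Finite) (hR₁ : R₁.Finite) (hA₂ : A₂.Finite)
    (hR₂ : R₂.Finite) (hd : Disjoint (A₁ ∪ A₂) (R₁ ∪ R₂)) :
    Pushing G (A₁ ∪ A₂) (R₁ ∪ R₂) (F₁ ∩ F₂) := by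
  intro U V hU hV hAU hRV
  obtain ⟨U₀, V₀, hU₀, hV₀, hAU₀, hRV₀, hd₀⟩ :=
    SeparatedNhds.of_finite (hA₁.union hA₂) (hR₁.union hR₂) hd
  obtain ⟨a, ha, ha', haF⟩ := h₁ (U ∩ U₀) (V ∩ V₀) (hU.inter hU₀) (hV.inter hV₀)
    (subset_union_left.trans (subset_inter hAU hAU₀))
    (subset_union_left.trans (subset_inter hRV hRV₀))
  obtain ⟨b, hb, hb', hbF⟩ := h₂ (U ∩ U₀) (V ∩ V₀) (hU.inter hU₀) (hV.inter hV₀)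
    (subset_union_right.trans (subset_inter hAU hAU₀))
    (subset_union_right.trans (subset_inter hRV hRV₀))
  have hne : ∀ x ∈ U ∩ U₀, x ∉ V ∩ V₀ := fun x hx hx' => hd₀.le_bot ⟨hx.2, hx'.2⟩
  have haF' : ∀ x ∈ F₁, a⁻¹ • x = x := fun x hx => inv_smul_eq_iff.2 (haF x hx).symm
  have hbF' : ∀ x ∈ F₂, b⁻¹ • x = x := fun x hx => inv_smul_eq_iff.2 (hbF x hx).symm
  refine ⟨a * b, fun x hx hxF => ?_, fun x hx hxF => ?_, fun x hx => ?_⟩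
  · rw [mul_smul]
    have hxV : x ∉ V ∩ V₀ := fun h => hx h.1
    by_cases h2 : x ∈ F₂
    · rw [hbF x h2]
      exact (ha x hxV fun h => hxF ⟨h, h2⟩).1
    · have h3 := hb x hxV h2
      by_cases h1 : b • x ∈ F₁
      · rw [haF _ h1]
        exact h3.1
      · exact (ha _ (hne _ h3) h1).1
  · rw [mul_inv_rev, mul_smul]
    have hxU : x ∉ U ∩ U₀ := fun h => hx h.1
    by_cases h1 : x ∈ F₁
    · rw [haF' x h1]
      exact (hb' x hxU fun h => hxF ⟨h1, h⟩).1
    · have h3 := ha' x hxU h1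
      by_cases h2 : a⁻¹ • x ∈ F₂
      · rw [hbF' _ h2]
        exact h3.1
      · exact (hb' _ (fun h => hne _ h h3) h2).1
  · rw [mul_smul, hbF x hx.2, haF x hx.1]

variable [IsMinimal G X]

/-- In a minimal system with infinite orbits, a point can be moved into a given open set by an
element that moves a finite set off another one. -/
theorem exists_smul_mem_forall_notMem (hinf : ∀ x : X, (orbit G x).Infinite) {O : Set X}
    (hO : IsOpen O) (hne : O.Nonempty) (α : X) {P Q : Set X} (hP : P.Finite) (hQ : Q.Finite) :
    ∃ k : G, k • α ∈ O ∧ ∀ q ∈ Q, k • q ∉ P := by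
  obtain ⟨I, hI⟩ := isCompact_univ.exists_finite_cover_smul G hO hne
  by_contra! hcon
  -- Moving `Q` off all the translates `g • P` at once makes `g⁻¹ * k` admissible for whichever
  -- translate `g • O` happens to contain `k • α`.
  have hP' : (⋃ g ∈ I, g • P).Finite := I.finite_toSet.biUnion fun g _ => hP.smul_set
  obtain ⟨k, hk⟩ := exists_forall_smul_notMem hinf hP' hQ
  obtain ⟨g, hg, hgk⟩ := mem_iUnion₂.1 (hI (mem_univ (k • α)))
  rw [mem_smul_set_iff_inv_smul_mem, ← mul_smul] at hgk
  obtain ⟨q, hq, hqP⟩ := hcon _ hgk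
  refine hk q hq (mem_iUnion₂.2 ⟨g, hg, ?_⟩)
  rwa [mem_smul_set_iff_inv_smul_mem, ← mul_smul]

/-- Finitely many translates of an isolated point would cover the space, making it finite. -/
theorem nhdsWithin_compl_neBot_of_isMinimal (hinf : ∀ x : X, (orbit G x).Infinite) (x : X) :
    (𝓝[≠] x).NeBot := by
  by_contra h
  rw [not_neBot, ← isOpen_singleton_iff_punctured_nhds] at h
  obtain ⟨I, hI⟩ := isCompact_univ.exists_finite_cover_smul G h (singleton_nonempty x)
  refine hinf x ((I.finite_toSet.biUnion fun g _ => (finite_singleton x).smul_set (a := g)).subset ?_)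
  exact (subset_univ _).trans hI

omit [TopologicalSpace X] [T2Space X] [ContinuousConstSMul G X] [CompactSpace X]
  [IsMinimal G X] in
theorem finite_pow_smul_of_periodic {T : G} {x : X} {j : ℕ} (hj : 0 < j) (h : T ^ j • x = x) :
    {y : X | ∃ n : ℕ, T ^ n • x = y}.Finite := by
  refine ((Finset.range j).finite_toSet.image fun n => T ^ n • x).subset ?_
  rintro _ ⟨n, rfl⟩
  refine ⟨n % j, by simpa using Nat.mod_lt n hj, ?_⟩
  conv_rhs => rw [← Nat.mod_add_div n j, pow_add, pow_mul, mul_smul, pow_smul_eq_self h]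

/-- A translate of the fixed set of pushing data that avoids a translate of a small neighborhood of
an attracting point, by an element moving a finite set off another one. -/
theorem exists_translate_avoiding (hinf : ∀ x : X, (orbit G x).Infinite) {T : G} {α : X}
    {W : Set X} (hc : ConvergesOn T W α) {F : Set X} (hF : IsClosed F) (hF' : F ≠ univ)
    {P Q : Set X} (hP : P.Finite) (hQ : Q.Finite) (t : G) :
    ∃ h : G, Disjoint (t • W) (h • F) ∧ Disjoint (h • P) Q := by
  -- The element sought is `t * (T ^ n)⁻¹ * k⁻¹`, which sends `p` to `q` exactly when `p = k • T ^ n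
  -- • t⁻¹ • q`. If `t⁻¹ • q` is `T`-periodic, its orbit is finite and the choice of `k` moves it
  -- off `P` for every `n`.
  have hfin : (⋃ q ∈ Q, {x | (∃ n : ℕ, T ^ n • t⁻¹ • q = x) ∧
      ∃ j : ℕ, 0 < j ∧ T ^ j • x = x}).Finite := by
    refine hQ.biUnion fun q _ => ?_
    by_cases hper : ∃ j : ℕ, 0 < j ∧ T ^ j • t⁻¹ • q = t⁻¹ • q
    · obtain ⟨j, hj, hjq⟩ := hper
      exact (finite_pow_smul_of_periodic hj hjq).subset fun x hx => hx.1
    · convert Set.finite_empty (α := X)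
      refine eq_empty_of_forall_notMem ?_
      rintro x ⟨⟨n, rfl⟩, j, hj, hjx⟩
      refine hper ⟨j, hj, ?_⟩
      rwa [← mul_smul, ← pow_add, add_comm, pow_add, mul_smul, smul_left_cancel_iff] at hjx
  obtain ⟨k, hkα, hk⟩ := exists_smul_mem_forall_notMem hinf hF.isOpen_compl
    (nonempty_compl.2 hF') α hP hfin
  -- If `t⁻¹ • q` is not `T`-periodic, the points `T ^ n • t⁻¹ • q` are pairwise distinct, so only
  -- finitely many `n` can hit the finite set `P`.
  have hbad : (⋃ q ∈ Q, {n : ℕ | k • T ^ n • t⁻¹ • q ∈ P ∧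
      ∀ j : ℕ, 0 < j → T ^ j • T ^ n • t⁻¹ • q ≠ T ^ n • t⁻¹ • q}).Finite := by
    refine hQ.biUnion fun q _ => ?_
    refine Set.Finite.of_injOn (f := fun n => k • T ^ n • t⁻¹ • q) (fun n hn => hn.1) ?_ hP
    have key : ∀ m n : ℕ, m < n → T ^ m • t⁻¹ • q = T ^ n • t⁻¹ • q →
        ¬ ∀ j : ℕ, 0 < j → T ^ j • T ^ m • t⁻¹ • q ≠ T ^ m • t⁻¹ • q := by
      intro m n hmn h hall
      refine hall (n - m) (Nat.sub_pos_of_lt hmn) ?_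
      rw [← mul_smul, ← pow_add, Nat.sub_add_cancel hmn.le, h]
    intro m hm n hn hmn
    have hmn' : T ^ m • t⁻¹ • q = T ^ n • t⁻¹ • q := smul_left_cancel k hmn
    rcases lt_trichotomy m n with h | h | h
    · exact absurd hm.2 (key m n h hmn')
    · exact h
    · exact absurd hn.2 (key n m h hmn'.symm)
  have hO : (k • ·) ⁻¹' Fᶜ ∈ 𝓝 α :=
    (continuous_const_smul k).continuousAt.preimage_mem_nhds (hF.isOpen_compl.mem_nhds hkα)
  have hev : ∀ᶠ n : ℕ in atTop, n ∉ ⋃ q ∈ Q, {n : ℕ | k • T ^ n • t⁻¹ • q ∈ P ∧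
      ∀ j : ℕ, 0 < j → T ^ j • T ^ n • t⁻¹ • q ≠ T ^ n • t⁻¹ • q} := by
    rw [← Nat.cofinite_eq_atTop]
    exact hbad.eventually_cofinite_notMem
  obtain ⟨n, hn, hn'⟩ := ((hc _ hO).and hev).exists
  refine ⟨t * (T ^ n)⁻¹ * k⁻¹, ?_, ?_⟩
  · rw [Set.disjoint_left]
    rintro _ ⟨w, hw, rfl⟩ hwF
    rw [mem_smul_set_iff_inv_smul_mem] at hwF
    refine hn w hw ?_
    simpa [mul_smul] using hwF
  · rw [Set.disjoint_left]
    rintro _ ⟨p, hp, rfl⟩ hq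
    have hp' : k • T ^ n • t⁻¹ • (t * (T ^ n)⁻¹ * k⁻¹) • p = p := by simp [mul_smul]
    by_cases hall : ∀ j : ℕ, 0 < j → T ^ j • T ^ n • t⁻¹ • (t * (T ^ n)⁻¹ * k⁻¹) • p
        ≠ T ^ n • t⁻¹ • (t * (T ^ n)⁻¹ * k⁻¹) • p
    · exact hn' (mem_iUnion₂.2 ⟨_, hq, by simpa only [mem_ofPred_eq, hp'] using ⟨hp, hall⟩⟩)
    · push Not at hall
      exact hk _ (mem_iUnion₂.2 ⟨_, hq, ⟨n, rfl⟩, hall⟩) (by simpa only [hp'] using hp)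

/-- Translates of a neighborhood `W` of an attracting point cover `X`. Each of them is removed from
the fixed set by multiplying with a conjugate supplied by `exists_translate_avoiding`, whose second
conclusion keeps the accumulated attractors and repellers disjoint, as `Pushing.inter` requires. -/
theorem Trichotomy.exists_pushing_empty (hinf : ∀ x : X, (orbit G x).Infinite) {g : G}
    (hg : Trichotomy X g) (hg' : Trichotomy X g⁻¹) {y : X} (hy : ¬ LocallyPeriodic g y) :
    ∃ A R : Set X, A.Finite ∧ R.Finite ∧ Disjoint A R ∧ Pushing G A R ∅ := by
  have hperf : ∀ x : X, (𝓝[≠] x).NeBot := nhdsWithin_compl_neBot_of_isMinimal (G := G) hinf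
  obtain ⟨T, α, W, hW, hc⟩ : ∃ (T : G) (α : X), Attracts T α := by
    rcases hg y with h | ⟨k, -, α, hα, -⟩ | ⟨k, -, h⟩
    · exact absurd h hy
    · exact ⟨_, _, hα⟩
    · exact ⟨_, _, h⟩
  set A := {x : X | PeriodicAttractor g x}
  set R := {x : X | PeriodicAttractor g⁻¹ x}
  set F := {x : X | LocallyPeriodic g x}
  have hA : A.Finite := hg.finite_attractors hperf
  have hR : R.Finite := hg'.finite_attractors hperf
  have hAR : Disjoint A R := Set.disjoint_left.2 fun x hx hx' => hx.not_inv hperf hx'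
  have hF : IsClosed F := hg.isClosed_locallyPeriodic hperf
  have hF' : F ≠ univ := fun h => hy (h.symm ▸ mem_univ y : y ∈ F)
  have hpush : Pushing G A R F := hg.pushing hperf hg'
  have hstep : ∀ I : Finset G, ∃ A' R' F' : Set X, A'.Finite ∧ R'.Finite ∧ Disjoint A' R' ∧
      Pushing G A' R' F' ∧ ∀ t ∈ I, Disjoint (t • W) F' := by
    classical
    intro I
    induction I using Finset.induction_on with
    | empty =>
      -- The induction starts with the identity, which fixes everything and pushes nothing.
      exact ⟨∅, ∅, univ, finite_empty, finite_empty, disjoint_bot_left,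
        fun U V _ _ _ _ => ⟨1, by simp, by simp, by simp⟩, by simp⟩
    | insert t I _ ih =>
      obtain ⟨A', R', F', hA', hR', hd, hp, hI⟩ := ih
      obtain ⟨h, hh₁, hh₂⟩ := exists_translate_avoiding hinf hc hF hF' (hA.union hR)
        (hA'.union hR') t
      refine ⟨A' ∪ h • A, R' ∪ h • R, F' ∩ h • F, hA'.union hA.smul_set, hR'.union hR.smul_set,
        ?_, ?_⟩
      · rw [smul_set_union, disjoint_union_left, disjoint_union_right, disjoint_union_right] at hh₂
        rw [disjoint_union_left, disjoint_union_right, disjoint_union_right]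
        exact ⟨⟨hd, hh₂.2.1.symm⟩, hh₂.1.2, (disjoint_smul_set).2 hAR⟩
      · have hdis : Disjoint (A' ∪ h • A) (R' ∪ h • R) := by
          rw [smul_set_union, disjoint_union_left, disjoint_union_right,
            disjoint_union_right] at hh₂
          rw [disjoint_union_left, disjoint_union_right, disjoint_union_right]
          exact ⟨⟨hd, hh₂.2.1.symm⟩, hh₂.1.2, (disjoint_smul_set).2 hAR⟩
        refine ⟨hp.inter (hpush.smul h) hA' hR' hA.smul_set hR.smul_set hdis, ?_⟩
        intro s hs
        rcases Finset.mem_insert.1 hs with rfl | hs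
        · exact hh₁.mono_right inter_subset_right
        · exact (hI s hs).mono_right inter_subset_left
  obtain ⟨I, hI⟩ := isCompact_univ.exists_finite_cover_smul G isOpen_interior
    ⟨α, mem_interior_iff_mem_nhds.2 hW⟩
  obtain ⟨A', R', F', hA', hR', hd, hp, hF'⟩ := hstep I
  obtain rfl : F' = ∅ := by
    refine eq_empty_of_forall_notMem fun x hx => ?_
    obtain ⟨t, ht, hxt⟩ := mem_iUnion₂.1 (hI (mem_univ x))
    exact Set.disjoint_left.1 (hF' t ht) (smul_set_mono interior_subset hxt) hx
  exact ⟨A', R', hA', hR', hd, hp⟩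

/-- A minimal action on a compact space with infinite orbits, in which some element is not locally
periodic but has attracting-repelling dynamics, is an action of a group with a free subgroup that
acts faithfully. -/
theorem exists_free_of_trichotomy [Nonempty X] (hinf : ∀ x : X, (orbit G x).Infinite) {g : G}
    (hg : Trichotomy X g) (hg' : Trichotomy X g⁻¹) {y : X} (hy : ¬ LocallyPeriodic g y) :
    ∃ φ : FreeGroup (Fin 2) →* G, Function.Injective φ := by
  obtain ⟨A, R, hA, hR, hd, hp⟩ := hg.exists_pushing_empty hinf hg' hy
  obtain ⟨h, hh⟩ := exists_forall_smul_notMem hinf (hA.union hR) (hA.union hR)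
  have hdis : Disjoint (A ∪ R) (h • (A ∪ R)) := by
    rw [Set.disjoint_left]
    rintro _ hx ⟨z, hz, rfl⟩
    exact hh z hz hx
  obtain ⟨O₁, O₂, hO₁, hO₂, hPO₁, hPO₂, hO⟩ := SeparatedNhds.of_finite (hA.union hR)
    (hA.union hR).smul_set hdis
  obtain ⟨U₀, V₀, hU₀, hV₀, hAU₀, hRV₀, hd₀⟩ := SeparatedNhds.of_finite hA hR hd
  have hO' : IsOpen (O₁ ∩ h⁻¹ • O₂) := hO₁.inter (hO₂.smul _)
  have hPO : A ∪ R ⊆ O₁ ∩ h⁻¹ • O₂ :=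
    subset_inter hPO₁ (smul_set_subset_iff_subset_inv_smul_set.1 hPO₂)
  -- Intersecting with `O₁ ∩ h⁻¹ • O₂` makes `U ∪ V` disjoint from its translate by `h`, so that `a`
  -- and `h * a * h⁻¹` have disjoint ping-pong tables.
  set U := U₀ ∩ (O₁ ∩ h⁻¹ • O₂) with hUdef
  set V := V₀ ∩ (O₁ ∩ h⁻¹ • O₂) with hVdef
  obtain ⟨a, ha, ha', -⟩ := hp U V (hU₀.inter hO') (hV₀.inter hO')
    (subset_inter hAU₀ (subset_union_left.trans hPO))
    (subset_inter hRV₀ (subset_union_right.trans hPO))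
  have hUV : Disjoint U V := hd₀.mono inter_subset_left inter_subset_left
  have hcross : ∀ x ∈ U ∪ V, ∀ y ∈ U ∪ V, x ≠ h • y := by
    rintro x hx y hy rfl
    have h1 : h • y ∈ O₁ := by rcases hx with hx | hx <;> exact hx.2.1
    have h2 : y ∈ h⁻¹ • O₂ := by rcases hy with hy | hy <;> exact hy.2.2
    rw [mem_inv_smul_set_iff] at h2
    exact Set.disjoint_left.1 hO h1 h2
  -- If `U` were empty, `a` could not push any point into it, so `V` would be the whole space,
  -- contradicting that `V` is disjoint from `h • V`.
  have hUne : U.Nonempty := by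
    by_contra hU
    rw [not_nonempty_iff_eq_empty] at hU
    have hV : ∀ x, x ∈ V := fun x => by
      by_contra hx
      have := ha x hx (notMem_empty _)
      rw [hU] at this
      exact this
    obtain ⟨x⟩ := ‹Nonempty X›
    exact hcross (h • x) (Or.inr (hV _)) x (Or.inr (hV _)) rfl
  let a' : ULift (Fin 2) → G := fun i => ![a, h * a * h⁻¹] i.down
  have hne : ∀ W₁ W₂ : Set X, W₁ ⊆ U ∪ V → W₂ ⊆ U ∪ V → Disjoint W₁ (h • W₂) := by
    intro W₁ W₂ h₁ h₂
    rw [Set.disjoint_left]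
    rintro _ hx ⟨z, hz, rfl⟩
    exact hcross _ (h₁ hx) z (h₂ hz) rfl
  have hinj : Function.Injective (FreeGroup.lift a') := by
    refine FreeGroup.injective_lift_of_ping_pong a' (fun i => ![U, h • U] i.down)
      (fun i => ![V, h • V] i.down) ?_ ?_ ?_ ?_ ?_ ?_
    · rintro ⟨i⟩
      fin_cases i
      · exact hUne
      · exact hUne.smul_set
    · rintro ⟨i⟩ ⟨j⟩ hij
      fin_cases i <;> fin_cases j
      · exact absurd rfl hij
      · exact hne _ _ subset_union_left subset_union_left
      · exact (hne _ _ subset_union_left subset_union_left).symm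
      · exact absurd rfl hij
    · rintro ⟨i⟩ ⟨j⟩ hij
      fin_cases i <;> fin_cases j
      · exact absurd rfl hij
      · exact hne _ _ subset_union_right subset_union_right
      · exact (hne _ _ subset_union_right subset_union_right).symm
      · exact absurd rfl hij
    · rintro ⟨i⟩ ⟨j⟩
      fin_cases i <;> fin_cases j
      · exact hUV
      · exact hne _ _ subset_union_left subset_union_right
      · exact (hne _ _ subset_union_right subset_union_left).symm
      · exact disjoint_smul_set.2 hUV
    · rintro ⟨i⟩
      fin_cases i
      · rintro _ ⟨x, hx, rfl⟩
        exact ha x hx (notMem_empty _)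
      · rintro _ ⟨x, hx, rfl⟩
        have h1 : h⁻¹ • x ∉ V := by
          rw [← mem_smul_set_iff_inv_smul_mem]
          exact hx
        exact ⟨_, ha _ h1 (notMem_empty _), by simp [a', mul_smul]⟩
    · rintro ⟨i⟩
      fin_cases i
      · rintro _ ⟨x, hx, rfl⟩
        exact ha' x hx (notMem_empty _)
      · rintro _ ⟨x, hx, rfl⟩
        have h1 : h⁻¹ • x ∉ U := by
          rw [← mem_smul_set_iff_inv_smul_mem]
          exact hx
        exact ⟨_, ha' _ h1 (notMem_empty _), by simp [a', mul_smul, mul_inv_rev]⟩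
  exact ⟨(FreeGroup.lift a').comp (FreeGroup.freeGroupCongr Equiv.ulift.symm).toMonoidHom,
    hinj.comp (FreeGroup.freeGroupCongr Equiv.ulift.symm).injective⟩

end PingPong
end CantorTits

namespace CantorTits

open Filter Set

/-! ### Intervals, cylinders and gaps of the central Cantor set -/

section CantorSet

variable {l : ℝ}

theorem cantorIntervals_snd {n : ℕ} {J : ℝ × ℝ} (hJ : J ∈ cantorIntervals l n) :
    J.2 = J.1 + l ^ n := by
  induction n generalizing J with
  | zero =>
    rw [cantorIntervals, mem_singleton_iff] at hJ
    simp [hJ]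
  | succ n ih =>
    rcases hJ with ⟨P, hP, rfl⟩ | ⟨P, hP, rfl⟩ <;>
    · simp only [ih hP]
      ring

theorem finite_cantorIntervals (l : ℝ) (n : ℕ) : (cantorIntervals l n).Finite := by
  induction n with
  | zero => exact finite_singleton _
  | succ n ih => exact (ih.image _).union (ih.image _)

theorem cantorIntervals_succ_iff {n : ℕ} {a : ℝ} :
    (a, a + l ^ (n + 1)) ∈ cantorIntervals l (n + 1) ↔ ∃ b, (b, b + l ^ n) ∈ cantorIntervals l n ∧
      (a = b ∨ a = b + (1 - l) * l ^ n) := by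
  constructor
  · rintro (⟨P, hP, h⟩ | ⟨P, hP, h⟩)
    · refine ⟨P.1, by rw [← cantorIntervals_snd hP]; exact hP, Or.inl ?_⟩
      exact (congrArg Prod.fst h).symm
    · refine ⟨P.1, by rw [← cantorIntervals_snd hP]; exact hP, Or.inr ?_⟩
      have h1 : P.2 - l * (P.2 - P.1) = a := congrArg Prod.fst h
      rw [← h1, cantorIntervals_snd hP]
      ring
  · rintro ⟨b, hb, rfl | rfl⟩
    · refine Or.inl ⟨_, hb, ?_⟩
      ext <;> simp only <;> ring
    · refine Or.inr ⟨_, hb, ?_⟩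
      ext <;> simp only <;> ring

variable (hl0 : 0 < l) (hl : l < 1 / 2)
include hl0 hl

theorem child_le {n : ℕ} : l * l ^ n < (1 - l) * l ^ n := by
  have := pow_pos hl0 n
  nlinarith

theorem cantorIntervals_unique {n : ℕ} {a b x : ℝ} (ha : (a, a + l ^ n) ∈ cantorIntervals l n)
    (hb : (b, b + l ^ n) ∈ cantorIntervals l n) (hxa : x ∈ Icc a (a + l ^ n))
    (hxb : x ∈ Icc b (b + l ^ n)) : a = b := by
  induction n generalizing a b with
  | zero =>
    have h1 := congrArg Prod.fst (mem_singleton_iff.1 ha)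
    have h2 := congrArg Prod.fst (mem_singleton_iff.1 hb)
    exact h1.trans h2.symm
  | succ n ih =>
    obtain ⟨a', ha', haa⟩ := cantorIntervals_succ_iff.1 ha
    obtain ⟨b', hb', hbb⟩ := cantorIntervals_succ_iff.1 hb
    have h1 := child_le hl0 hl (n := n)
    have hp := pow_pos hl0 n
    have hp' : 0 < l * l ^ n := mul_pos hl0 hp
    rw [pow_succ'] at hxa hxb
    obtain ⟨hxa1, hxa2⟩ := hxa
    obtain ⟨hxb1, hxb2⟩ := hxb
    have hab : a' = b' := by
      refine ih ha' hb' ?_ ?_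
      · rcases haa with rfl | rfl <;> constructor <;> nlinarith
      · rcases hbb with rfl | rfl <;> constructor <;> nlinarith
    subst hab
    rcases haa with rfl | rfl <;> rcases hbb with rfl | rfl
    · rfl
    · exfalso; linarith
    · exfalso; linarith
    · rfl

omit hl in
theorem left_mem_cantor_aux (hl : l < 1 / 2) {n : ℕ} {a : ℝ}
    (ha : (a, a + l ^ n) ∈ cantorIntervals l n) :
    ∀ k, k ≤ n → ∃ b, (b, b + l ^ k) ∈ cantorIntervals l k ∧
      Icc a (a + l ^ n) ⊆ Icc b (b + l ^ k) := by
  induction n generalizing a with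
  | zero =>
    intro k hk
    obtain rfl : k = 0 := by omega
    exact ⟨a, ha, Subset.rfl⟩
  | succ n ih =>
    intro k hk
    rcases Nat.lt_or_ge k (n + 1) with hk' | hk'
    · obtain ⟨b, hb, hab⟩ := cantorIntervals_succ_iff.1 ha
      obtain ⟨c, hc, hbc⟩ := ih hb k (by omega)
      refine ⟨c, hc, Subset.trans ?_ hbc⟩
      have h1 := child_le hl0 hl (n := n)
      have hp := pow_pos hl0 n
      rw [pow_succ']
      rcases hab with rfl | rfl
      · exact Icc_subset_Icc_right (by nlinarith)
      · exact Icc_subset_Icc (by nlinarith) (by nlinarith)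
    · obtain rfl : k = n + 1 := by omega
      exact ⟨a, ha, Subset.rfl⟩

/-- Left children keep the left end and right children keep the right end, so an end point survives
in every later step; in the earlier steps it lies in the ancestors of its interval. -/
theorem endpoint_mem_cantorSet {n : ℕ} {a : ℝ} (ha : (a, a + l ^ n) ∈ cantorIntervals l n) :
    a ∈ centralCantorSet l ∧ a + l ^ n ∈ centralCantorSet l := by
  have hp := fun k => pow_pos hl0 k
  have hL : ∀ k, (a, a + l ^ (n + k)) ∈ cantorIntervals l (n + k) := by
    intro k
    induction k with
    | zero => exact ha
    | succ k ih => exact cantorIntervals_succ_iff.2 ⟨a, ih, Or.inl rfl⟩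
  have hR : ∀ k, (a + l ^ n - l ^ (n + k), a + l ^ n - l ^ (n + k) + l ^ (n + k)) ∈
      cantorIntervals l (n + k) := by
    intro k
    induction k with
    | zero => simpa using ha
    | succ k ih => exact (cantorIntervals_succ_iff (n := n + k)).2 ⟨_, ih, Or.inr (by ring)⟩
  constructor <;> refine mem_iInter.2 fun m => ?_
  · rcases le_total m n with h | h
    · obtain ⟨b, hb, hab⟩ := left_mem_cantor_aux hl0 hl ha m h
      exact mem_iUnion₂.2 ⟨_, hb, hab (left_mem_Icc.2 (by linarith [hp n]))⟩
    · obtain ⟨k, rfl⟩ := Nat.exists_eq_add_of_le h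
      exact mem_iUnion₂.2 ⟨_, hL k, left_mem_Icc.2 (by linarith [hp (n + k)])⟩
  · rcases le_total m n with h | h
    · obtain ⟨b, hb, hab⟩ := left_mem_cantor_aux hl0 hl ha m h
      exact mem_iUnion₂.2 ⟨_, hb, hab (right_mem_Icc.2 (by linarith [hp n]))⟩
    · obtain ⟨k, rfl⟩ := Nat.exists_eq_add_of_le h
      refine mem_iUnion₂.2 ⟨_, hR k, ⟨?_, ?_⟩⟩
      · simp only; linarith [hp (n + k)]
      · simp only; linarith

omit hl0 hl

open Classical in
/-- The left end point of the interval of step `n` that contains the point `x` of the central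
Cantor set. -/
noncomputable def leftEnd (l : ℝ) (n : ℕ) (x : ℝ) : ℝ :=
  if h : ∃ a, (a, a + l ^ n) ∈ cantorIntervals l n ∧ x ∈ Icc a (a + l ^ n) then h.choose else 0

theorem leftEnd_spec {x : ℝ} (hx : x ∈ centralCantorSet l) (n : ℕ) :
    (leftEnd l n x, leftEnd l n x + l ^ n) ∈ cantorIntervals l n ∧
      x ∈ Icc (leftEnd l n x) (leftEnd l n x + l ^ n) := by
  have h : ∃ a, (a, a + l ^ n) ∈ cantorIntervals l n ∧ x ∈ Icc a (a + l ^ n) := by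
    obtain ⟨J, hJ, hxJ⟩ := mem_iUnion₂.1 (mem_iInter.1 hx n)
    have h1 := cantorIntervals_snd hJ
    exact ⟨J.1, by rw [← h1]; exact hJ, by rw [← h1]; exact hxJ⟩
  rw [leftEnd, dif_pos h]
  exact h.choose_spec

theorem leftEnd_zero {x : ℝ} (hx : x ∈ centralCantorSet l) : leftEnd l 0 x = 0 :=
  congrArg Prod.fst (mem_singleton_iff.1 (leftEnd_spec hx 0).1)

include hl0 hl in
theorem leftEnd_eq {n : ℕ} {a x : ℝ} (ha : (a, a + l ^ n) ∈ cantorIntervals l n)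
    (hx : x ∈ Icc a (a + l ^ n)) : leftEnd l n x = a := by
  have h : ∃ a, (a, a + l ^ n) ∈ cantorIntervals l n ∧ x ∈ Icc a (a + l ^ n) := ⟨a, ha, hx⟩
  rw [leftEnd, dif_pos h]
  exact cantorIntervals_unique hl0 hl h.choose_spec.1 ha h.choose_spec.2 hx

theorem finite_range_leftEnd (l : ℝ) (n : ℕ) :
    {a | ∃ x ∈ centralCantorSet l, leftEnd l n x = a}.Finite := by
  refine ((finite_cantorIntervals l n).image Prod.fst).subset ?_
  rintro _ ⟨x, hx, rfl⟩
  exact ⟨_, (leftEnd_spec hx n).1, rfl⟩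

variable (l) in
/-- Two points of the Cantor set lie in the same interval of step `n`. -/
def SameCyl (n : ℕ) (x y : centralCantorSet l) : Prop := leftEnd l n x = leftEnd l n y

theorem SameCyl.refl {n : ℕ} (x : centralCantorSet l) : SameCyl l n x x := rfl

theorem SameCyl.symm {n : ℕ} {x y : centralCantorSet l} (h : SameCyl l n x y) : SameCyl l n y x :=
  Eq.symm h

theorem SameCyl.trans {n : ℕ} {x y z : centralCantorSet l} (h : SameCyl l n x y)
    (h' : SameCyl l n y z) : SameCyl l n x z := Eq.trans h h'

theorem sameCyl_zero (x y : centralCantorSet l) : SameCyl l 0 x y :=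
  (leftEnd_zero x.2).trans (leftEnd_zero y.2).symm

theorem leftEnd_le (n : ℕ) (x : centralCantorSet l) : leftEnd l n x ≤ x := (leftEnd_spec x.2 n).2.1

theorem le_leftEnd_add (n : ℕ) (x : centralCantorSet l) : (x : ℝ) ≤ leftEnd l n x + l ^ n :=
  (leftEnd_spec x.2 n).2.2

theorem SameCyl.abs_sub_le {n : ℕ} {x y : centralCantorSet l} (h : SameCyl l n x y) :
    |(x : ℝ) - y| ≤ l ^ n := by
  have h1 := leftEnd_le n x
  have h2 := leftEnd_le n y
  have h3 := le_leftEnd_add n x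
  have h4 := le_leftEnd_add n y
  rw [SameCyl] at h
  rw [abs_le]
  constructor <;> linarith

include hl0 hl

theorem sameCyl_of_mem_Icc {n : ℕ} {x y : centralCantorSet l}
    (h : (y : ℝ) ∈ Icc (leftEnd l n x) (leftEnd l n x + l ^ n)) : SameCyl l n x y :=
  (leftEnd_eq hl0 hl (leftEnd_spec x.2 n).1 h).symm

theorem leftEnd_succ (n : ℕ) (x : centralCantorSet l) :
    leftEnd l (n + 1) x = leftEnd l n x ∨
      leftEnd l (n + 1) x = leftEnd l n x + (1 - l) * l ^ n := by
  obtain ⟨h1, h2⟩ := leftEnd_spec x.2 (n + 1)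
  obtain ⟨b, hb, h⟩ := cantorIntervals_succ_iff.1 h1
  have hbx : leftEnd l n x = b := by
    refine leftEnd_eq hl0 hl hb ?_
    have h3 := child_le hl0 hl (n := n)
    have hp := pow_pos hl0 n
    have hp' : 0 < l * l ^ n := mul_pos hl0 hp
    rw [pow_succ'] at h2
    obtain ⟨h4, h5⟩ := h2
    rcases h with h | h <;> rw [h] at h4 h5 <;> constructor <;> nlinarith
  rwa [hbx]

theorem SameCyl.of_succ {n : ℕ} {x y : centralCantorSet l} (h : SameCyl l (n + 1) x y) :
    SameCyl l n x y := by
  have aux : ∀ z : centralCantorSet l, leftEnd l n (leftEnd l (n + 1) z) = leftEnd l n z := by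
    intro z
    refine leftEnd_eq hl0 hl (leftEnd_spec z.2 n).1 ?_
    have hp := pow_pos hl0 n
    rcases leftEnd_succ hl0 hl n z with h | h <;> rw [h] <;> constructor <;> nlinarith
  rw [SameCyl] at h ⊢
  rw [← aux x, h, aux y]

theorem SameCyl.mono {n m : ℕ} (hnm : m ≤ n) {x y : centralCantorSet l} (h : SameCyl l n x y) :
    SameCyl l m x y := by
  induction n, hnm using Nat.le_induction with
  | base => exact h
  | succ n _ ih => exact ih (SameCyl.of_succ hl0 hl h)

/-- The end points of an interval of step `n` belong to the Cantor set. -/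
theorem exists_endpoints (n : ℕ) (x : centralCantorSet l) : ∃ a b : centralCantorSet l,
    (a : ℝ) = leftEnd l n x ∧ (b : ℝ) = leftEnd l n x + l ^ n ∧ SameCyl l n x a ∧
      SameCyl l n x b := by
  obtain ⟨h1, h2⟩ := endpoint_mem_cantorSet hl0 hl (leftEnd_spec x.2 n).1
  have hp := pow_pos hl0 n
  exact ⟨⟨_, h1⟩, ⟨_, h2⟩, rfl, rfl, sameCyl_of_mem_Icc hl0 hl ⟨le_rfl, by simp only; linarith⟩,
    sameCyl_of_mem_Icc hl0 hl ⟨by simp only; linarith, le_rfl⟩⟩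

/-- The two sides of the gap in the middle of an interval of step `n`. -/
theorem exists_gap (n : ℕ) (x : centralCantorSet l) : ∃ u v : centralCantorSet l,
    (u : ℝ) = leftEnd l n x + l ^ (n + 1) ∧ (v : ℝ) = leftEnd l n x + (1 - l) * l ^ n ∧
      SameCyl l n x u ∧ SameCyl l n x v ∧ (∀ c : centralCantorSet l, c ≤ u ∨ v ≤ c) := by
  have h := (leftEnd_spec x.2 n).1
  have h1 := (endpoint_mem_cantorSet hl0 hl
    (cantorIntervals_succ_iff.2 ⟨_, h, Or.inl rfl⟩)).2
  have h2 := (endpoint_mem_cantorSet hl0 hl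
    (cantorIntervals_succ_iff.2 ⟨_, h, Or.inr rfl⟩)).1
  have hp := pow_pos hl0 n
  have hp' : 0 < l * l ^ n := mul_pos hl0 hp
  have hc := child_le hl0 hl (n := n)
  refine ⟨⟨_, h1⟩, ⟨_, h2⟩, rfl, rfl, sameCyl_of_mem_Icc hl0 hl ?_,
    sameCyl_of_mem_Icc hl0 hl ?_, fun c => ?_⟩
  · simp only [pow_succ']
    constructor <;> nlinarith
  · constructor <;> simp only <;> nlinarith
  · by_contra! hcon
    obtain ⟨h3, h4⟩ := hcon
    replace h3 : leftEnd l n x + l ^ (n + 1) < c := h3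
    replace h4 : (c : ℝ) < leftEnd l n x + (1 - l) * l ^ n := h4
    rw [pow_succ'] at h3
    have h5 : SameCyl l n x c := sameCyl_of_mem_Icc hl0 hl ⟨by linarith, by nlinarith⟩
    rw [SameCyl] at h5
    have h6 := leftEnd_le (n + 1) c
    have h7 := le_leftEnd_add (n + 1) c
    rw [pow_succ'] at h7
    rcases leftEnd_succ hl0 hl n c with h8 | h8 <;> rw [h8] at h6 h7 <;> linarith

/-- Take the last step at which `y` and `z` share an interval: they then lie in its left and right
child respectively, on either side of its central gap. -/
theorem exists_split {y z : centralCantorSet l} (hyz : y < z) : ∃ n : ℕ, SameCyl l n y z ∧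
    ¬ SameCyl l (n + 1) y z ∧
    (y : ℝ) ≤ leftEnd l n y + l ^ (n + 1) ∧ leftEnd l n y + (1 - l) * l ^ n ≤ z := by
  classical
  have hyz' : (y : ℝ) < z := hyz
  have hex : ∃ n : ℕ, ¬ SameCyl l n y z := by
    obtain ⟨n, hn⟩ := exists_pow_lt_of_lt_one (sub_pos.2 hyz') (by linarith : l < 1)
    refine ⟨n, fun h => ?_⟩
    have := h.abs_sub_le
    rw [abs_sub_comm, abs_of_pos (sub_pos.2 hyz')] at this
    linarith
  have h1 := Nat.find_spec hex
  have h0 : Nat.find hex ≠ 0 := by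
    intro h
    rw [h] at h1
    exact h1 (sameCyl_zero y z)
  obtain ⟨n, hn⟩ := Nat.exists_eq_succ_of_ne_zero h0
  have h2 : SameCyl l n y z := by
    by_contra h
    have := Nat.find_min' hex h
    omega
  rw [hn] at h1
  refine ⟨n, h2, h1, ?_⟩
  have hc := child_le hl0 hl (n := n)
  have e1 := leftEnd_le (n + 1) y
  have e2 := le_leftEnd_add (n + 1) y
  have e3 := leftEnd_le (n + 1) z
  have e4 := le_leftEnd_add (n + 1) z
  have h2' : leftEnd l n y = leftEnd l n z := h2
  rw [Nat.succ_eq_add_one, SameCyl] at h1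
  rw [pow_succ'] at e2 e4 ⊢
  rcases leftEnd_succ hl0 hl n y with hy | hy <;> rcases leftEnd_succ hl0 hl n z with hz | hz
  · exact absurd (by rw [hy, hz, h2']) h1
  · rw [hy] at e2
    rw [hz, ← h2'] at e3
    exact ⟨e2, e3⟩
  · exfalso
    rw [hy] at e1
    rw [hz, ← h2'] at e4
    linarith
  · exact absurd (by rw [hy, hz, h2']) h1

/-- Points that separate at a step `i ≤ n` are at least a central gap apart, of length `(1 - 2 * l)
* l ^ i`. Thus cylinders are open. -/
theorem sameCyl_of_abs_sub_lt {n : ℕ} {x y : centralCantorSet l}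
    (h : |(x : ℝ) - y| < (1 - 2 * l) * l ^ n) : SameCyl l n x y := by
  have key : ∀ {y z : centralCantorSet l}, y < z → (z : ℝ) - y < (1 - 2 * l) * l ^ n →
      SameCyl l n y z := by
    intro y z hyz h
    obtain ⟨i, h1, -, h2, h3⟩ := exists_split hl0 hl hyz
    rcases le_total n i with hni | hni
    · exact h1.mono hl0 hl hni
    · exfalso
      have h4 : l ^ n ≤ l ^ i := pow_le_pow_of_le_one hl0.le (by linarith) hni
      rw [pow_succ'] at h2
      nlinarith
  rcases lt_trichotomy x y with hxy | hxy | hxy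
  · refine key hxy ?_
    rwa [abs_sub_comm, abs_of_pos (sub_pos.2 (show _ < (_ : ℝ) from hxy))] at h
  · rw [hxy]; rfl
  · refine (key hxy ?_).symm
    rwa [abs_of_pos (sub_pos.2 (show _ < (_ : ℝ) from hxy))] at h

theorem cyl_mem_nhds (n : ℕ) (x : centralCantorSet l) : {y | SameCyl l n x y} ∈ 𝓝 x := by
  refine Metric.mem_nhds_iff.2 ⟨(1 - 2 * l) * l ^ n, ?_, fun y hy => ?_⟩
  · have := pow_pos hl0 n
    have : 0 < 1 - 2 * l := by linarith
    positivity
  · refine sameCyl_of_abs_sub_lt hl0 hl ?_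
    rw [Metric.mem_ball, Subtype.dist_eq, Real.dist_eq, abs_sub_comm] at hy
    exact hy

theorem exists_cyl_subset {x : centralCantorSet l} {s : Set (centralCantorSet l)} (hs : s ∈ 𝓝 x) :
    ∃ n : ℕ, ∀ y, SameCyl l n x y → y ∈ s := by
  obtain ⟨ε, hε, h⟩ := Metric.mem_nhds_iff.1 hs
  obtain ⟨n, hn⟩ := exists_pow_lt_of_lt_one hε (by linarith : l < 1)
  refine ⟨n, fun y hy => h ?_⟩
  rw [Metric.mem_ball, Subtype.dist_eq, Real.dist_eq, abs_sub_comm]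
  exact hy.abs_sub_le.trans_lt hn

/-- Two consecutive points of the Cantor set bound a gap. -/
theorem gap_length {u v : centralCantorSet l} (huv : u < v)
    (h : ∀ c : centralCantorSet l, c ≤ u ∨ v ≤ c) :
    ∃ n : ℕ, (v : ℝ) - u = (1 - 2 * l) * l ^ n ∧ SameCyl l n u v ∧ ¬ SameCyl l (n + 1) u v := by
  obtain ⟨n, h1, h1', h2, h3⟩ := exists_split hl0 hl huv
  obtain ⟨u', v', hu', hv', -, -, h4⟩ := exists_gap hl0 hl n u
  have huu : (u' : ℝ) = u := by
    refine le_antisymm ?_ (by rw [hu']; exact h2)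
    rcases h u' with h5 | h5
    · exact h5
    · exfalso
      have h6 : (v : ℝ) ≤ u' := h5
      have := child_le hl0 hl (n := n)
      rw [hu', pow_succ'] at h6
      linarith
  have hvv : (v' : ℝ) = v := by
    refine le_antisymm (by rw [hv']; exact h3) ?_
    rcases h v' with h5 | h5
    · exfalso
      have h6 : (v' : ℝ) ≤ u := h5
      have := child_le hl0 hl (n := n)
      rw [pow_succ'] at h2
      linarith
    · exact h5
  refine ⟨n, ?_, h1, h1'⟩
  rw [← huu, ← hvv, hu', hv']
  ring

omit hl0 hl in
theorem isCompact_centralCantorSet (l : ℝ) : IsCompact (centralCantorSet l) := by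
  have hcl : IsClosed (centralCantorSet l) := isClosed_iInter fun n =>
    (finite_cantorIntervals l n).isClosed_biUnion fun _ _ => isClosed_Icc
  refine isCompact_Icc.of_isClosed_subset hcl (fun x hx => ?_ : _ ⊆ Icc (0 : ℝ) 1)
  have := (leftEnd_spec hx 0).2
  rw [leftEnd_zero hx] at this
  simpa using this

omit hl0 hl in
theorem centralCantorSet_subset_Icc (l : ℝ) : centralCantorSet l ⊆ Icc (0 : ℝ) 1 := fun x hx => by
  have := (leftEnd_spec hx 0).2
  rw [leftEnd_zero hx] at this
  simpa using this

/-- Between two points of the set there is a gap, which a connected subset could not cross. -/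
theorem isTotallyDisconnected_centralCantorSet : IsTotallyDisconnected (centralCantorSet l) := by
  intro t ht hpre x hx y hy
  by_contra hne
  wlog hxy : x < y generalizing x y
  · exact this hy hx (Ne.symm hne) (lt_of_le_of_ne (not_lt.1 hxy) (Ne.symm hne))
  obtain ⟨n, h1, -, h2, h3⟩ := exists_split hl0 hl (y := ⟨x, ht hx⟩) (z := ⟨y, ht hy⟩) hxy
  obtain ⟨u, v, hu, hv, -, -, h⟩ := exists_gap hl0 hl n ⟨x, ht hx⟩
  have hc := child_le hl0 hl (n := n)
  have huv : (u : ℝ) < v := by rw [hu, hv, pow_succ']; linarith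
  obtain ⟨m, hm1, hm2⟩ := exists_between huv
  have hm : m ∈ t := hpre.ordConnected.out hx hy ⟨by rw [hu] at hm1; simp only at h2; linarith,
    by rw [hv] at hm2; simp only at h3; linarith⟩
  rcases h ⟨m, ht hm⟩ with h4 | h4
  · exact absurd h4 (not_le.2 hm1)
  · exact absurd h4 (not_le.2 hm2)

end CantorSet
end CantorTits

namespace CantorTits

open Filter Set

/-! ### Rigidity: difference quotients, gaps and functions constant across gaps -/

section LocalSimilarity

variable {l : ℝ}

/-- `g` is strictly differentiable along the Cantor set. -/
def StrictDiff (g : centralCantorSet l → centralCantorSet l) : Prop :=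
  ∀ x, ∃ ρ : ℝ, ∀ ε : ℝ, 0 < ε → ∀ᶠ p : centralCantorSet l × centralCantorSet l in 𝓝 (x, x),
    |(g p.1 : ℝ) - g p.2 - ρ * ((p.1 : ℝ) - p.2)| ≤ ε * |(p.1 : ℝ) - p.2|

/-- `g` maps the part of the Cantor set in the interval of step `n` around `x` to the part in the
interval of step `m` around `g x`, by a similarity that respects the smaller intervals. -/
def MapsCyl (g : centralCantorSet l → centralCantorSet l) (x : centralCantorSet l) (n m : ℕ) :
    Prop :=
  (∀ k y, SameCyl l (n + k) x y ↔ SameCyl l (m + k) (g x) (g y)) ∧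
    ∀ y z, SameCyl l n x y → SameCyl l n x z →
      |(g y : ℝ) - g z| * l ^ n = l ^ m * |(y : ℝ) - z|

/-- `g` maps small intervals around `x` to intervals, by similarities of a fixed ratio `l ^ c`. -/
def LocalSimilar (g : centralCantorSet l → centralCantorSet l) (N : ℕ) (x : centralCantorSet l) :
    Prop :=
  ∃ c : ℤ, ∀ n, N ≤ n → ∃ m : ℕ, (m : ℤ) = n + c ∧ MapsCyl g x n m

theorem LocalSimilar.mono {g : centralCantorSet l → centralCantorSet l} {N N' : ℕ}
    {x : centralCantorSet l} (h : LocalSimilar g N x) (hN : N ≤ N') : LocalSimilar g N' x := by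
  obtain ⟨c, hc⟩ := h
  exact ⟨c, fun n hn => hc n (hN.trans hn)⟩

variable (hl0 : 0 < l) (hl : l < 1 / 2)
include hl0 hl

theorem exists_sameCyl_ne (n : ℕ) (x : centralCantorSet l) : ∃ y, SameCyl l n x y ∧ y ≠ x := by
  obtain ⟨a, b, ha, hb, hxa, hxb⟩ := exists_endpoints hl0 hl n x
  have hp := pow_pos hl0 n
  by_cases h : a = x
  · refine ⟨b, hxb, fun h' => ?_⟩
    have : (a : ℝ) = b := by rw [h, h']
    rw [ha, hb] at this
    linarith
  · exact ⟨a, hxa, h⟩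

/-- The derivative is nonzero because the inverse is Lipschitz near `g x`, with constant `|ρ'| + 1`.
The bounds `3/4` and `5/4` are chosen because their quotient `5/3` is less than `2 < 1 / l`, which
is what `add_eq_add_of_pow_ratio` needs. -/
theorem StrictDiff.exists_pos {g : centralCantorSet l ≃ centralCantorSet l} (hg : StrictDiff g)
    (hg' : StrictDiff g.symm) (hc : Continuous g) (x : centralCantorSet l) :
    ∃ ρ σ : ℝ, 0 < ρ ∧ (σ = 1 ∨ σ = -1) ∧
    ∀ᶠ p : centralCantorSet l × centralCantorSet l in 𝓝 (x, x), p.1 ≤ p.2 →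
      3 / 4 * ρ * ((p.2 : ℝ) - p.1) ≤ σ * ((g p.2 : ℝ) - g p.1) ∧
      σ * ((g p.2 : ℝ) - g p.1) ≤ 5 / 4 * ρ * ((p.2 : ℝ) - p.1) := by
  obtain ⟨ρ, hρ⟩ := hg x
  obtain ⟨ρ', hρ'⟩ := hg' (g x)
  have hne : ρ ≠ 0 := by
    rintro rfl
    have h1 := hρ' 1 one_pos
    have hcc : Tendsto (fun p : centralCantorSet l × centralCantorSet l => (g p.1, g p.2))
        (𝓝 (x, x)) (𝓝 (g x, g x)) :=
      ((hc.comp continuous_fst).prodMk (hc.comp continuous_snd)).tendsto (x, x)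
    have h2 := hcc.eventually h1
    have hA : 0 < |ρ'| + 1 := by positivity
    have h3 := hρ (1 / (2 * (|ρ'| + 1))) (by positivity)
    obtain ⟨s, hs, hs'⟩ := (nhds_prod_eq (X := centralCantorSet l) (x := x) (y := x) ▸
      (h2.and h3)).exists_mem
    obtain ⟨t, ht, hts⟩ := Filter.mem_prod_same_iff.1 (hs : s ∈ 𝓝 x ×ˢ 𝓝 x)
    obtain ⟨n, hn⟩ := exists_cyl_subset hl0 hl ht
    obtain ⟨y, hy, hyx⟩ := exists_sameCyl_ne hl0 hl n x
    obtain ⟨h4, h5⟩ := hs' (y, x) (hts ⟨hn y hy, hn x rfl⟩)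
    simp only [Equiv.symm_apply_apply, zero_mul, sub_zero, one_mul] at h4 h5
    have h6 : 0 < |(y : ℝ) - x| := abs_pos.2 (sub_ne_zero.2 fun h => hyx (Subtype.ext h))
    have h7 : |(y : ℝ) - x| ≤ (|ρ'| + 1) * |(g y : ℝ) - g x| := by
      have h8 := abs_sub_abs_le_abs_sub ((y : ℝ) - x) (ρ' * ((g y : ℝ) - g x))
      rw [abs_mul] at h8
      linarith
    have h9 : (|ρ'| + 1) * |(g y : ℝ) - g x| ≤ |(y : ℝ) - x| / 2 := by
      calc (|ρ'| + 1) * |(g y : ℝ) - g x|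
          ≤ (|ρ'| + 1) * (1 / (2 * (|ρ'| + 1)) * |(y : ℝ) - x|) :=
            mul_le_mul_of_nonneg_left h5 hA.le
        _ = |(y : ℝ) - x| / 2 := by field_simp
    linarith
  obtain ⟨σ, hσ, hσρ⟩ : ∃ σ : ℝ, (σ = 1 ∨ σ = -1) ∧ σ * ρ = |ρ| := by
    rcases le_total 0 ρ with h | h
    · exact ⟨1, Or.inl rfl, by rw [abs_of_nonneg h, one_mul]⟩
    · exact ⟨-1, Or.inr rfl, by rw [abs_of_nonpos h]; ring⟩
  have hpos : 0 < |ρ| := abs_pos.2 hne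
  refine ⟨|ρ|, σ, hpos, hσ, ?_⟩
  filter_upwards [hρ (|ρ| / 4) (by positivity)] with p hp hle
  have hle' : (0 : ℝ) ≤ (p.2 : ℝ) - p.1 := sub_nonneg.2 hle
  have hσ1 : |σ| = 1 := by rcases hσ with rfl | rfl <;> simp
  have h1 : |σ * ((g p.2 : ℝ) - g p.1) - |ρ| * ((p.2 : ℝ) - p.1)| ≤ |ρ| / 4 * ((p.2 : ℝ) - p.1) := by
    rw [← hσρ, show σ * ((g p.2 : ℝ) - g p.1) - σ * ρ * ((p.2 : ℝ) - p.1) =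
      -σ * ((g p.1 : ℝ) - g p.2 - ρ * ((p.1 : ℝ) - p.2)) by ring, abs_mul, abs_neg, hσ1, one_mul,
      hσρ]
    rwa [abs_sub_comm (p.1 : ℝ), abs_of_nonneg hle'] at hp
  rw [abs_le] at h1
  constructor <;> nlinarith

/-- A function that does not jump across the gaps of a Cantor set of Hausdorff dimension less than
one and that is Lipschitz is constant. -/
theorem eq_of_gap_eq {E : centralCantorSet l → ℝ} {N : ℕ} {x : centralCantorSet l} {B : ℝ}
    (hB : ∀ y z, SameCyl l N x y → SameCyl l N x z → |E y - E z| ≤ B * |(y : ℝ) - z|)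
    (hgap : ∀ u v, SameCyl l N x u → SameCyl l N x v → u < v →
      (∀ c : centralCantorSet l, c ≤ u ∨ v ≤ c) → E u = E v)
    {y z : centralCantorSet l} (hy : SameCyl l N x y) (hz : SameCyl l N x z) : E y = E z := by
  have hB0 : 0 ≤ B := by
    obtain ⟨w, hw, hwx⟩ := exists_sameCyl_ne hl0 hl N x
    have h1 := (abs_nonneg _).trans (hB w x hw rfl)
    have h2 : 0 < |(w : ℝ) - x| := abs_pos.2 (sub_ne_zero.2 fun h => hwx (Subtype.ext h))
    exact nonneg_of_mul_nonneg_left h1 h2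
  -- Cutting at central gaps `k` times splits the increment of `E` over an interval of step `i` into
  -- at most `2 ^ k` increments over intervals of step `i + k`, since the gaps contribute nothing.
  -- For `i = N` the bound tends to zero as `2 * l < 1`.
  have key : ∀ k i, N ≤ i → ∀ y z, SameCyl l N x y → SameCyl l i y z →
      |E y - E z| ≤ 2 ^ k * (B * l ^ (i + k)) := by
    intro k
    induction k with
    | zero =>
      intro i hi y z hy hyz
      have h1 := hB y z hy (hy.trans (hyz.mono hl0 hl hi))
      have h2 := mul_le_mul_of_nonneg_left hyz.abs_sub_le hB0
      simpa using h1.trans h2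
    | succ k ih =>
      intro i hi y z hy hyz
      have hpos : 0 ≤ 2 ^ k * (B * l ^ (i + (k + 1))) := by positivity
      by_cases hs : SameCyl l (i + 1) y z
      · have := ih (i + 1) (by omega) y z hy hs
        rw [show i + 1 + k = i + (k + 1) by ring] at this
        rw [pow_succ 2 k]
        linarith
      · wlog hlt : y < z generalizing y z
        · rw [abs_sub_comm]
          refine this z y (hy.trans (hyz.mono hl0 hl hi)) hyz.symm (fun h => hs h.symm) ?_
          exact lt_of_le_of_ne (not_lt.1 hlt) fun h => hs (h ▸ rfl)
        obtain ⟨j, hj1, hj2, hj3, hj4⟩ := exists_split hl0 hl hlt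
        obtain rfl : i = j := by
          rcases lt_trichotomy i j with h | h | h
          · exact absurd (hj1.mono hl0 hl h) hs
          · exact h
          · exact absurd (hyz.mono hl0 hl h) hj2
        obtain ⟨u, v, hu, hv, hyu, hyv, hc⟩ := exists_gap hl0 hl i y
        have hch := child_le hl0 hl (n := i)
        have huv : u < v := by
          change (u : ℝ) < v
          rw [hu, hv, pow_succ']
          linarith
        have hyu' : SameCyl l (i + 1) y u := by
          by_contra hcon
          have hlt' : y < u := by
            refine lt_of_le_of_ne ?_ fun h => hcon (h ▸ rfl)
            change (y : ℝ) ≤ u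
            rw [hu]
            exact hj3
          obtain ⟨p, hp1, hp2, hp3, hp4⟩ := exists_split hl0 hl hlt'
          have hpi : p = i := by
            rcases lt_trichotomy i p with h | h | h
            · exact absurd (hp1.mono hl0 hl h) hcon
            · exact h.symm
            · exact absurd (hyu.mono hl0 hl h) hp2
          rw [hpi, hu, pow_succ'] at hp4
          linarith
        have hvz' : SameCyl l (i + 1) v z := by
          by_contra hcon
          have hlt' : v < z := by
            refine lt_of_le_of_ne ?_ fun h => hcon (h ▸ rfl)
            change (v : ℝ) ≤ z
            rw [hv]
            exact hj4
          obtain ⟨p, hp1, hp2, hp3, hp4⟩ := exists_split hl0 hl hlt'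
          have hpi : p = i := by
            rcases lt_trichotomy i p with h | h | h
            · exact absurd (hp1.mono hl0 hl h) hcon
            · exact h.symm
            · exact absurd ((hyv.symm.trans hyz).mono hl0 hl h) hp2
          have hyv' : leftEnd l i y = leftEnd l i v := hyv
          rw [hpi, ← hyv', hv, pow_succ'] at hp3
          linarith
        have h1 := ih (i + 1) (by omega) y u hy hyu'
        have h2 := hgap u v (hy.trans (hyu.mono hl0 hl hi)) (hy.trans (hyv.mono hl0 hl hi)) huv hc
        have h3 := ih (i + 1) (by omega) v z (hy.trans (hyv.mono hl0 hl hi)) hvz'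
        rw [show i + 1 + k = i + (k + 1) by ring] at h1 h3
        calc |E y - E z| = |(E y - E u) + (E v - E z)| := by rw [h2]; ring_nf
          _ ≤ |E y - E u| + |E v - E z| := abs_add_le _ _
          _ ≤ _ := by rw [pow_succ 2 k]; linarith
  have hlim : Tendsto (fun k : ℕ => 2 ^ k * (B * l ^ (N + k))) atTop (𝓝 0) := by
    have h1 : Tendsto (fun k : ℕ => (B * l ^ N) * (2 * l) ^ k) atTop (𝓝 ((B * l ^ N) * 0)) :=
      (tendsto_pow_atTop_nhds_zero_of_lt_one (by linarith) (by linarith)).const_mul _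
    rw [mul_zero] at h1
    refine h1.congr fun k => ?_
    rw [mul_pow, pow_add]
    ring
  have h0 : |E y - E z| ≤ 0 := ge_of_tendsto' hlim fun k =>
    key k N le_rfl y z hy (hy.symm.trans hz)
  exact sub_eq_zero.1 (abs_eq_zero.1 (le_antisymm h0 (abs_nonneg _)))

end LocalSimilarity
end CantorTits

namespace CantorTits

open Filter Set

/-! ### From strict differentiability to local similarity -/

section LocalSimilarity

variable {l : ℝ} (hl0 : 0 < l) (hl : l < 1 / 2)
include hl0 hl

/-- The quotients `l ^ j / l ^ i` and `l ^ j' / l ^ i'` differ by a factor at most `5/3`, whereas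
distinct powers of `l` differ by a factor greater than 2. -/
theorem add_eq_add_of_pow_ratio {ρ : ℝ} (hρ : 0 < ρ) {i j i' j' : ℕ}
    (h1 : 3 / 4 * ρ * l ^ i ≤ l ^ j) (h2 : l ^ j ≤ 5 / 4 * ρ * l ^ i)
    (h1' : 3 / 4 * ρ * l ^ i' ≤ l ^ j') (h2' : l ^ j' ≤ 5 / 4 * ρ * l ^ i') :
    j + i' = j' + i := by
  have key : ∀ {i j i' j' : ℕ}, l ^ j ≤ 5 / 4 * ρ * l ^ i → 3 / 4 * ρ * l ^ i' ≤ l ^ j' →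
      ¬ j + i' < j' + i := by
    intro i j i' j' h2 h1' hlt
    have e1 : l ^ (j' + i) ≤ l ^ (j + i' + 1) :=
      pow_le_pow_of_le_one hl0.le (by linarith) (by omega)
    rw [pow_succ, pow_add, pow_add] at e1
    have hi := pow_pos hl0 i
    have hi' := pow_pos hl0 i'
    have hj := pow_pos hl0 j
    have e2 := mul_le_mul_of_nonneg_right h1' hi.le
    have e3 := mul_le_mul_of_nonneg_right h2 hi'.le
    have e4 : l ^ j * l ^ i' * l ≤ l ^ j * l ^ i' * (1 / 2) :=
      mul_le_mul_of_nonneg_left hl.le (by positivity)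
    have e5 : 0 < ρ * l ^ i * l ^ i' := by positivity
    nlinarith
  rcases lt_trichotomy (j + i') (j' + i) with h | h | h
  · exact absurd h (key h2 h1')
  · exact h
  · exact absurd h (key h2' h1)

/-- The image of a gap under a monotone map is a gap. -/
theorem image_gap_length {g : centralCantorSet l ≃ centralCantorSet l} {σ : ℝ}
    (hσ : σ = 1 ∨ σ = -1) {u v : centralCantorSet l}
    (hc : ∀ c : centralCantorSet l, c ≤ u ∨ v ≤ c) (hσuv : 0 < σ * ((g v : ℝ) - g u))
    (hb : ∀ c : centralCantorSet l, c ∈ uIcc (g u) (g v) → u ≤ g.symm c ∧ g.symm c ≤ v) :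
    ∃ j : ℕ, σ * ((g v : ℝ) - g u) = (1 - 2 * l) * l ^ j := by
  have hends : ∀ c ∈ uIcc (g u) (g v), c = g u ∨ c = g v := by
    intro c hc'
    obtain ⟨h1, h2⟩ := hb c hc'
    rcases hc (g.symm c) with h | h
    · exact Or.inl (by rw [← le_antisymm h h1, Equiv.apply_symm_apply])
    · exact Or.inr (by rw [← le_antisymm h2 h, Equiv.apply_symm_apply])
  rcases hσ with rfl | rfl
  · have hlt : g u < g v := by
      change (g u : ℝ) < g v
      linarith
    obtain ⟨j, hj, -⟩ := gap_length hl0 hl hlt fun c => by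
      by_contra! hcon
      rcases hends c (by rw [uIcc_of_le hlt.le]; exact ⟨hcon.1.le, hcon.2.le⟩) with h | h
      · exact hcon.1.ne' h
      · exact hcon.2.ne h
    exact ⟨j, by linarith⟩
  · have hlt : g v < g u := by
      change (g v : ℝ) < g u
      linarith
    obtain ⟨j, hj, -⟩ := gap_length hl0 hl hlt fun c => by
      by_contra! hcon
      rcases hends c (by rw [uIcc_of_ge hlt.le]; exact ⟨hcon.1.le, hcon.2.le⟩) with h | h
      · exact hcon.2.ne h
      · exact hcon.1.ne' h
    exact ⟨j, by linarith⟩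

/-- A bijection of the Cantor set that is monotone near a point, with difference quotients in a
narrow range, is a local similarity of ratio a power of `l`. -/
theorem exists_ratio {g : centralCantorSet l ≃ centralCantorSet l} {N : ℕ}
    {x : centralCantorSet l} {ρ σ : ℝ} (hρ : 0 < ρ) (hσ : σ = 1 ∨ σ = -1)
    (ha : ∀ y z, SameCyl l N x y → SameCyl l N x z → y ≤ z →
      3 / 4 * ρ * ((z : ℝ) - y) ≤ σ * ((g z : ℝ) - g y) ∧
      σ * ((g z : ℝ) - g y) ≤ 5 / 4 * ρ * ((z : ℝ) - y))
    (hb : ∀ u v, SameCyl l N x u → SameCyl l N x v → u ≤ v → ∀ c : centralCantorSet l,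
      c ∈ uIcc (g u) (g v) → u ≤ g.symm c ∧ g.symm c ≤ v) :
    ∃ j₀ : ℕ, ∀ y z, SameCyl l N x y → SameCyl l N x z →
      σ * ((g z : ℝ) - g y) = l ^ j₀ / l ^ N * ((z : ℝ) - y) := by
  have h2l : 0 < 1 - 2 * l := by linarith
  have hgap : ∀ u v, SameCyl l N x u → SameCyl l N x v → u < v →
      (∀ c : centralCantorSet l, c ≤ u ∨ v ≤ c) → ∃ i j : ℕ, (v : ℝ) - u = (1 - 2 * l) * l ^ i ∧
        σ * ((g v : ℝ) - g u) = (1 - 2 * l) * l ^ j ∧ 3 / 4 * ρ * l ^ i ≤ l ^ j ∧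
        l ^ j ≤ 5 / 4 * ρ * l ^ i := by
    intro u v hu hv huv hc
    obtain ⟨h1, h2⟩ := ha u v hu hv huv.le
    have h0 : (0 : ℝ) < (v : ℝ) - u := sub_pos.2 (show (u : ℝ) < v from huv)
    obtain ⟨i, hi, -⟩ := gap_length hl0 hl huv hc
    obtain ⟨j, hj⟩ := image_gap_length hl0 hl hσ hc
      (lt_of_lt_of_le (by positivity) h1) (hb u v hu hv huv.le)
    refine ⟨i, j, hi, hj, ?_, ?_⟩
    · rw [hi, hj] at h1
      refine le_of_mul_le_mul_left ?_ h2l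
      linarith
    · rw [hi, hj] at h2
      refine le_of_mul_le_mul_left ?_ h2l
      linarith
  obtain ⟨u₀, v₀, hu₀, hv₀, hxu₀, hxv₀, hc₀⟩ := exists_gap hl0 hl N x
  have huv₀ : u₀ < v₀ := by
    have := child_le hl0 hl (n := N)
    change (u₀ : ℝ) < v₀
    rw [hu₀, hv₀, pow_succ']
    linarith
  -- The central gap of the interval itself, of length `(1 - 2 * l) * l ^ N`, fixes the ratio; every
  -- other gap is then compared with it.
  obtain ⟨i₀, j₁, hi₀, -, hA₀, hB₀⟩ := hgap u₀ v₀ hxu₀ hxv₀ huv₀ hc₀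
  obtain rfl : i₀ = N := by
    rw [hu₀, hv₀, pow_succ'] at hi₀
    have h1 : (1 - 2 * l) * l ^ N = (1 - 2 * l) * l ^ i₀ := by linarith
    exact (pow_right_injective₀ hl0 (by linarith) (mul_left_cancel₀ h2l.ne' h1)).symm
  have hN := pow_pos hl0 i₀
  have hj₁ := pow_pos hl0 j₁
  refine ⟨j₁, fun y z hy hz => ?_⟩
  -- The defect from linearity is Lipschitz and takes equal values at the two sides of each gap,
  -- hence is constant.
  have hE := eq_of_gap_eq hl0 hl (E := fun y => σ * g y - l ^ j₁ / l ^ i₀ * y) (N := i₀) (x := x)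
    (B := 5 / 4 * ρ + l ^ j₁ / l ^ i₀) ?_ ?_ hy hz
  · linarith
  · intro y z hy hz
    wlog hyz : y ≤ z generalizing y z
    · rw [abs_sub_comm, abs_sub_comm (y : ℝ)]
      exact this z y hz hy (le_of_not_ge hyz)
    obtain ⟨h1, h2⟩ := ha y z hy hz hyz
    have h0 : (0 : ℝ) ≤ (z : ℝ) - y := sub_nonneg.2 hyz
    have hq : 0 < l ^ j₁ / l ^ i₀ := by positivity
    have hq' := mul_nonneg hq.le h0
    have hρ' := mul_nonneg hρ.le h0
    rw [abs_sub_comm (y : ℝ), abs_of_nonneg h0, abs_le]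
    constructor <;> nlinarith
  · intro u v hu hv huv hc
    obtain ⟨i, j, hi, hj, hA, hB⟩ := hgap u v hu hv huv hc
    have h1 := add_eq_add_of_pow_ratio hl0 hl hρ hA₀ hB₀ hA hB
    have h2 : l ^ j₁ * l ^ i = l ^ j * l ^ i₀ := by rw [← pow_add, ← pow_add, h1]
    have h3 : l ^ j₁ / l ^ i₀ * ((v : ℝ) - u) = σ * ((g v : ℝ) - g u) := by
      rw [hi, hj, div_mul_eq_mul_div, div_eq_iff hN.ne']
      linear_combination (1 - 2 * l) * h2
    linarith

theorem sameCyl_iff_endpoints {n : ℕ} {x a b : centralCantorSet l} (ha : (a : ℝ) = leftEnd l n x)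
    (hb : (b : ℝ) = leftEnd l n x + l ^ n) (y : centralCantorSet l) :
    SameCyl l n x y ↔ a ≤ y ∧ y ≤ b := by
  constructor
  · intro h
    have h1 := leftEnd_le n y
    have h2 := le_leftEnd_add n y
    rw [SameCyl] at h
    rw [← h] at h1 h2
    exact ⟨show (a : ℝ) ≤ y by rwa [ha], show (y : ℝ) ≤ b by rwa [hb]⟩
  · rintro ⟨h1, h2⟩
    refine sameCyl_of_mem_Icc hl0 hl ⟨?_, ?_⟩
    · rw [← ha]; exact h1
    · rw [← hb]; exact h2

/-- By `exists_ratio` the map is exactly affine on the interval of step `N`, with ratio `κ` up to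
sign; it remains to see that it respects cylinders. The image of a cylinder of step `n` is the part
of the Cantor set between two points `p < q` at distance `κ * l ^ n`. If `p` and `q` split at step
`m`, then `κ * l ^ n ≤ l ^ m`. The central gap of step `m` between them pulls back to a gap of some
step `i ≥ n`, so `l ^ m = κ * l ^ i ≤ κ * l ^ n`. Equality makes `p` and `q` the end points of a
cylinder of step `m`. -/
theorem localSimilar_of_monotone {g : centralCantorSet l ≃ centralCantorSet l} {N : ℕ}
    {x : centralCantorSet l} {ρ σ : ℝ} (hρ : 0 < ρ) (hσ : σ = 1 ∨ σ = -1)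
    (ha : ∀ y z, SameCyl l N x y → SameCyl l N x z → y ≤ z →
      3 / 4 * ρ * ((z : ℝ) - y) ≤ σ * ((g z : ℝ) - g y) ∧
      σ * ((g z : ℝ) - g y) ≤ 5 / 4 * ρ * ((z : ℝ) - y))
    (hb : ∀ u v, SameCyl l N x u → SameCyl l N x v → u ≤ v → ∀ c : centralCantorSet l,
      c ∈ uIcc (g u) (g v) → u ≤ g.symm c ∧ g.symm c ≤ v) {x' : centralCantorSet l}
    (hx' : SameCyl l N x x') : LocalSimilar g N x' := by
  have h2l : 0 < 1 - 2 * l := by linarith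
  obtain ⟨j₀, hj₀⟩ := exists_ratio hl0 hl hρ hσ ha hb
  set κ := l ^ j₀ / l ^ N with hκ
  have hN := pow_pos hl0 N
  have hj₀' := pow_pos hl0 j₀
  have hκ0 : 0 < κ := by positivity
  have hσ1 : |σ| = 1 := by rcases hσ with rfl | rfl <;> simp
  have habs : ∀ y z, SameCyl l N x y → SameCyl l N x z → |(g z : ℝ) - g y| = κ * |(z : ℝ) - y| := by
    intro y z hy hz
    have := congrArg abs (hj₀ y z hy hz)
    rwa [abs_mul, hσ1, one_mul, abs_mul, abs_of_pos hκ0] at this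
  have hcyl : ∀ n, N ≤ n → ∀ y, SameCyl l N x y →
      ∃ m : ℕ, m + N = j₀ + n ∧ ∀ z, SameCyl l n y z ↔ SameCyl l m (g y) (g z) := by
    intro n hn y hy
    obtain ⟨a, b, hae, hbe, hya, hyb⟩ := exists_endpoints hl0 hl n y
    have hmem : ∀ z, SameCyl l n y z ↔ a ≤ z ∧ z ≤ b := sameCyl_iff_endpoints hl0 hl hae hbe
    have hD : ∀ z, a ≤ z → z ≤ b → SameCyl l N x z := fun z h1 h2 =>
      hy.trans (((hmem z).2 ⟨h1, h2⟩).mono hl0 hl hn)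
    have hnp := pow_pos hl0 n
    have hab : a ≤ b := by
      change (a : ℝ) ≤ b
      rw [hae, hbe]
      linarith
    obtain ⟨p, q, hpq, hfw⟩ : ∃ p q : centralCantorSet l, (q : ℝ) - p = κ * l ^ n ∧
        ∀ z, a ≤ z ∧ z ≤ b ↔ p ≤ g z ∧ g z ≤ q := by
      have e1 := hj₀ a b (hD a le_rfl hab) (hD b hab le_rfl)
      have e2 : (b : ℝ) - a = l ^ n := by rw [hae, hbe]; ring
      rw [e2] at e1
      have hback := hb a b (hD a le_rfl hab) (hD b hab le_rfl) hab
      have hpos : 0 < κ * l ^ n := by positivity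
      have hm : ∀ z, a ≤ z → z ≤ b → 0 ≤ σ * ((g z : ℝ) - g a) ∧ 0 ≤ σ * ((g b : ℝ) - g z) := by
        intro z h1 h2
        rw [hj₀ a z (hD a le_rfl hab) (hD z h1 h2), hj₀ z b (hD z h1 h2) (hD b hab le_rfl)]
        exact ⟨mul_nonneg hκ0.le (sub_nonneg.2 h1), mul_nonneg hκ0.le (sub_nonneg.2 h2)⟩
      rcases hσ with rfl | rfl
      · refine ⟨g a, g b, by linarith, fun z => ⟨fun h => ?_, fun h => ?_⟩⟩
        · obtain ⟨h1, h2⟩ := hm z h.1 h.2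
          exact ⟨show (g a : ℝ) ≤ g z by linarith, show (g z : ℝ) ≤ g b by linarith⟩
        · have h3 : g a ≤ g b := h.1.trans h.2
          have := hback (g z) (by rw [uIcc_of_le h3]; exact h)
          rwa [Equiv.symm_apply_apply] at this
      · refine ⟨g b, g a, by linarith, fun z => ⟨fun h => ?_, fun h => ?_⟩⟩
        · obtain ⟨h1, h2⟩ := hm z h.1 h.2
          exact ⟨show (g b : ℝ) ≤ g z by linarith, show (g z : ℝ) ≤ g a by linarith⟩
        · have h3 : g b ≤ g a := h.1.trans h.2
          have := hback (g z) (by rw [uIcc_of_ge h3]; exact h)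
          rwa [Equiv.symm_apply_apply] at this
    have hpq' : p < q := by
      have : 0 < κ * l ^ n := by positivity
      change (p : ℝ) < q
      linarith
    obtain ⟨m, hm1, -, hm3, hm4⟩ := exists_split hl0 hl hpq'
    obtain ⟨u, v, hu, hv, -, -, hc⟩ := exists_gap hl0 hl m p
    have hch := child_le hl0 hl (n := m)
    have huv : u < v := by
      change (u : ℝ) < v
      rw [hu, hv, pow_succ']
      linarith
    have hpu : p ≤ u := show (p : ℝ) ≤ u by rw [hu]; exact hm3
    have hvq : v ≤ q := show (v : ℝ) ≤ q by rw [hv]; exact hm4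
    have hu' := (hfw (g.symm u)).2 (by
      rw [Equiv.apply_symm_apply]; exact ⟨hpu, huv.le.trans hvq⟩)
    have hv' := (hfw (g.symm v)).2 (by
      rw [Equiv.apply_symm_apply]; exact ⟨hpu.trans huv.le, hvq⟩)
    have hne : g.symm u ≠ g.symm v := fun h => huv.ne (g.symm.injective h)
    -- A point strictly between the preimages of the sides of the gap would have its image strictly
    -- inside the gap; so the preimages bound a gap, which lies in a cylinder of step `n` and is
    -- therefore of step at least `n`.
    have hbtw : ∀ s t : centralCantorSet l, a ≤ s → t ≤ b → s < t →
        (g s = u ∧ g t = v ∨ g s = v ∧ g t = u) → ∃ i, n ≤ i ∧ (t : ℝ) - s = (1 - 2 * l) * l ^ i := by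
      intro s t has htb hst hor
      have hs : SameCyl l N x s := hD s has (hst.le.trans htb)
      have ht : SameCyl l N x t := hD t (has.trans hst.le) htb
      obtain ⟨i, hi1, hi2, hi3⟩ := gap_length hl0 hl hst fun c => by
        by_contra! hcon
        have hcD : SameCyl l N x c := hD c (has.trans hcon.1.le) (hcon.2.le.trans htb)
        have k1 := hj₀ s c hs hcD
        have k2 := hj₀ c t hcD ht
        have k3 : 0 < κ * ((c : ℝ) - s) := mul_pos hκ0 (sub_pos.2 (show (s : ℝ) < c from hcon.1))
        have k4 : 0 < κ * ((t : ℝ) - c) := mul_pos hκ0 (sub_pos.2 (show (c : ℝ) < t from hcon.2))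
        rw [← k1] at k3
        rw [← k2] at k4
        have huv' : (u : ℝ) < v := huv
        have hor' : (g s : ℝ) = u ∧ (g t : ℝ) = v ∨ (g s : ℝ) = v ∧ (g t : ℝ) = u :=
          hor.imp (fun h => ⟨congrArg _ h.1, congrArg _ h.2⟩)
            fun h => ⟨congrArg _ h.1, congrArg _ h.2⟩
        have hcc : (g c : ℝ) ≤ u ∨ (v : ℝ) ≤ g c := hc (g c)
        rcases hσ with rfl | rfl <;> rcases hor' with ⟨h1, h2⟩ | ⟨h1, h2⟩ <;>
          rcases hcc with h3 | h3 <;> linarith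
      refine ⟨i, ?_, hi1⟩
      by_contra hcon
      have hsn : SameCyl l n s t :=
        ((hmem s).2 ⟨has, hst.le.trans htb⟩).symm.trans ((hmem t).2 ⟨has.trans hst.le, htb⟩)
      exact hi3 (hsn.mono hl0 hl (by omega))
    obtain ⟨i, hni, hi⟩ : ∃ i, n ≤ i ∧ |((g.symm v : centralCantorSet l) : ℝ) - g.symm u| =
        (1 - 2 * l) * l ^ i := by
      rcases lt_or_gt_of_ne hne with h | h
      · obtain ⟨i, hi, hi'⟩ := hbtw _ _ hu'.1 hv'.2 h (Or.inl (by simp))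
        exact ⟨i, hi, by rw [← hi', abs_of_pos (sub_pos.2 (show _ < (_ : ℝ) from h))]⟩
      · obtain ⟨i, hi, hi'⟩ := hbtw _ _ hv'.1 hu'.2 h (Or.inr (by simp))
        exact ⟨i, hi, by
          rw [← hi', abs_sub_comm, abs_of_pos (sub_pos.2 (show _ < (_ : ℝ) from h))]⟩
    have huvκ := habs _ _ (hD _ hu'.1 hu'.2) (hD _ hv'.1 hv'.2)
    rw [Equiv.apply_symm_apply, Equiv.apply_symm_apply, hi,
      abs_of_pos (sub_pos.2 (show (u : ℝ) < v from huv)), hu, hv, pow_succ', hκ] at huvκ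
    have hm : m + N = j₀ + i := by
      refine pow_right_injective₀ hl0 (by linarith : l ≠ 1) ?_
      simp only [pow_add]
      refine mul_left_cancel₀ h2l.ne' ?_
      field_simp at huvκ
      linarith
    have hle : m + N ≤ j₀ + n := by
      have k1 : (q : ℝ) - p ≤ l ^ m := by
        have := hm1.abs_sub_le
        rw [abs_sub_comm] at this
        exact (le_abs_self _).trans this
      rw [hpq, hκ, div_mul_eq_mul_div, div_le_iff₀ hN, ← pow_add, ← pow_add] at k1
      exact (pow_le_pow_iff_right_of_lt_one₀ hl0 (by linarith)).1 k1
    have hmn : m + N = j₀ + n := by omega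
    have hκm : κ * l ^ n = l ^ m := by
      rw [hκ, div_mul_eq_mul_div, div_eq_iff hN.ne', ← pow_add, ← pow_add, hmn]
    have hpe : (p : ℝ) = leftEnd l m p := by
      have k1 := leftEnd_le m p
      have k2 := le_leftEnd_add m q
      rw [← (hm1 : leftEnd l m p = leftEnd l m q)] at k2
      linarith
    have hqe : (q : ℝ) = leftEnd l m p + l ^ m := by linarith
    refine ⟨m, hmn, fun z => ?_⟩
    have hmem' := sameCyl_iff_endpoints hl0 hl hpe hqe
    have hgy : SameCyl l m p (g y) := (hmem' _).2 ((hfw y).1 ((hmem y).1 rfl))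
    rw [hmem, hfw, ← hmem']
    exact ⟨fun h => hgy.symm.trans h, fun h => hgy.trans h⟩
  refine ⟨(j₀ : ℤ) - N, fun n hn => ?_⟩
  obtain ⟨m, hm, -⟩ := hcyl n hn x' hx'
  refine ⟨m, by omega, fun k y => ?_, fun y z hy hz => ?_⟩
  · obtain ⟨m', hm', h⟩ := hcyl (n + k) (by omega) x' hx'
    obtain rfl : m' = m + k := by omega
    exact h y
  · have h1 := habs z y (hx'.trans (hz.mono hl0 hl hn)) (hx'.trans (hy.mono hl0 hl hn))
    have h2 : κ * l ^ n = l ^ m := by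
      rw [hκ, div_mul_eq_mul_div, div_eq_iff hN.ne', ← pow_add, ← pow_add, hm]
    rw [h1, ← h2]
    ring

/-- A strictly differentiable bijection of the Cantor set is locally a similarity. -/
theorem StrictDiff.exists_localSimilar {g : centralCantorSet l ≃ centralCantorSet l}
    (hg : StrictDiff g) (hg' : StrictDiff g.symm) (hc : Continuous g) (hc' : Continuous g.symm) :
    ∃ N : ℕ, ∀ x, LocalSimilar g N x := by
  have : CompactSpace (centralCantorSet l) := isCompact_iff_compactSpace.1 (isCompact_centralCantorSet l)
  have hloc : ∃ N : ℕ, ∀ x ∈ (univ : Set (centralCantorSet l)), LocalSimilar g N x := by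
    refine isCompact_univ.induction_on (p := fun s => ∃ N : ℕ, ∀ x ∈ s, LocalSimilar g N x)
      ⟨0, by simp⟩ (fun s t hst ⟨N, hN⟩ => ⟨N, fun x hx => hN x (hst hx)⟩) ?_ fun x _ => ?_
    · rintro s t ⟨N, hN⟩ ⟨N', hN'⟩
      refine ⟨max N N', ?_⟩
      rintro x (hx | hx)
      · exact (hN x hx).mono (le_max_left _ _)
      · exact (hN' x hx).mono (le_max_right _ _)
    · obtain ⟨ρ, σ, hρ, hσ, h⟩ := hg.exists_pos hl0 hl hg' hc x
      obtain ⟨ρ', σ', hρ', hσ', h'⟩ := hg'.exists_pos hl0 hl (by simpa using hg) hc' (g x)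
      rw [nhds_prod_eq] at h h'
      obtain ⟨t, ht, hts⟩ := Filter.mem_prod_same_iff.1 h
      obtain ⟨t', ht', hts'⟩ := Filter.mem_prod_same_iff.1 h'
      obtain ⟨n₁, hn₁⟩ := exists_cyl_subset hl0 hl ht
      obtain ⟨n₂, hn₂⟩ := exists_cyl_subset hl0 hl ht'
      obtain ⟨n₃, hn₃⟩ := exists_cyl_subset hl0 hl
        (hc.continuousAt.preimage_mem_nhds (cyl_mem_nhds hl0 hl n₂ (g x)))
      have ha : ∀ y z, SameCyl l (max n₁ n₃) x y → SameCyl l (max n₁ n₃) x z → y ≤ z →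
          3 / 4 * ρ * ((z : ℝ) - y) ≤ σ * ((g z : ℝ) - g y) ∧
          σ * ((g z : ℝ) - g y) ≤ 5 / 4 * ρ * ((z : ℝ) - y) := fun y z hy hz hyz =>
        hts (mk_mem_prod (hn₁ y (hy.mono hl0 hl (le_max_left _ _)))
          (hn₁ z (hz.mono hl0 hl (le_max_left _ _)))) hyz
      refine ⟨{y | SameCyl l (max n₁ n₃) x y}, mem_nhdsWithin_of_mem_nhds (cyl_mem_nhds hl0 hl _ x),
        max n₁ n₃, fun x' hx' => localSimilar_of_monotone hl0 hl hρ hσ ha ?_ hx'⟩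
      -- Monotonicity of the inverse near `g x` ensures that no point from outside is mapped between
      -- `g u` and `g v`. Bounds on `g` alone near `x` would not exclude this.
      have hmono : ∀ y z, SameCyl l n₂ (g x) y → SameCyl l n₂ (g x) z → y ≤ z →
          0 ≤ σ' * ((g.symm z : ℝ) - g.symm y) := fun y z hy hz hyz =>
        (mul_nonneg (by positivity) (sub_nonneg.2 (show (y : ℝ) ≤ z from hyz))).trans
          (hts' (mk_mem_prod (hn₂ y hy) (hn₂ z hz)) hyz).1
      have hconv : ∀ y z c : centralCantorSet l, SameCyl l n₂ (g x) y → SameCyl l n₂ (g x) z →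
          y ≤ c → c ≤ z → SameCyl l n₂ (g x) c := by
        intro y z c hy hz h1 h2
        obtain ⟨a, b, ha, hb, -, -⟩ := exists_endpoints hl0 hl n₂ (g x)
        have hi := sameCyl_iff_endpoints hl0 hl ha hb
        exact (hi c).2 ⟨((hi y).1 hy).1.trans h1, h2.trans ((hi z).1 hz).2⟩
      have hbtw : ∀ y z c : centralCantorSet l, SameCyl l n₂ (g x) y → SameCyl l n₂ (g x) z →
          y ≤ c → c ≤ z → (g.symm y ≤ g.symm c ∧ g.symm c ≤ g.symm z) ∨
            (g.symm z ≤ g.symm c ∧ g.symm c ≤ g.symm y) := by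
        intro y z c hy hz h1 h2
        have k1 := hmono y c hy (hconv y z c hy hz h1 h2) h1
        have k2 := hmono c z (hconv y z c hy hz h1 h2) hz h2
        rcases hσ' with rfl | rfl
        · exact Or.inl ⟨show (_ : ℝ) ≤ _ by linarith, show (_ : ℝ) ≤ _ by linarith⟩
        · exact Or.inr ⟨show (_ : ℝ) ≤ _ by linarith, show (_ : ℝ) ≤ _ by linarith⟩
      intro u v hu hv huv c hcuv
      have hu' : SameCyl l n₂ (g x) (g u) := hn₃ u (hu.mono hl0 hl (le_max_right _ _))
      have hv' : SameCyl l n₂ (g x) (g v) := hn₃ v (hv.mono hl0 hl (le_max_right _ _))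
      -- The sign `σ'` of the inverse need not be related to `σ`: either orientation is allowed
      -- here, and `u ≤ v` then leaves the second only when `u = v`.
      have hres : (u ≤ g.symm c ∧ g.symm c ≤ v) ∨ (v ≤ g.symm c ∧ g.symm c ≤ u) := by
        rcases le_total (g u) (g v) with h | h
        · rw [uIcc_of_le h] at hcuv
          simpa using hbtw _ _ c hu' hv' hcuv.1 hcuv.2
        · rw [uIcc_of_ge h] at hcuv
          simpa [or_comm] using hbtw _ _ c hv' hu' hcuv.1 hcuv.2
      rcases hres with h | h
      · exact h
      · have huv' : u = v := le_antisymm huv (h.1.trans h.2)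
        subst huv'
        exact h
  exact hloc.imp fun N hN x => hN x (mem_univ x)

end LocalSimilarity
end CantorTits

namespace CantorTits

open Filter Set MulAction

/-! ### Pigeonhole arguments for integer heights -/

section Heights

/-- Last times at which a sequence of integers with bounded increments is below given thresholds,
together with the pigeonhole principle. -/
theorem exists_rise {α : Type*} [Finite α] (col : ℕ → α) (h : ℕ → ℤ) (h0 : h 0 = 0) {L : ℤ}
    (hL : 0 ≤ L) (hstep : ∀ k, h (k + 1) ≤ h k + L) {n : ℕ} (hn : (Nat.card α : ℤ) * L < h n) :
    ∃ i j, i < j ∧ col i = col j ∧ h i < h j ∧ ∀ k, i ≤ k → k ≤ j → h i ≤ h k := by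
  classical
  have := Fintype.ofFinite α
  rw [Nat.card_eq_fintype_card] at hn
  -- `K t` is the last time up to `n` with height at most `t * L`. There is one more threshold than
  -- colors, so two of these times share a color. As increments are at most `L`, the height at `K t`
  -- lies in `(t * L - L, t * L]`, so a larger threshold gives a strictly larger height, and after
  -- `K t` heights stay above `t * L` up to time `n`.
  let K : Fin (Fintype.card α + 1) → ℕ := fun t => Nat.findGreatest (fun k => h k ≤ t * L) n
  have hK1 : ∀ t, h (K t) ≤ t * L := fun t =>
    Nat.findGreatest_spec (P := fun k => h k ≤ t * L) (Nat.zero_le n) (by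
      rw [h0]; positivity)
  have hK2 : ∀ t k, K t < k → k ≤ n → t * L < h k := fun t k h1 h2 =>
    not_le.1 (Nat.findGreatest_is_greatest h1 h2)
  have hKn : ∀ t, K t < n := fun t => by
    refine lt_of_le_of_ne (Nat.findGreatest_le n) fun h => ?_
    have h1 := hK1 t
    rw [h] at h1
    have h2 : (t : ℤ) * L ≤ Fintype.card α * L :=
      mul_le_mul_of_nonneg_right (by exact_mod_cast Nat.lt_succ_iff.1 t.2) hL
    omega
  have hK3 : ∀ t, t * L - L < h (K t) := fun t => by
    have h1 := hK2 t (K t + 1) (Nat.lt_succ_self _) (hKn t)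
    have h2 := hstep (K t)
    omega
  obtain ⟨t, t', hne, hcol⟩ := Fintype.exists_ne_map_eq_of_card_lt (fun t => col (K t)) (by simp)
  wlog hlt : t < t' generalizing t t'
  · exact this t' t hne.symm hcol.symm (lt_of_le_of_ne (not_lt.1 hlt) hne.symm)
  have hhlt : h (K t) < h (K t') := by
    have h1 := hK1 t
    have h2 := hK3 t'
    have h3 : ((t : ℤ) + 1) * L ≤ t' * L :=
      mul_le_mul_of_nonneg_right (by exact_mod_cast hlt) hL
    rw [add_mul, one_mul] at h3
    omega
  refine ⟨K t, K t', ?_, hcol, hhlt, fun k h1 h2 => ?_⟩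
  · by_contra hcon
    rcases lt_or_eq_of_le (not_lt.1 hcon) with h4 | h4
    · have h5 := hK2 t' _ h4 (hKn t).le
      have h6 := hK1 t
      have h3 : ((t : ℤ) + 1) * L ≤ t' * L :=
        mul_le_mul_of_nonneg_right (by exact_mod_cast hlt) hL
      rw [add_mul, one_mul] at h3
      omega
    · rw [h4] at hhlt
      exact lt_irrefl _ hhlt
  · rcases eq_or_lt_of_le h1 with rfl | h1
    · exact le_rfl
    · exact (hK1 t).trans (hK2 t k h1 (h2.trans (hKn t').le)).le

/-- A path started at such a time never goes below its initial height: these are the times to look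
at for forward returns. -/
theorem exists_tail_min {h : ℕ → ℤ} {B : ℤ} (hB : ∀ k, B ≤ h k) (n : ℕ) :
    ∃ i, n ≤ i ∧ ∀ k, i ≤ k → h i ≤ h k := by
  obtain ⟨b, ⟨i, hi, rfl⟩, hb⟩ := Int.exists_least_of_bdd (P := fun z => ∃ k, n ≤ k ∧ h k = z)
    ⟨B, by rintro _ ⟨k, -, rfl⟩; exact hB k⟩ ⟨_, n, le_rfl, rfl⟩
  exact ⟨i, hi, fun k hk => hb _ ⟨k, hi.trans hk, rfl⟩⟩

/-- Read backwards in time, a path from a new strict minimum stays above its initial height: these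
are the times to look at for returns of the inverse. -/
theorem exists_record {h : ℕ → ℤ} (hB : ∀ B : ℤ, ∃ k, h k < B) (n : ℕ) (C : ℤ) :
    ∃ j, n ≤ j ∧ h j < C ∧ ∀ k, k < j → h j < h k := by
  classical
  obtain ⟨b, hb, hbC⟩ : ∃ b : ℤ, (∀ k ≤ n, b ≤ h k) ∧ b ≤ C := by
    obtain ⟨b, hb⟩ := ((Finset.range (n + 1)).image h).bddBelow
    refine ⟨min b C, fun k hk => (min_le_left _ _).trans (hb ?_), min_le_right _ _⟩
    exact Finset.mem_coe.2 (Finset.mem_image_of_mem _ (Finset.mem_range.2 (by omega)))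
  have hex := hB b
  refine ⟨Nat.find hex, ?_, (Nat.find_spec hex).trans_le hbC, fun k hk => ?_⟩
  · by_contra hcon
    exact absurd (Nat.find_spec hex) (not_lt.2 (hb _ (by omega)))
  · exact (Nat.find_spec hex).trans_le (not_lt.1 (Nat.find_min hex hk))

end Heights

/-! ### Composition, restriction and inversion of similarities between cylinders -/

section Cylinders

variable {l : ℝ} (hl0 : 0 < l) (hl : l < 1 / 2)

theorem MapsCyl.mem {g : centralCantorSet l → centralCantorSet l} {x y : centralCantorSet l}
    {n m : ℕ} (h : MapsCyl g x n m) (hy : SameCyl l n x y) : SameCyl l m (g x) (g y) :=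
  (h.1 0 y).1 hy

theorem MapsCyl.id (x : centralCantorSet l) (n : ℕ) : MapsCyl (fun y => y) x n n :=
  ⟨fun _ _ => Iff.rfl, fun _ _ _ _ => mul_comm _ _⟩

include hl0

theorem MapsCyl.comp {g h : centralCantorSet l → centralCantorSet l} {x : centralCantorSet l}
    {n m p : ℕ} (hg : MapsCyl g x n m) (hh : MapsCyl h (g x) m p) :
    MapsCyl (fun y => h (g y)) x n p := by
  refine ⟨fun k y => (hg.1 k y).trans (hh.1 k (g y)), fun y z hy hz => ?_⟩
  have h1 := hg.2 y z hy hz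
  have h2 := hh.2 (g y) (g z) (hg.mem hy) (hg.mem hz)
  refine mul_left_cancel₀ (pow_pos hl0 m).ne' ?_
  linear_combination l ^ n * h2 + l ^ p * h1

include hl

theorem MapsCyl.shift {g : centralCantorSet l → centralCantorSet l} {x : centralCantorSet l}
    {n m : ℕ} (hg : MapsCyl g x n m) (j : ℕ) : MapsCyl g x (n + j) (m + j) := by
  refine ⟨fun k y => ?_, fun y z hy hz => ?_⟩
  · rw [add_assoc, add_assoc]
    exact hg.1 (j + k) y
  · have h1 := hg.2 y z (hy.mono hl0 hl (Nat.le_add_right _ _))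
      (hz.mono hl0 hl (Nat.le_add_right _ _))
    rw [pow_add, pow_add]
    linear_combination l ^ j * h1

theorem MapsCyl.eq {g : centralCantorSet l → centralCantorSet l}
    {x : centralCantorSet l} {n m m' : ℕ} (h : MapsCyl g x n m) (h' : MapsCyl g x n m') :
    m = m' := by
  obtain ⟨y, hy, hyx⟩ := exists_sameCyl_ne hl0 hl n x
  have h1 := h.2 y x hy rfl
  have h2 := h'.2 y x hy rfl
  have h3 : 0 < |(y : ℝ) - x| := abs_pos.2 (sub_ne_zero.2 fun h => hyx (Subtype.ext h))
  exact pow_right_injective₀ hl0 (by linarith : l ≠ 1)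
    (mul_right_cancel₀ h3.ne' (h1.symm.trans h2))

theorem MapsCyl.sub_eq {g : centralCantorSet l → centralCantorSet l}
    {x : centralCantorSet l} {n m n' m' : ℕ} (h : MapsCyl g x n m) (h' : MapsCyl g x n' m') :
    (m : ℤ) - n = m' - n' := by
  have h1 := h.shift hl0 hl n'
  have h2 := h'.shift hl0 hl n
  rw [add_comm n' n] at h2
  have := MapsCyl.eq hl0 hl h1 h2
  omega

omit hl0 hl in
theorem MapsCyl.inv {G : Type*} [Group G] [MulAction G (centralCantorSet l)] {g : G}
    {x : centralCantorSet l} {n m : ℕ} (h : MapsCyl (g • ·) x n m) :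
    MapsCyl (g⁻¹ • ·) (g • x) m n := by
  have key : ∀ k y, SameCyl l (m + k) (g • x) y ↔ SameCyl l (n + k) x (g⁻¹ • y) := by
    intro k y
    have := h.1 k (g⁻¹ • y)
    simpa using this.symm
  refine ⟨fun k y => by simpa using key k y, fun y z hy hz => ?_⟩
  have := h.2 (g⁻¹ • y) (g⁻¹ • z) ((key 0 y).1 hy) ((key 0 z).1 hz)
  simp only [smul_inv_smul] at this
  linarith

end Cylinders

/-! ### The integer cocycle of similarity exponents -/

section Cocycle

variable {l : ℝ} (hl0 : 0 < l) (hl : l < 1 / 2) {G : Type*} [Group G]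
  [MulAction G (centralCantorSet l)]

/-- The group acts by homeomorphisms that are locally similarities. -/
def ActsByLocalSimilarities (l : ℝ) (G : Type*) [Group G] [MulAction G (centralCantorSet l)] :
    Prop :=
  ∀ g : G, ∃ N : ℕ, ∀ x : centralCantorSet l, LocalSimilar (g • ·) N x

variable (hG : ActsByLocalSimilarities l G)
include hl0 hl hG

/-- Near `x` the element `g` is a similarity of ratio `l ^ c g x`, and the last clause is the chain
rule. Positive values mean contraction. The first clause holds from a step uniform in the point, the
second for any cylinder that is mapped to a cylinder. -/
theorem exists_cocycle : ∃ c : G → centralCantorSet l → ℤ,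
    (∀ g, ∃ N : ℕ, ∀ x n, N ≤ n → ∃ m : ℕ, (m : ℤ) = n + c g x ∧ MapsCyl (g • ·) x n m) ∧
    (∀ g x n m, MapsCyl (g • ·) x n m → (m : ℤ) = n + c g x) ∧
    ∀ g h x, c (h * g) x = c h (g • x) + c g x := by
  choose N c hc using hG
  have huniq : ∀ g x n m, MapsCyl (g • ·) x n m → (m : ℤ) = n + c g x := by
    intro g x n m h
    obtain ⟨m', hm', h'⟩ := hc g x (N g) le_rfl
    have := MapsCyl.sub_eq hl0 hl h h'
    omega
  refine ⟨c, fun g => ⟨N g, fun x => hc g x⟩, huniq, fun g h x => ?_⟩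
  have hn : (N g : ℤ) ≤ N g + (N h + (c g x).natAbs : ℕ) := by omega
  -- The step is taken so deep that its image under `g` still has step at least `N h`.
  obtain ⟨m, hm, hgm⟩ := hc g x (N g + (N h + (c g x).natAbs)) (by omega)
  obtain ⟨p, hp, hhp⟩ := hc h (g • x) m (by omega)
  have h1 := hgm.comp hl0 hhp
  simp only [← mul_smul] at h1
  have := huniq (h * g) x _ p h1
  omega

omit hl0 hl hG in
/-- The partial products of a sequence of group elements. -/
def wordProd (s : ℕ → G) : ℕ → G
  | 0 => 1
  | k + 1 => s k * wordProd s k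

omit hl0 hl hG [MulAction G (centralCantorSet l)] in
-- Words are prefixes of infinite sequences, padded by `1`, so that heights along a word form a
-- sequence on `ℕ`; a letter is appended by updating the sequence at position `n`.
theorem exists_wordProd {S : Set G} {g : G} (hg : g ∈ Subgroup.closure S) :
    ∃ s : ℕ → G, (∀ k, s k = 1 ∨ s k ∈ S ∨ (s k)⁻¹ ∈ S) ∧ ∃ n, wordProd s n = g := by
  have hupd : ∀ (s : ℕ → G) (n : ℕ) (x : G), wordProd (Function.update s n x) (n + 1) =
      x * wordProd s n := by
    intro s n x
    have h1 : ∀ k, k ≤ n → wordProd (Function.update s n x) k = wordProd s k := by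
      intro k hk
      induction k with
      | zero => rfl
      | succ k ih =>
        rw [wordProd, wordProd, ih (by omega), Function.update_of_ne (by omega)]
    rw [wordProd, h1 n le_rfl, Function.update_self]
  have hupd' : ∀ (s : ℕ → G) (n : ℕ) (x : G), (∀ k, s k = 1 ∨ s k ∈ S ∨ (s k)⁻¹ ∈ S) →
      (x = 1 ∨ x ∈ S ∨ x⁻¹ ∈ S) → ∀ k, Function.update s n x k = 1 ∨ Function.update s n x k ∈ S ∨
        (Function.update s n x k)⁻¹ ∈ S := by
    intro s n x hs hx k
    by_cases h : k = n
    · subst h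
      rwa [Function.update_self]
    · rw [Function.update_of_ne h]
      exact hs k
  induction hg using Subgroup.closure_induction_left with
  | one => exact ⟨fun _ => 1, fun _ => Or.inl rfl, 0, rfl⟩
  | mul_left x hx y _ ih =>
    obtain ⟨s, hs, n, rfl⟩ := ih
    exact ⟨_, hupd' s n x hs (Or.inr (Or.inl hx)), n + 1, hupd s n x⟩
  | inv_mul_cancel x hx y _ ih =>
    obtain ⟨s, hs, n, rfl⟩ := ih
    exact ⟨_, hupd' s n x⁻¹ hs (Or.inr (Or.inr (by rwa [inv_inv]))), n + 1, hupd s n x⁻¹⟩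

omit hl hG in
/-- Along a path that stays above the level of validity of its steps, intervals are mapped to
intervals by similarities. -/
theorem mapsCyl_wordProd {c : G → centralCantorSet l → ℤ}
    (hcoc : ∀ g h x, c (h * g) x = c h (g • x) + c g x) {s : ℕ → G} {N : ℕ}
    (hs : ∀ k x n, N ≤ n → ∃ m : ℕ, (m : ℤ) = n + c (s k) x ∧ MapsCyl (s k • ·) x n m)
    (x : centralCantorSet l) {i j : ℕ} (hij : i ≤ j) (n : ℕ)
    (hn : ∀ k, i ≤ k → k ≤ j → (N : ℤ) ≤ n + c (wordProd s k) x - c (wordProd s i) x) :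
    ∃ m : ℕ, (m : ℤ) = n + c (wordProd s j) x - c (wordProd s i) x ∧
      MapsCyl ((wordProd s j * (wordProd s i)⁻¹) • ·) (wordProd s i • x) n m := by
  induction j, hij using Nat.le_induction with
  | base =>
    refine ⟨n, by ring, ?_⟩
    simp only [mul_inv_cancel, one_smul]
    exact MapsCyl.id _ _
  | succ j hij ih =>
    obtain ⟨m, hm, h⟩ := ih fun k h1 h2 => hn k h1 (h2.trans (Nat.le_succ j))
    have h1 := hn j hij (Nat.le_succ j)
    obtain ⟨p, hp, hh⟩ := hs j (wordProd s j • x) m (by omega)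
    refine ⟨p, ?_, ?_⟩
    · rw [wordProd, hcoc]
      omega
    · have h2 : (wordProd s j * (wordProd s i)⁻¹) • wordProd s i • x = wordProd s j • x := by
        rw [mul_smul, inv_smul_smul]
      have h3 := h.comp hl0 (h := (s j • ·)) (p := p) (by rw [h2]; exact hh)
      simp only [← mul_smul] at h3 ⊢
      rw [wordProd, mul_assoc]
      simpa only [mul_smul] using h3

end Cocycle

end CantorTits

namespace CantorTits

open Filter Set MulAction Pointwise

/-! ### Contracting and isometric returns to a cylinder -/

section Dynamics

variable {l : ℝ} (hl0 : 0 < l) (hl : l < 1 / 2) {G : Type*} [Group G]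
  [MulAction G (centralCantorSet l)]
include hl0 hl

theorem isComplete_cyl (n : ℕ) (x : centralCantorSet l) : IsComplete {y | SameCyl l n x y} := by
  have : CompactSpace (centralCantorSet l) :=
    isCompact_iff_compactSpace.1 (isCompact_centralCantorSet l)
  refine (IsClosed.isCompact ?_).isComplete
  rw [← isOpen_compl_iff, isOpen_iff_mem_nhds]
  intro y hy
  exact mem_of_superset (cyl_mem_nhds hl0 hl n y) fun z hz hz' => hy (hz'.trans (SameCyl.symm hz))

omit hl in
/-- A self-similarity of an interval of step `N` with ratio `l ^ (m - N)` scales distances under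
iteration. -/
theorem MapsCyl.abs_pow_sub {φ : G} {x : centralCantorSet l} {N m : ℕ} (h : MapsCyl (φ • ·) x N m)
    (hl : l < 1 / 2) (hNm : N ≤ m) (hx : SameCyl l N x (φ • x)) (k : ℕ) {y z : centralCantorSet l}
    (hy : SameCyl l N x y) (hz : SameCyl l N x z) : SameCyl l N x (φ ^ k • y) ∧
      |((φ ^ k • y : centralCantorSet l) : ℝ) - (φ ^ k • z : centralCantorSet l)| =
        (l ^ (m - N)) ^ k * |(y : ℝ) - z| := by
  have hmaps : ∀ y, SameCyl l N x y → SameCyl l N x (φ • y) := fun y hy =>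
    hx.trans ((h.mem hy).mono hl0 hl hNm)
  have hdist : ∀ y z, SameCyl l N x y → SameCyl l N x z →
      |((φ • y : centralCantorSet l) : ℝ) - (φ • z : centralCantorSet l)| =
        l ^ (m - N) * |(y : ℝ) - z| := by
    intro y z hy hz
    have h1 := h.2 y z hy hz
    refine mul_right_cancel₀ (pow_pos hl0 N).ne' ?_
    rw [h1, mul_right_comm, ← pow_add, Nat.sub_add_cancel hNm]
  have hin : ∀ k y, SameCyl l N x y → SameCyl l N x (φ ^ k • y) := by
    intro k
    induction k with
    | zero => intro y hy; simpa using hy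
    | succ k ih => intro y hy; rw [pow_succ', mul_smul]; exact hmaps _ (ih y hy)
  refine ⟨hin k y hy, ?_⟩
  induction k with
  | zero => simp
  | succ k ih =>
    rw [pow_succ', mul_smul, mul_smul, hdist _ _ (hin k y hy) (hin k z hz), ih, pow_succ']
    ring

/-- The cylinder is complete and mapped into itself with ratio `l ^ (m - N) < 1`, so Banach's fixed
point theorem applies; exact scaling makes the convergence uniform on the cylinder. -/
theorem MapsCyl.exists_attractor {φ : G} {x : centralCantorSet l} {N m : ℕ}
    (h : MapsCyl (φ • ·) x N m) (hNm : N < m) (hx : SameCyl l N x (φ • x)) :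
    ∃ r, SameCyl l N x r ∧ φ • r = r ∧ ConvergesOn φ {y | SameCyl l N x y} r := by
  have hq0 : 0 ≤ l ^ (m - N) := by positivity
  have hq1 : l ^ (m - N) < 1 := pow_lt_one₀ hl0.le (by linarith) (by omega)
  have hmaps : MapsTo (φ • · : centralCantorSet l → centralCantorSet l)
      {y | SameCyl l N x y} {y | SameCyl l N x y} := fun y hy => by
    simpa using (h.abs_pow_sub hl0 hl hNm.le hx 1 hy hy).1
  obtain ⟨r, hr, hfix, -⟩ := ContractingWith.exists_fixedPoint' (isComplete_cyl hl0 hl N x) hmaps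
    (K := ⟨l ^ (m - N), hq0⟩) ⟨by exact_mod_cast hq1, LipschitzWith.of_dist_le_mul
      fun y z => by
        have h1 := (h.abs_pow_sub hl0 hl hNm.le hx 1 y.2 z.2).2
        rw [pow_one, pow_one] at h1
        rw [Subtype.dist_eq, Subtype.dist_eq, Subtype.dist_eq, Subtype.dist_eq, Real.dist_eq,
          Real.dist_eq]
        exact h1.le⟩ (x := x) rfl (edist_ne_top _ _)
  have hrx : φ • r = r := hfix
  refine ⟨r, hr, hrx, fun U hU => ?_⟩
  obtain ⟨ε, hε, hεU⟩ := Metric.mem_nhds_iff.1 hU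
  have hlim := tendsto_pow_atTop_nhds_zero_of_lt_one hq0 hq1
  filter_upwards [hlim.eventually (gt_mem_nhds hε)] with k hk y hy
  refine hεU ?_
  have h1 := (h.abs_pow_sub hl0 hl hNm.le hx k hy hr).2
  rw [pow_smul_eq_self hrx] at h1
  rw [Metric.mem_ball, Subtype.dist_eq, Real.dist_eq, h1]
  have h2 : |(y : ℝ) - r| ≤ 1 := ((SameCyl.symm hy).trans hr).abs_sub_le.trans
    (pow_le_one₀ hl0.le (by linarith))
  calc (l ^ (m - N)) ^ k * |(y : ℝ) - r| ≤ (l ^ (m - N)) ^ k * 1 :=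
        mul_le_mul_of_nonneg_left h2 (by positivity)
    _ < ε := by rwa [mul_one]

theorem eq_endpoint {n : ℕ} {x a b e f : centralCantorSet l} (ha : (a : ℝ) = leftEnd l n x)
    (hb : (b : ℝ) = leftEnd l n x + l ^ n) (he : SameCyl l n x e) (hf : SameCyl l n x f)
    (hef : |(e : ℝ) - f| = l ^ n) : e = a ∧ f = b ∨ e = b ∧ f = a := by
  obtain ⟨e1, e2⟩ := (sameCyl_iff_endpoints hl0 hl ha hb e).1 he
  obtain ⟨f1, f2⟩ := (sameCyl_iff_endpoints hl0 hl ha hb f).1 hf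
  replace e1 : (a : ℝ) ≤ e := e1
  replace e2 : (e : ℝ) ≤ b := e2
  replace f1 : (a : ℝ) ≤ f := f1
  replace f2 : (f : ℝ) ≤ b := f2
  rcases abs_cases ((e : ℝ) - f) with ⟨h1, -⟩ | ⟨h1, -⟩
  · right
    constructor <;> apply Subtype.ext <;> linarith
  · left
    constructor <;> apply Subtype.ext <;> linarith

/-- An isometry of a central Cantor set is an involution. -/
theorem MapsCyl.sq_smul {φ : G} {x : centralCantorSet l} {N : ℕ} (h : MapsCyl (φ • ·) x N N)
    (hx : SameCyl l N x (φ • x)) {y : centralCantorSet l} (hy : SameCyl l N x y) :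
    φ ^ 2 • y = y := by
  obtain ⟨a, b, ha, hb, hxa, hxb⟩ := exists_endpoints hl0 hl N x
  have hin : ∀ z, SameCyl l N x z → SameCyl l N x (φ • z) := fun z hz => by
    simpa using (h.abs_pow_sub hl0 hl le_rfl hx 1 hz hz).1
  have hd : ∀ z t : centralCantorSet l, SameCyl l N x z → SameCyl l N x t →
      |((φ • z : centralCantorSet l) : ℝ) - (φ • t : centralCantorSet l)| = |(z : ℝ) - t| :=
    fun z t hz ht => by simpa using (h.abs_pow_sub hl0 hl le_rfl hx 1 hz ht).2
  have hge : ∀ z, SameCyl l N x z → (a : ℝ) ≤ z ∧ (z : ℝ) ≤ b := fun z hz =>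
    (sameCyl_iff_endpoints hl0 hl ha hb z).1 hz
  have hab : |((φ • a : centralCantorSet l) : ℝ) - (φ • b : centralCantorSet l)| = l ^ N := by
    rw [hd a b hxa hxb, ha, hb, abs_sub_comm, add_sub_cancel_left, abs_of_pos (pow_pos hl0 N)]
  have h1 := hge _ (hin y hy)
  have h2 := hge y hy
  have h3 := hge _ (hin _ (hin y hy))
  have h4 := hd y a hy hxa
  have h5 := hd (φ • y) a (hin y hy) hxa
  rw [pow_two, mul_smul]
  apply Subtype.ext
  -- The end points form the only pair at distance `l ^ N`, so an isometry fixes or exchanges them;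
  -- distances to `a` then identify it as the identity or the reflection.
  rcases eq_endpoint hl0 hl ha hb (hin a hxa) (hin b hxb) hab with ⟨h6, -⟩ | ⟨h6, -⟩
  · rw [h6, abs_of_nonneg (sub_nonneg.2 h1.1), abs_of_nonneg (sub_nonneg.2 h2.1)] at h4
    rw [h6, abs_of_nonneg (sub_nonneg.2 h3.1), abs_of_nonneg (sub_nonneg.2 h1.1)] at h5
    linarith
  · rw [h6, abs_of_nonpos (sub_nonpos.2 h1.2), abs_of_nonneg (sub_nonneg.2 h2.1)] at h4
    rw [h6, abs_of_nonpos (sub_nonpos.2 h3.2), abs_of_nonneg (sub_nonneg.2 h1.1)] at h5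
    linarith

end Dynamics

/-! ### Transport of dynamical types by commuting elements -/

section Transport

variable {G X : Type*} [Group G] [TopologicalSpace X] [MulAction G X] [ContinuousConstSMul G X]

/-- This and the next lemmas are applied with `h` a power of `g`, to pull a conclusion on a later
point of the orbit of `x` back to `x`. -/
theorem LocallyPeriodic.of_smul {g h : G} (hgh : Commute g h) {x : X}
    (hx : LocallyPeriodic g (h • x)) : LocallyPeriodic g x := by
  obtain ⟨k, hk, hx⟩ := hx
  refine ⟨k, hk, ?_⟩
  filter_upwards [(continuous_const_smul h).continuousAt.eventually hx] with y hy
  rwa [← mul_smul, (hgh.pow_left k).eq, mul_smul, smul_left_cancel_iff] at hy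

theorem Attracts.of_smul {T h : G} (hTh : Commute T h) {x : X} (hx : Attracts T (h • x)) :
    Attracts T x := by
  obtain ⟨W, hW, hc⟩ := hx
  refine ⟨(h • ·) ⁻¹' W, (continuous_const_smul h).continuousAt.preimage_mem_nhds hW,
    fun U hU => ?_⟩
  have hU' : (h⁻¹ • ·) ⁻¹' U ∈ 𝓝 (h • x) :=
    (continuous_const_smul h⁻¹).continuousAt.preimage_mem_nhds (by simpa using hU)
  filter_upwards [hc _ hU'] with n hn y hy
  have := hn _ hy
  rwa [mem_preimage, ← mul_smul, ← mul_smul, mul_assoc, (hTh.pow_left n).eq, inv_mul_cancel_left] at this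

theorem InBasin.of_smul {g h : G} (hgh : Commute g h) {x : X} (hx : InBasin g (h • x)) :
    InBasin g x := by
  obtain ⟨k, hk, α, hα, hx⟩ := hx
  refine ⟨k, hk, h⁻¹ • α, Attracts.of_smul (hgh.pow_left k) (by simpa using hα), ?_⟩
  refine (hx.const_smul h⁻¹).congr fun n => ?_
  rw [← mul_smul, ← mul_smul, mul_assoc, ((hgh.pow_left k).pow_left n).eq, inv_mul_cancel_left]

theorem PeriodicAttractor.of_smul {g h : G} (hgh : Commute g h) {x : X}
    (hx : PeriodicAttractor g (h • x)) : PeriodicAttractor g x := by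
  obtain ⟨k, hk, hx⟩ := hx
  exact ⟨k, hk, hx.of_smul (hgh.pow_left k)⟩

end Transport

/-! ### The trichotomy for one element, and contracting elements in groups -/

section Dynamics

variable {l : ℝ} (hl0 : 0 < l) (hl : l < 1 / 2) {G : Type*} [Group G]
  [MulAction G (centralCantorSet l)] [ContinuousConstSMul G (centralCantorSet l)]

instance (l : ℝ) (N : ℕ) : Finite {a | ∃ x ∈ centralCantorSet l, leftEnd l N x = a} :=
  (finite_range_leftEnd l N).to_subtype

omit [ContinuousConstSMul G (centralCantorSet l)] in
theorem wordProd_const (g : G) (k : ℕ) : wordProd (fun _ => g) k = g ^ k := by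
  induction k with
  | zero => simp [wordProd]
  | succ k ih => rw [wordProd, ih, pow_succ']

include hl0 hl

/-- The cases depend on the heights `c (g ^ k) x`. If they are bounded below, two tail minima in the
same cylinder of step `N` give a forward return that is isometric or contracting. If not, two
records in the same cylinder give a contracting return of `g⁻¹`, and arbitrarily strong contractions
force the orbit onto its fixed point. -/
theorem ActsByLocalSimilarities.trichotomy (hG : ActsByLocalSimilarities l G) (g : G) :
    Trichotomy (centralCantorSet l) g := by
  intro x
  obtain ⟨c, hc, -, hcoc⟩ := exists_cocycle hl0 hl hG
  obtain ⟨N, hN⟩ := hc g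
  let α := {a | ∃ x ∈ centralCantorSet l, leftEnd l N x = a}
  let col : ℕ → α := fun k => ⟨leftEnd l N (g ^ k • x : centralCantorSet l), _, (g ^ k • x).2, rfl⟩
  have hcol : ∀ i j, col i = col j → SameCyl l N (g ^ i • x) (g ^ j • x) := fun i j h =>
    congrArg Subtype.val h
  have hpath := fun (i j : ℕ) (hij : i ≤ j) (n : ℕ) =>
    mapsCyl_wordProd hl0 hcoc (s := fun _ => g) (N := N) (fun _ => hN) x hij n
  simp only [wordProd_const] at hpath
  have hpow : ∀ {i j : ℕ}, i ≤ j → g ^ j * (g ^ i)⁻¹ = g ^ (j - i) := fun {i j} hij => by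
    rw [mul_inv_eq_iff_eq_mul, ← pow_add, Nat.sub_add_cancel hij]
  have hcomm : ∀ k, Commute g (g ^ k) := fun k => Commute.self_pow g k
  by_cases hbdd : ∃ B : ℤ, ∀ k, B ≤ c (g ^ k) x
  · obtain ⟨B, hB⟩ := hbdd
    choose t ht ht' using exists_tail_min hB
    -- A strictly increasing sequence of tail minima: each is chosen after the previous one.
    let τ : ℕ → ℕ := fun k => Nat.rec (t 0) (fun _ p => t (p + 1)) k
    have hτ : ∀ k, ∀ j, τ k ≤ j → c (g ^ τ k) x ≤ c (g ^ j) x := by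
      intro k
      cases k with
      | zero => exact ht' 0
      | succ k => exact ht' _
    have hτm : StrictMono τ := strictMono_nat_of_lt_succ fun k => ht (τ k + 1)
    obtain ⟨a, b, hab, hcab⟩ := Finite.exists_ne_map_eq_of_infinite fun k => col (τ k)
    wlog hlt : a < b generalizing a b
    · exact this b a hab.symm hcab.symm (lt_of_le_of_ne (not_lt.1 hlt) hab.symm)
    have hij := hτm hlt
    obtain ⟨m, hm, hmaps⟩ := hpath (τ a) (τ b) hij.le N fun k h1 _ => by
      have := hτ a k h1
      omega
    have hge := hτ a (τ b) hij.le
    have hsame : SameCyl l N (g ^ τ a • x) ((g ^ τ b * (g ^ τ a)⁻¹) • g ^ τ a • x) := by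
      rw [mul_smul, inv_smul_smul]
      exact hcol _ _ hcab
    rw [hpow hij.le] at hmaps hsame
    -- For `m = N` the return is an isometry of the cylinder, hence an involution, which explains
    -- the factor 2 in the period.
    rcases eq_or_lt_of_le (show N ≤ m by omega) with heq | hlt'
    · subst heq
      left
      refine LocallyPeriodic.of_smul (hcomm (τ a)) ⟨(τ b - τ a) * 2, by omega, ?_⟩
      filter_upwards [cyl_mem_nhds hl0 hl N (g ^ τ a • x)] with y hy
      rw [pow_mul]
      exact hmaps.sq_smul hl0 hl hsame hy
    · right; left
      obtain ⟨r, hr, -, hconv⟩ := hmaps.exists_attractor hl0 hl hlt' hsame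
      refine InBasin.of_smul (hcomm (τ a)) ⟨τ b - τ a, by omega, r, ⟨_, ?_, hconv⟩,
        hconv.tendsto rfl⟩
      exact mem_of_superset (cyl_mem_nhds hl0 hl N r) fun y hy => hr.trans hy
  · right; right
    push Not at hbdd
    have hrec := exists_record hbdd
    -- Record times with heights below `-k`: the contraction factors of the returns of `g⁻¹` to a
    -- fixed earlier record are then not bounded away from zero.
    choose ρ hρ1 hρ2 hρ3 using fun k : ℕ => hrec k (-k)
    obtain ⟨a, ha⟩ := Finite.exists_infinite_fiber fun k => col (ρ k)
    have hinf : ((fun k => col (ρ k)) ⁻¹' {a}).Infinite := Set.infinite_coe_iff.1 ha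
    obtain ⟨k₁, hk₁⟩ := hinf.nonempty
    set i := ρ k₁ with hi
    have hback : ∀ k, col (ρ k) = a → i < ρ k → ∃ m : ℕ, N < m ∧
        (m : ℤ) = N + c (g ^ i) x - c (g ^ ρ k) x ∧
        MapsCyl ((g⁻¹ ^ (ρ k - i)) • ·) (g ^ ρ k • x) N m ∧
        SameCyl l N (g ^ ρ k • x) (g⁻¹ ^ (ρ k - i) • g ^ ρ k • x) ∧
        g⁻¹ ^ (ρ k - i) • g ^ ρ k • x = g ^ i • x := by
      intro k hk hik
      have h1 := hρ3 k i hik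
      obtain ⟨n, hn⟩ : ∃ n : ℕ, (n : ℤ) = N + c (g ^ i) x - c (g ^ ρ k) x :=
        ⟨(N + c (g ^ i) x - c (g ^ ρ k) x).toNat, Int.toNat_of_nonneg (by omega)⟩
      obtain ⟨m, hm, hmaps⟩ := hpath i (ρ k) hik.le n fun j h2 h3 => by
        rcases eq_or_lt_of_le h3 with h4 | h4
        · rw [h4]; omega
        · have := hρ3 k j h4
          omega
      obtain rfl : m = N := by omega
      rw [hpow hik.le] at hmaps
      have h5 : g ^ (ρ k - i) • g ^ i • x = g ^ ρ k • x := by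
        rw [← mul_smul, ← pow_add, Nat.sub_add_cancel hik.le]
      have h6 : g⁻¹ ^ (ρ k - i) • g ^ ρ k • x = g ^ i • x := by
        rw [inv_pow, inv_smul_eq_iff, h5]
      have h7 := hmaps.inv
      rw [h5, ← inv_pow] at h7
      refine ⟨n, by omega, hn, h7, ?_, h6⟩
      rw [h6]
      exact hcol _ _ (hk.trans hk₁.symm)
    obtain ⟨k₀, hk₀, hk₀'⟩ := hinf.exists_gt i
    obtain ⟨m₀, hm₀, -, hmaps₀, hsame₀, -⟩ := hback k₀ hk₀ (hk₀'.trans_le (hρ1 k₀))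
    obtain ⟨r, hr, hfix, hconv⟩ := hmaps₀.exists_attractor hl0 hl hm₀ hsame₀
    have hpos₀ : 0 < ρ k₀ - i := by have := hρ1 k₀; omega
    have hatt : PeriodicAttractor g⁻¹ r := by
      refine ⟨ρ k₀ - i, hpos₀, _, ?_, hconv⟩
      exact mem_of_superset (cyl_mem_nhds hl0 hl N r) fun y hy => hr.trans hy
    -- The returns from all records `ρ k` in the given cylinder have the same fixed point `r`, since
    -- their fixed points are periodic and attracted to `r`. Each return sends `g ^ ρ k • x` to `g ^
    -- i • x`, so the latter is within `l ^ (m - N)` of `r`, with `m - N` as large as desired.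
    have hir : g ^ i • x = r := by
      have hle : ∀ K : ℕ, |((g ^ i • x : centralCantorSet l) : ℝ) - r| ≤ l ^ K := by
        intro K
        obtain ⟨k, hk, hkK⟩ := hinf.exists_gt (max i (K + (c (g ^ i) x).natAbs))
        have hik : i < ρ k := (lt_of_le_of_lt (le_max_left _ _) hkK).trans_le (hρ1 k)
        obtain ⟨m, hm, hm', hmaps, hsame, himg⟩ := hback k hk hik
        have hKm : K ≤ m - N := by
          have h1 := hρ2 k
          have h2 := lt_of_le_of_lt (le_max_right _ _) hkK
          omega
        obtain ⟨r', hr', hfix', -⟩ := hmaps.exists_attractor hl0 hl hm hsame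
        have hcyl : SameCyl l N (g ^ ρ k₀ • x) (g ^ ρ k • x) :=
          hcol _ _ (hk₀.trans hk.symm)
        have hrr : r' = r := by
          refine eq_of_tendsto_of_periodic (hconv.tendsto (hcyl.trans hr')) (j := ρ k - i)
            (by omega) ?_
          rw [← pow_mul, mul_comm, pow_mul, pow_smul_eq_self hfix']
        subst hrr
        have h1 := (hmaps.abs_pow_sub hl0 hl hm.le hsame 1 (SameCyl.refl _) hr').2
        rw [pow_one, pow_one, hfix', himg] at h1
        rw [h1]
        have h2 : |((g ^ ρ k • x : centralCantorSet l) : ℝ) - r'| ≤ 1 :=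
          hr'.abs_sub_le.trans (pow_le_one₀ hl0.le (by linarith))
        calc _ ≤ l ^ (m - N) * 1 := mul_le_mul_of_nonneg_left h2 (by positivity)
          _ ≤ l ^ K := by
            rw [mul_one]
            exact pow_le_pow_of_le_one hl0.le (by linarith) hKm
      have h0 : |((g ^ i • x : centralCantorSet l) : ℝ) - r| ≤ 0 :=
        ge_of_tendsto' (tendsto_pow_atTop_nhds_zero_of_lt_one hl0.le (by linarith : l < 1)) hle
      exact Subtype.ext (sub_eq_zero.1 (abs_eq_zero.1 (le_antisymm h0 (abs_nonneg _))))
    rw [← hir] at hatt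
    exact hatt.of_smul (h := g ^ i) ((Commute.refl g).inv_left.pow_right i)

omit [ContinuousConstSMul G (centralCantorSet l)] in
/-- If all group elements map a fixed interval around `x` to intervals of bounded step, the orbit
of `x` is finite. -/
theorem finite_orbit_of_bounded {x : centralCantorSet l} {n M : ℕ}
    (h : ∀ g : G, ∃ m ≤ M, MapsCyl (g • ·) x n m) : (orbit G x).Finite := by
  obtain ⟨a, b, ha, hb, hxa, hxb⟩ := exists_endpoints hl0 hl n x
  -- The left end of the cylinder of `g • x` comes from an end `a` or `b` of the cylinder of `x`.
  -- Thus `g • x` is determined by its step `m`, that left end and the choice of `a` or `b`: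
  -- finitely many possibilities.
  have hfin : (⋃ m ∈ Finset.range (M + 1),
      ((fun p : ℝ => p + l ^ m / l ^ n * |(x : ℝ) - a|) ''
        {p | ∃ x ∈ centralCantorSet l, leftEnd l m x = p} ∪
      (fun p : ℝ => p + l ^ m / l ^ n * |(x : ℝ) - b|) ''
        {p | ∃ x ∈ centralCantorSet l, leftEnd l m x = p})).Finite :=
    (Finset.range (M + 1)).finite_toSet.biUnion fun m _ =>
      ((finite_range_leftEnd l m).image _).union ((finite_range_leftEnd l m).image _)
  refine Set.Finite.of_finite_image (f := Subtype.val) (hfin.subset ?_) Subtype.val_injective.injOn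
  rintro _ ⟨_, ⟨g, rfl⟩, rfl⟩
  obtain ⟨m, hm, hmaps⟩ := h g
  refine mem_iUnion₂.2 ⟨m, Finset.mem_range.2 (by omega), ?_⟩
  obtain ⟨a', b', ha', hb', hga', hgb'⟩ := exists_endpoints hl0 hl m (g • x)
  have hn := pow_pos hl0 n
  have hm' := pow_pos hl0 m
  have hinv := hmaps.inv
  have hea := hinv.mem hga'
  have heb := hinv.mem hgb'
  simp only [inv_smul_smul] at hea heb
  have hdist : |((g⁻¹ • a' : centralCantorSet l) : ℝ) - (g⁻¹ • b' : centralCantorSet l)| = l ^ n := by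
    have h1 := hinv.2 a' b' hga' hgb'
    rw [show (a' : ℝ) - b' = -(l ^ m) by rw [ha', hb']; ring, abs_neg, abs_of_pos hm'] at h1
    exact mul_right_cancel₀ hm'.ne' h1
  have h2 := hmaps.2 x (g⁻¹ • a') (SameCyl.refl x) hea
  simp only [smul_inv_smul] at h2
  have h3 : 0 ≤ ((g • x : centralCantorSet l) : ℝ) - a' := by
    rw [ha']
    exact sub_nonneg.2 (leftEnd_le m _)
  rw [abs_of_nonneg h3] at h2
  have h4 : ((g • x : centralCantorSet l) : ℝ) = leftEnd l m (g • x : centralCantorSet l) +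
      l ^ m / l ^ n * |(x : ℝ) - (g⁻¹ • a' : centralCantorSet l)| := by
    rw [← ha', div_mul_eq_mul_div, ← h2, mul_div_cancel_right₀ _ hn.ne']
    ring
  rcases eq_endpoint hl0 hl ha hb hea heb hdist with ⟨h5, -⟩ | ⟨h5, -⟩
  · rw [h5] at h4
    exact Or.inl ⟨_, ⟨_, (g • x).2, rfl⟩, h4.symm⟩
  · rw [h5] at h4
    exact Or.inr ⟨_, ⟨_, (g • x).2, rfl⟩, h4.symm⟩

omit [ContinuousConstSMul G (centralCantorSet l)] in
/-- A finitely generated group acting with an infinite orbit contains an element that contracts an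
interval around a point of the orbit. -/
theorem ActsByLocalSimilarities.exists_contraction (hG : ActsByLocalSimilarities l G)
    [hfg : Group.FG G] {x : centralCantorSet l} (hx : (orbit G x).Infinite) :
    ∃ (φ : G) (y : centralCantorSet l) (N m : ℕ), y ∈ orbit G x ∧ N < m ∧
      MapsCyl (φ • ·) y N m ∧ SameCyl l N y (φ • y) := by
  obtain ⟨c, hc, huniq, hcoc⟩ := exists_cocycle hl0 hl hG
  obtain ⟨S, hS⟩ := Group.fg_def.1 hfg
  have hc1 : ∀ x, c 1 x = 0 := fun x => by
    have := huniq 1 x 0 0 (by simpa using MapsCyl.id x 0)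
    omega
  have hcinv : ∀ g x, c g⁻¹ (g • x) = - c g x := fun g x => by
    have := hcoc g g⁻¹ x
    rw [inv_mul_cancel, hc1] at this
    omega
  let S' : Set G := {s | s = 1 ∨ s ∈ S ∨ s⁻¹ ∈ S}
  have hS'fin : S'.Finite := by
    refine ((Set.finite_singleton (1 : G)).union
      (S.finite_toSet.union S.finite_toSet.inv)).subset ?_
    rintro s (h | h | h)
    · exact Or.inl h
    · exact Or.inr (Or.inl h)
    · exact Or.inr (Or.inr h)
  obtain ⟨N, hN⟩ : ∃ N : ℕ, ∀ s ∈ S', ∀ x n, N ≤ n →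
      ∃ m : ℕ, (m : ℤ) = n + c s x ∧ MapsCyl (s • ·) x n m := by
    choose N hN using hc
    obtain ⟨B, hB⟩ := (hS'fin.image N).bddAbove
    exact ⟨B, fun s hs x n hn => hN s x n ((hB ⟨s, hs, rfl⟩).trans hn)⟩
  have hS'inv : ∀ s ∈ S', s⁻¹ ∈ S' := by
    rintro s (rfl | h | h)
    · exact Or.inl inv_one
    · exact Or.inr (Or.inr (by rwa [inv_inv]))
    · exact Or.inr (Or.inl h)
  -- The inverse maps a cylinder of step `N` around `s • x` to one of step `N - c s x`, which is
  -- nonnegative.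
  have hL : ∀ s ∈ S', ∀ x, c s x ≤ N := by
    intro s hs x
    obtain ⟨m, hm, -⟩ := hN s⁻¹ (hS'inv s hs) (s • x) N le_rfl
    rw [hcinv] at hm
    omega
  let α := {a | ∃ x ∈ centralCantorSet l, leftEnd l N x = a}
  by_contra! hcon
  -- If the height rose above this bound along a word for `g`, `exists_rise` would give a subword
  -- returning to the same cylinder of step `N`, strictly contracting and valid all along: this is
  -- excluded by `hcon`. Applied also to inverses along the orbit, the bound becomes two-sided.
  have hbound : ∀ g y, y ∈ orbit G x → c g y ≤ Nat.card α * N := by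
    intro g y hy
    by_contra! hlt
    obtain ⟨s, hs, n, hn⟩ := exists_wordProd (S := (S : Set G)) (g := g) (by rw [hS]; trivial)
    let col : ℕ → α := fun k => ⟨leftEnd l N (wordProd s k • y : centralCantorSet l), _,
      (wordProd s k • y).2, rfl⟩
    obtain ⟨i, j, hij, hcol, hhlt, hmin⟩ := exists_rise col (fun k => c (wordProd s k) y)
      (by simpa [wordProd] using hc1 y) (L := N) (by positivity) (fun k => by
        simp only [wordProd]
        rw [hcoc]
        have := hL (s k) (hs k) (wordProd s k • y)
        omega) (n := n) (by rwa [hn])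
    obtain ⟨m, hm, hmaps⟩ := mapsCyl_wordProd hl0 hcoc (N := N) (fun k => hN (s k) (hs k)) y hij.le N
      fun k h1 h2 => by
        have := hmin k h1 h2
        omega
    refine hcon _ (wordProd s i • y) N m ?_ (by omega) hmaps ?_
    · exact (mem_orbit_iff.2 ⟨_, rfl⟩ : wordProd s i • y ∈ orbit G y) |> fun h => by
        rwa [orbit_eq_iff.2 hy] at h
    · rw [mul_smul, inv_smul_smul]
      exact congrArg Subtype.val hcol
  set B : ℕ := Nat.card α * N with hBdef
  have hbound' : ∀ g, (c g x).natAbs ≤ B := by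
    intro g
    have h1 := hbound g x (mem_orbit_self x)
    have h2 := hbound g⁻¹ (g • x) (mem_orbit x g)
    rw [hcinv] at h2
    have h3 : ((Nat.card α * N : ℕ) : ℤ) = Nat.card α * N := by push_cast; rfl
    omega
  -- Starting at step `N + B`, heights in `[-B, B]` keep every word at steps at least `N`, where
  -- generators map cylinders to cylinders, and at most `N + 2 * B`.
  refine hx (finite_orbit_of_bounded hl0 hl (n := N + B) (M := N + B + B) fun g => ?_)
  obtain ⟨s, hs, n, rfl⟩ := exists_wordProd (S := (S : Set G)) (g := g) (by rw [hS]; trivial)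
  obtain ⟨m, hm, hmaps⟩ := mapsCyl_wordProd hl0 hcoc (N := N) (fun k => hN (s k) (hs k)) x
    (Nat.zero_le n) (N + B) fun k _ _ => by
      have h1 := hbound' (wordProd s k)
      have h2 := hc1 x
      simp only [wordProd]
      omega
  simp only [wordProd, inv_one, mul_one, one_smul, hc1] at hm hmaps
  have := hbound' (wordProd s n)
  exact ⟨m, by omega, hmaps⟩

end Dynamics
end CantorTits

namespace CantorTits

open Filter Set MulAction Pointwise

/-! ### Minimal closed invariant sets -/

section MinimalSets

variable {G Y : Type*} [Group G] [TopologicalSpace Y] [MulAction G Y] [ContinuousConstSMul G Y]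

/-- Zorn's lemma gives a smallest nonempty closed invariant set, by compactness along chains; each
orbit closure inside it is again such a set, hence all of it. -/
theorem exists_minimal_subMulAction (G : Type*) (Y : Type*) [Group G] [TopologicalSpace Y]
    [MulAction G Y] [ContinuousConstSMul G Y] [CompactSpace Y] [Nonempty Y] :
    ∃ X : SubMulAction G Y, IsClosed (X : Set Y) ∧ (X : Set Y).Nonempty ∧ IsMinimal G X := by
  let S : Set (Set Y) := {s | IsClosed s ∧ s.Nonempty ∧ ∀ (g : G), ∀ x ∈ s, g • x ∈ s}
  obtain ⟨M, -, hM⟩ := zorn_superset_nonempty S (fun c hc hchain hne => by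
    refine ⟨⋂₀ c, ⟨isClosed_sInter fun s hs => (hc hs).1, ?_, ?_⟩, fun s hs => sInter_subset_of_mem hs⟩
    · have := hne.to_subtype
      rw [sInter_eq_iInter]
      refine IsCompact.nonempty_iInter_of_directed_nonempty_isCompact_isClosed _ ?_
        (fun s => (hc s.2).2.1) (fun s => (hc s.2).1.isCompact) fun s => (hc s.2).1
      rintro ⟨s, hs⟩ ⟨t, ht⟩
      rcases hchain.total hs ht with h | h
      · exact ⟨⟨s, hs⟩, Subset.rfl, h⟩
      · exact ⟨⟨t, ht⟩, h, Subset.rfl⟩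
    · intro g x hx s hs
      exact (hc hs).2.2 g x (hx s hs)) univ ⟨isClosed_univ, univ_nonempty, fun _ _ _ => mem_univ _⟩
  obtain ⟨⟨hMc, hMne, hMinv⟩, hMmin⟩ := hM
  let X : SubMulAction G Y := ⟨M, fun g x hx => hMinv g _ hx⟩
  refine ⟨X, hMc, hMne, ⟨fun x => ?_⟩⟩
  have hcl : closure (orbit G (x : Y)) ∈ S := by
    refine ⟨isClosed_closure, (nonempty_orbit _).closure, fun g y hy => ?_⟩
    have h1 : g • y ∈ closure (g • orbit G (x : Y)) := by
      rw [closure_smul]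
      exact smul_mem_smul_set hy
    rwa [smul_orbit] at h1
  have hsub : closure (orbit G (x : Y)) ⊆ M := hMc.closure_subset_iff.2 (by
    rintro _ ⟨g, rfl⟩
    exact hMinv g _ x.2)
  have hall := hMmin hcl hsub
  intro y
  have hy : (y : Y) ∈ closure (orbit G (x : Y)) := hall y.2
  rw [closure_subtype]
  convert hy using 2
  ext z
  constructor
  · rintro ⟨_, ⟨g, rfl⟩, rfl⟩
    exact ⟨g, rfl⟩
  · rintro ⟨g, rfl⟩
    exact ⟨g • x, ⟨g, rfl⟩, rfl⟩

omit [ContinuousConstSMul G Y] in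
theorem Attracts.restrict {X : SubMulAction G Y} {T : G} {α : X} (h : Attracts T (α : Y)) :
    Attracts T α := by
  obtain ⟨W, hW, hc⟩ := h
  refine ⟨Subtype.val ⁻¹' W, continuous_subtype_val.continuousAt.preimage_mem_nhds hW,
    fun U hU => ?_⟩
  rw [nhds_subtype_eq_comap] at hU
  obtain ⟨U', hU', hUU'⟩ := hU
  exact (hc U' hU').mono fun n hn y hy => hUU' (hn _ hy)

omit [ContinuousConstSMul G Y] in
-- Closedness is needed for basins: the attracting point is a limit of points of `X`, so it belongs
-- to `X`.
theorem Trichotomy.restrict {X : SubMulAction G Y} (hX : IsClosed (X : Set Y)) {g : G}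
    (h : Trichotomy Y g) : Trichotomy X g := by
  intro x
  rcases h x with ⟨k, hk, h⟩ | ⟨k, hk, α, hα, h⟩ | ⟨k, hk, h⟩
  · left
    exact ⟨k, hk, (continuous_subtype_val.continuousAt.eventually h).mono fun y hy => Subtype.ext hy⟩
  · right; left
    have hαX : α ∈ (X : Set Y) :=
      hX.mem_of_tendsto h (Eventually.of_forall fun n => X.smul_mem _ x.2)
    exact ⟨k, hk, ⟨α, hαX⟩, Attracts.restrict hα, tendsto_subtype_rng.2 h⟩
  · right; right
    exact ⟨k, hk, Attracts.restrict h⟩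

omit [TopologicalSpace Y] [ContinuousConstSMul G Y] in
theorem infinite_orbit_restrict {X : SubMulAction G Y} (h : ∀ y : Y, (orbit G y).Infinite)
    (x : X) : (orbit G x).Infinite := by
  refine Set.Infinite.of_image Subtype.val ((h x).mono ?_)
  rintro _ ⟨g, rfl⟩
  exact ⟨g • x, ⟨g, rfl⟩, rfl⟩

end MinimalSets

/-! ### The alternative for local similarities of the Cantor set -/

section CantorAction

variable {l : ℝ} (hl0 : 0 < l) (hl : l < 1 / 2) {G : Type*} [Group G]
  [MulAction G (centralCantorSet l)] [ContinuousConstSMul G (centralCantorSet l)]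
include hl0 hl

/-- A finitely generated group acting on a central Cantor set by local similarities contains a free
group or has a finite orbit. -/
theorem ActsByLocalSimilarities.free_or_finite_orbit (hG : ActsByLocalSimilarities l G)
    [Group.FG G] : (∃ φ : FreeGroup (Fin 2) →* G, Function.Injective φ) ∨
      ∃ x : centralCantorSet l, (orbit G x).Finite := by
  rw [or_iff_not_imp_right]
  intro hinf
  replace hinf : ∀ x : centralCantorSet l, (orbit G x).Infinite := fun x h => hinf ⟨x, h⟩
  have : CompactSpace (centralCantorSet l) :=
    isCompact_iff_compactSpace.1 (isCompact_centralCantorSet l)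
  have : Nonempty (centralCantorSet l) :=
    ⟨⟨0, (endpoint_mem_cantorSet hl0 hl (n := 0) (a := 0) (by simp [cantorIntervals])).1⟩⟩
  obtain ⟨X, hXc, ⟨x, hx⟩, hXmin⟩ := exists_minimal_subMulAction G (centralCantorSet l)
  have : CompactSpace X := isCompact_iff_compactSpace.1 hXc.isCompact
  have : Nonempty X := ⟨⟨x, hx⟩⟩
  have : ContinuousConstSMul G X :=
    ⟨fun g => ((continuous_const_smul g).comp continuous_subtype_val).subtype_mk _⟩
  have hinfX : ∀ x : X, (orbit G x).Infinite := infinite_orbit_restrict hinf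
  obtain ⟨φ, y, N, m, hy, hNm, hmaps, hsame⟩ := hG.exists_contraction hl0 hl (hinf x)
  have hyX : y ∈ X := by
    obtain ⟨g, rfl⟩ := hy
    exact X.smul_mem g hx
  -- As `X` is perfect, it has points `z ≠ y` arbitrarily near `y`. Local periodicity would make
  -- some `φ ^ k` fix both, but it multiplies their distance by `(l ^ (m - N)) ^ k < 1`.
  have hper : ¬ LocallyPeriodic φ (⟨y, hyX⟩ : X) := by
    rintro ⟨k, hk, h⟩
    have := nhdsWithin_compl_neBot_of_isMinimal (G := G) hinfX ⟨y, hyX⟩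
    have h1 : ∀ᶠ z : X in 𝓝 ⟨y, hyX⟩, SameCyl l N y z :=
      continuous_subtype_val.continuousAt.eventually (cyl_mem_nhds hl0 hl N y)
    obtain ⟨z, ⟨hz1, hz2⟩, hz3⟩ :=
      ((eventually_nhdsWithin_of_eventually_nhds (s := {⟨y, hyX⟩}ᶜ) (h.and h1)).and eventually_mem_nhdsWithin).exists
    have hz1' : φ ^ k • (z : centralCantorSet l) = z := congrArg Subtype.val hz1
    have hy1' : φ ^ k • y = y := congrArg Subtype.val h.self_of_nhds
    have h2 := (hmaps.abs_pow_sub hl0 hl hNm.le hsame k hz2 (SameCyl.refl y)).2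
    rw [hz1', hy1'] at h2
    have h3 : 0 < |((z : centralCantorSet l) : ℝ) - y| :=
      abs_pos.2 (sub_ne_zero.2 fun h => hz3 (Subtype.ext (Subtype.ext h)))
    have h4 : (l ^ (m - N)) ^ k < 1 :=
      pow_lt_one₀ (by positivity) (pow_lt_one₀ hl0.le (by linarith) (by omega)) hk.ne'
    nlinarith
  exact exists_free_of_trichotomy hinfX ((hG.trichotomy hl0 hl φ).restrict hXc)
    ((hG.trichotomy hl0 hl φ⁻¹).restrict hXc) hper

end CantorAction
end CantorTits

namespace CantorTits

open Filter Set MulAction Pointwise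

/-! ### Smooth maps of the surface are strictly differentiable along the Cantor set -/

section Segment

/-- Subtracting the linear part leaves a function whose derivative is continuous and vanishes at
`t`; the mean value inequality on the convex set `[0, 1]` makes it `δ`-Lipschitz near `t`. -/
theorem strict_deriv_within {w : ℝ → ℝ} {t : ℝ} (ht : t ∈ Icc (0 : ℝ) 1)
    (hw : ContDiffWithinAt ℝ ∞ w (Icc 0 1) t) {δ : ℝ} (hδ : 0 < δ) :
    ∃ T ∈ 𝓝[Icc 0 1] t, ∀ a ∈ T, ∀ b ∈ T,
      |w a - w b - fderivWithin ℝ w (Icc 0 1) t 1 * (a - b)| ≤ δ * |a - b| := by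
  set L := fderivWithin ℝ w (Icc 0 1) t with hL
  have hu : UniqueDiffOn ℝ (Icc (0 : ℝ) 1) := uniqueDiffOn_Icc one_pos
  have hw1 : ContDiffWithinAt ℝ 1 w (Icc 0 1) t := hw.of_le (by exact_mod_cast le_top)
  have hev : ∀ᶠ y in 𝓝[Icc 0 1] t, HasFDerivWithinAt (fun a => w a - L a)
      (fderivWithin ℝ w (Icc 0 1) y - L) (Icc 0 1) y := by
    have h1 := hw1.eventually (by simp)
    rw [insert_eq_of_mem ht] at h1
    filter_upwards [h1] with y hy
    exact (hy.differentiableWithinAt (by simp)).hasFDerivWithinAt.sub L.hasFDerivWithinAt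
  have hcont : ContinuousWithinAt (fun y => fderivWithin ℝ w (Icc 0 1) y - L) (Icc 0 1) t :=
    (hw.fderivWithin_right (m := 0) hu (by simp) ht).continuousWithinAt.sub
      continuousWithinAt_const
  obtain ⟨T, hT, hlip⟩ := (convex_Icc (0 : ℝ) 1)
    |>.exists_nhdsWithin_lipschitzOnWith_of_hasFDerivWithinAt_of_nnnorm_lt hev hcont
    ⟨δ, hδ.le⟩ (by rw [← hL, sub_self, nnnorm_zero]; exact hδ)
  refine ⟨T, hT, fun a ha b hb => ?_⟩
  have h1 := hlip.dist_le_mul a ha b hb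
  rw [Real.dist_eq, Real.dist_eq] at h1
  have hLin : ∀ a : ℝ, L a = L 1 * a := fun a => by
    have := L.map_smul a 1
    rw [smul_eq_mul, smul_eq_mul, mul_one] at this
    rw [this, mul_comm]
  rw [hLin a, hLin b] at h1
  rw [show w a - w b - L 1 * (a - b) = w a - L 1 * a - (w b - L 1 * b) by ring]
  exact h1

variable {H : Type v} [TopologicalSpace H] {I : ModelWithCorners ℝ (EuclideanSpace ℝ (Fin 2)) H}
  {S : Type w} [TopologicalSpace S] [ChartedSpace H S] [IsManifold I ∞ S] {l : ℝ} {e : ℝ → S}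

omit [IsManifold I ∞ S] in
theorem contDiffWithinAt_chart {h : ℝ → S} {t : ℝ} (hh : ContMDiffWithinAt 𝓘(ℝ, ℝ) I ∞ h (Icc 0 1) t) :
    ContDiffWithinAt ℝ ∞ (extChartAt I (h t) ∘ h) (Icc 0 1) t :=
  contMDiffWithinAt_iff_contDiffWithinAt.1 (contMDiffWithinAt_iff_target.1 hh).2

/-- A smooth map of the surface preserving the Cantor set in an embedded segment induces a strictly
differentiable map of the Cantor set. -/
theorem strictDiff_of_contMDiff (he : IsEmbeddedSegment I e) {f : S → S} (hf : ContMDiff I I ∞ f)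
    {g : centralCantorSet l → centralCantorSet l} (hg : Continuous g)
    (hfg : ∀ x : centralCantorSet l, e (g x) = f (e x)) : StrictDiff g := by
  intro x
  have hx := centralCantorSet_subset_Icc l x.2
  have hs := centralCantorSet_subset_Icc l (g x).2
  have hu := contDiffWithinAt_chart (he.contMDiffOn _ hs)
  have hv := contDiffWithinAt_chart (h := f ∘ e) (t := (x : ℝ))
    (hf.contMDiffAt.comp_contMDiffWithinAt _ (he.contMDiffOn _ hx))
  rw [Function.comp_apply, ← hfg] at hv
  set φ := extChartAt I (e (g x))
  have hne : fderivWithin ℝ (φ ∘ e) (Icc 0 1) (g x) ≠ 0 := by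
    have h1 := he.deriv_ne_zero _ hs
    have h2 : MDifferentiableWithinAt 𝓘(ℝ, ℝ) I e (Icc 0 1) (g x) :=
      (he.contMDiffOn _ hs).mdifferentiableWithinAt (by simp)
    have h3 := h2.mfderivWithin
    simp only [writtenInExtChartAt, extChartAt_model_space_eq_id,
      PartialEquiv.refl_symm, PartialEquiv.refl_coe, Function.comp_id, preimage_id,
      ModelWithCorners.range_eq_univ, inter_univ, id_eq] at h3
    exact fun h => h1 (h3.trans h)
  have hne1 : fderivWithin ℝ (φ ∘ e) (Icc 0 1) (g x) 1 ≠ 0 := fun h =>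
    hne (ContinuousLinearMap.ext_ring h)
  -- The functional `ℓ` is 1 on the velocity of the segment at `g x`, so `ℓ ∘ φ ∘ e` is a parameter
  -- of the segment with derivative 1 there. Since `e ∘ g = f ∘ e` on the Cantor set, comparing it
  -- with `ℓ ∘ φ ∘ f ∘ e` recovers the increments of `g`.
  obtain ⟨ℓ, hℓ⟩ := SeparatingDual.exists_eq_one (R := ℝ) hne1
  have hU : ContDiffWithinAt ℝ ∞ (ℓ ∘ φ ∘ e) (Icc 0 1) (g x) :=
    ℓ.contDiff.contDiffAt.comp_contDiffWithinAt _ hu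
  have hV : ContDiffWithinAt ℝ ∞ (ℓ ∘ φ ∘ f ∘ e) (Icc 0 1) x :=
    ℓ.contDiff.contDiffAt.comp_contDiffWithinAt _ hv
  have hU1 : fderivWithin ℝ (ℓ ∘ φ ∘ e) (Icc 0 1) (g x) 1 = 1 := by
    have h1 := (hu.differentiableWithinAt (by simp)).hasFDerivWithinAt
    have h2 := (ℓ.hasFDerivAt.comp_hasFDerivWithinAt _ h1).fderivWithin
      (uniqueDiffOn_Icc one_pos _ hs)
    rw [h2, ContinuousLinearMap.comp_apply, hℓ]
  set ρ := fderivWithin ℝ (ℓ ∘ φ ∘ f ∘ e) (Icc 0 1) x 1 with hρ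
  refine ⟨ρ, fun ε hε => ?_⟩
  -- The bound `1 / 2` allows `δ * |D|` to be absorbed into `|D|`, giving `|D| ≤ 2 * (|ρ| + 1) *
  -- |Q|`; the total error is then `δ * (1 + 2 * (|ρ| + 1)) * |Q|`, whence the denominator `2 * |ρ|
  -- + 3`.
  have hδ : 0 < min (1 / 2) (ε / (2 * |ρ| + 3)) := lt_min (by norm_num) (by positivity)
  set δ := min (1 / 2) (ε / (2 * |ρ| + 3)) with hδdef
  have hδ1 : δ ≤ 1 / 2 := min_le_left _ _
  have hδ2 : δ * (2 * |ρ| + 3) ≤ ε := (le_div_iff₀ (by positivity)).1 (min_le_right _ _)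
  obtain ⟨T, hT, hTU⟩ := strict_deriv_within hs hU hδ
  obtain ⟨T', hT', hTV⟩ := strict_deriv_within hx hV hδ
  have hlim : Tendsto (fun y : centralCantorSet l => (y : ℝ)) (𝓝 x) (𝓝[Icc 0 1] (x : ℝ)) :=
    tendsto_nhdsWithin_of_tendsto_nhds_of_eventually_within _ continuous_subtype_val.continuousAt
      (Eventually.of_forall fun y => centralCantorSet_subset_Icc l y.2)
  have hlim' : Tendsto (fun y : centralCantorSet l => (g y : ℝ)) (𝓝 x) (𝓝[Icc 0 1] (g x : ℝ)) :=
    tendsto_nhdsWithin_of_tendsto_nhds_of_eventually_within _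
      (continuous_subtype_val.comp hg).continuousAt
      (Eventually.of_forall fun y => centralCantorSet_subset_Icc l (g y).2)
  have hev := (hlim.eventually hT').and (hlim'.eventually hT)
  rw [nhds_prod_eq]
  filter_upwards [prod_mem_prod hev hev] with p hp
  obtain ⟨⟨hp1, hp2⟩, hp3, hp4⟩ := hp
  have k1 := hTU _ hp2 _ hp4
  have k2 := hTV _ hp1 _ hp3
  rw [hU1, one_mul] at k1
  rw [← hρ] at k2
  simp only [Function.comp_apply, hfg] at k1 k2
  set A := ℓ (φ (f (e p.1))) - ℓ (φ (f (e p.2)))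
  set D := (g p.1 : ℝ) - g p.2
  set Q := (p.1 : ℝ) - p.2
  have k3 : |A| ≤ (|ρ| + δ) * |Q| := by
    have := abs_sub_abs_le_abs_sub A (ρ * Q)
    rw [abs_mul] at this
    nlinarith
  have k4 : |D| ≤ 2 * (|ρ| + 1) * |Q| := by
    have h1 := abs_sub_abs_le_abs_sub D A
    rw [abs_sub_comm D A] at h1
    have h2 : δ * |D| ≤ 1 / 2 * |D| := mul_le_mul_of_nonneg_right hδ1 (abs_nonneg _)
    have h3 : δ * |Q| ≤ 1 / 2 * |Q| := mul_le_mul_of_nonneg_right hδ1 (abs_nonneg _)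
    nlinarith [abs_nonneg Q]
  calc |D - ρ * Q| = |(A - ρ * Q) - (A - D)| := by ring_nf
    _ ≤ |A - ρ * Q| + |A - D| := abs_sub _ _
    _ ≤ δ * |Q| + δ * (2 * (|ρ| + 1) * |Q|) :=
      add_le_add k2 (k1.trans (mul_le_mul_of_nonneg_left k4 hδ.le))
    _ = δ * (2 * |ρ| + 3) * |Q| := by ring
    _ ≤ ε * |Q| := mul_le_mul_of_nonneg_right hδ2 (abs_nonneg _)

end Segment
end CantorTits

namespace CantorTits

open Filter Set MulAction

/-! ### The mapping class group acting on the Cantor set -/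

section MappingClassAction

variable {H : Type v} [TopologicalSpace H] {I : ModelWithCorners ℝ (EuclideanSpace ℝ (Fin 2)) H}
  {S : Type w} [TopologicalSpace S] [ChartedSpace H S] [IsManifold I ∞ S]
  (o : SurfaceOrientation I S) (K : Set S)

/-- The action of `Diff(S, K)` on `K`. -/
noncomputable def relDiffeoPerm : relDiffeo o K →* Equiv.Perm K where
  toFun f :=
    { toFun := fun p => ⟨f.1 p, f.2.2.subset ⟨p, p.2, rfl⟩⟩
      invFun := fun p => ⟨f⁻¹.1 p, f⁻¹.2.2.subset ⟨p, p.2, rfl⟩⟩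
      left_inv := fun p => Subtype.ext (diffeo_inv_apply f.1 p)
      right_inv := fun p => Subtype.ext (diffeo_apply_inv f.1 p) }
  map_one' := rfl
  map_mul' _ _ := rfl

variable {K}

/-- The action of the mapping class group on a totally disconnected set `K`. -/
noncomputable def mcgPerm (hK : IsTotallyDisconnected K) : SmoothMCG o K →* Equiv.Perm K :=
  QuotientGroup.lift (relDiffeoZero o K) (relDiffeoPerm o K) fun f hf => by
    have h : (f : SmoothMCG o K) = (1 : relDiffeo o K) := by
      rw [QuotientGroup.mk_one]
      exact (QuotientGroup.eq_one_iff f).2 hf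
    exact Equiv.ext fun p => Subtype.ext (apply_eq_of_mk_eq hK h p.2)

variable {o}

/-- A continuous injection of a compact space into a Hausdorff space is an embedding, and embeddings
preserve total disconnectedness. -/
theorem IsEmbeddedSegment.isTotallyDisconnected_image [T2Space S] {e : ℝ → S} {l : ℝ}
    (he : IsEmbeddedSegment I e) (hl0 : 0 < l) (hl : l < 1 / 2) :
    IsTotallyDisconnected (e '' centralCantorSet l) := by
  have := isCompact_iff_compactSpace.1 (isCompact_centralCantorSet l)
  have hc : Continuous ((centralCantorSet l).domRestrict e) :=
    (he.contMDiffOn.continuousOn.mono (centralCantorSet_subset_Icc l)).domRestrict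
  have hemb : Topology.IsEmbedding ((centralCantorSet l).domRestrict e) :=
    (hc.isClosedEmbedding (injOn_iff_injective.1
      (he.injOn.mono (centralCantorSet_subset_Icc l)))).isEmbedding
  rw [← range_domRestrict, ← image_univ]
  refine hemb.isTotallyDisconnected_image.2 ?_
  have := (Topology.IsEmbedding.subtypeVal (p := (· ∈ centralCantorSet l))).isTotallyDisconnected_image
    (s := univ)
  rw [← this, image_univ, Subtype.range_coe]
  exact isTotallyDisconnected_centralCantorSet hl0 hl

end MappingClassAction

end CantorTits

theorem theorem1p3 {H : Type v} [TopologicalSpace H]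
    (I : ModelWithCorners ℝ (EuclideanSpace ℝ (Fin 2)) H)
    (S : Type w) [TopologicalSpace S] [T2Space S] [SecondCountableTopology S]
    [ChartedSpace H S] [IsManifold I ∞ S] (o : SurfaceOrientation I S)
    (l : ℝ) (hl0 : 0 < l) (hl : l < 1 / 2)
    (e : ℝ → S) (he : IsEmbeddedSegment I e)
    (Γ : Subgroup (SmoothMCG o (e '' centralCantorSet l))) (hΓ : Γ.FG) :
    (∃ φ : FreeGroup (Fin 2) →* Γ, Function.Injective φ) ∨
    (∃ p ∈ e '' centralCantorSet l, (mcgOrbit Γ p).Finite) := by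
  have hK := CantorTits.IsEmbeddedSegment.isTotallyDisconnected_image he hl0 hl
  have hinj : Set.InjOn e (centralCantorSet l) := he.injOn.mono (CantorTits.centralCantorSet_subset_Icc l)
  let E : centralCantorSet l ≃ e '' centralCantorSet l := Equiv.Set.imageOfInjOn e _ hinj
  let ψ : Γ →* Equiv.Perm (centralCantorSet l) :=
    (E.symm.permCongrHom.toMonoidHom.comp (CantorTits.mcgPerm o hK)).comp Γ.subtype
  let : MulAction Γ (centralCantorSet l) := MulAction.compHom _ ψ
  -- The abstract action, transported to the parameter set by `e`, is computed by any
  -- representative; continuity, strict differentiability and the comparison of orbits all rest on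
  -- this.
  have hspec : ∀ (γ : Γ) (f : relDiffeo o (e '' centralCantorSet l)),
      (f : SmoothMCG o (e '' centralCantorSet l)) = γ → ∀ x : centralCantorSet l,
        e (γ • x : centralCantorSet l) = f.1 (e x) := by
    rintro ⟨_, hγ⟩ f rfl x
    have h1 : E ((⟨(f : SmoothMCG o (e '' centralCantorSet l)), hγ⟩ : Γ) • x) =
        CantorTits.mcgPerm o hK (f : SmoothMCG o (e '' centralCantorSet l)) (E x) :=
      E.apply_symm_apply _
    exact congrArg Subtype.val h1
  have := isCompact_iff_compactSpace.1 (CantorTits.isCompact_centralCantorSet l)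
  have hemb : Topology.IsEmbedding ((centralCantorSet l).domRestrict e) :=
    ((he.contMDiffOn.continuousOn.mono (CantorTits.centralCantorSet_subset_Icc l)).domRestrict.isClosedEmbedding
      (Set.injOn_iff_injective.1 hinj)).isEmbedding
  have hcont : ContinuousConstSMul Γ (centralCantorSet l) := by
    refine ⟨fun γ => hemb.continuous_iff.2 ?_⟩
    obtain ⟨f, hf⟩ := QuotientGroup.mk_surjective (γ : SmoothMCG o (e '' centralCantorSet l))
    have h1 : (centralCantorSet l).domRestrict e ∘ (γ • ·) = f.1 ∘ (centralCantorSet l).domRestrict e :=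
      funext fun x => hspec γ f hf x
    rw [h1]
    exact f.1.continuous.comp hemb.continuous
  have hdiff : ∀ γ : Γ, CantorTits.StrictDiff (γ • · : centralCantorSet l → centralCantorSet l) := by
    intro γ
    obtain ⟨f, hf⟩ := QuotientGroup.mk_surjective (γ : SmoothMCG o (e '' centralCantorSet l))
    exact CantorTits.strictDiff_of_contMDiff he f.1.contMDiff (continuous_const_smul γ) (hspec γ f hf)
  have hG : CantorTits.ActsByLocalSimilarities l Γ := fun γ =>
    CantorTits.StrictDiff.exists_localSimilar hl0 hl (g := MulAction.toPerm γ) (hdiff γ) (hdiff γ⁻¹)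
      (continuous_const_smul γ) (continuous_const_smul γ⁻¹)
  have : Group.FG Γ := (Group.fg_iff_subgroup_fg Γ).2 hΓ
  refine (hG.free_or_finite_orbit hl0 hl).imp id ?_
  rintro ⟨x, hx⟩
  refine ⟨e x, ⟨x, x.2, rfl⟩, (hx.image fun y : centralCantorSet l => e y).subset ?_⟩
  rintro _ ⟨f, hf, rfl⟩
  exact ⟨(⟨_, hf⟩ : Γ) • x, MulAction.mem_orbit _ _, hspec ⟨_, hf⟩ f rfl x⟩
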